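/- Let $d,n\ge 1$ and let $V_1,\dots,V_n:\mathbb R^d\to\mathbb R$ be differentiable, $V=\sum_{i=1}^n V_i$ with $e^{-V}$ integrable, $\gamma>0$, $\sigma=\sqrt{2\gamma}$. Let $\pi(d\theta,dr)=Z^{-1}e^{-V(\theta)-\|r\|^2/2}\,d\theta\,dr$ on $\mathbb R^d\times\mathbb R^d$ be the invariant distribution of underdamped Langevin dynamics, whose generator is $$\mathcal L f = r^{T}\nabla_\theta f-(\gamma r+\nabla V(\theta))^{T}\nabla_r f+\gamma\Delta_r f .$$ For a step size $h>0$ consider the Euler–Maruyama chain with stochastic gradients $$\theta_{k+1}=\theta_k+h r_k,\qquad r_{k+1}=r_k-h\big(n\nabla V_{I_k}(\theta_k)+\gamma r_k\big)+\sigma\sqrt h\,\xi_{k+1},$$ started from an arbitrary random $(\theta_0,r_0)$, where $\mathcal F_k$ is the filtration of the information available before the $k$-th iteration, $\xi_{k+1}$ is a standard Gaussian vector in $\mathbb R^d$ independent of $\mathcal F_k$ and $I_k$ jointly, and where, given $\mathcal F_k$, the index $I_k\in\{1,\dots,n\}$ is drawn according to one of the following rules at the current state: (a) SGHMC: uniformly;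 (b) exact EWSG: $\mathbb P(I_k=i\mid\mathcal F_k)=p_i\propto\exp\big(-\tfrac12\|x+\sum_j a_j\|^2+\tfrac12\|x+n a_i\|^2\big)$ with $a_i=\sqrt h\,\nabla V_i(\theta_k)/\sigma$; (c) practical EWSG: the law after $M\ge 0$ steps, started from the uniform distribution, of the Metropolis chain on indices with uniform proposals $j$ and acceptance probability $\min\{1,\exp(\tfrac12\|x+n a_j\|^2-\tfrac12\|x+n a_i\|^2)\}$. In (b) and (c) the hyper-parameter $x=x(\theta_k,r_k)$ is $O(\sqrt h)$ in the sense that $\|x(\theta,r)\|\le c\sqrt h\,(1+\|r\|)$ (for instance $x=\sqrt h\,\gamma r_k/\sigma$, or a constant vector with $\|x\|\le c\sqrt h$). Let $\phi:\mathbb R^d\times\mathbb R^d\to\mathbb R$ be $\pi$-integrable, $\bar\phi=\int\phi\,d\pi$ and $\widehat\phi_K=\frac1K\sum_{k=1}^K\phi(\theta_k,r_k)$. Assume that $\mathbb E\|\nabla V_i(\theta_k)\|^l<M_1$ and $\mathbb E\|r_k\|^l<M_2$ for all $l=1,\dots,12$, $i=1,\dots,n$, $k\ge0$, and that there is a $C^3$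 solution $\psi$ of the Poisson equation $\mathcal L\psi=\phi-\bar\phi$ with $\|D^l\psi\|_\infty<M_3$ for $l=0,1,2,3$. Then there are constants $C_1,C_2,C_3>0$, depending only on $M_1,M_2,M_3$ and on the fixed parameters $d,n,\gamma,c$ (not on $h$, $K$, $M$, the $V_i$, $\phi$, $\psi$ or the chain), such that for all $K\ge1$, with $T=Kh$, $$\mathbb E\big(\widehat\phi_K-\bar\phi\big)^2\le C_1\frac1T+C_2\frac hT\cdot\frac1K\sum_{k=0}^{K-1}\mathbb E\big[\operatorname{Tr}\operatorname{cov}(n\nabla V_{I_k}(\theta_k)\mid\mathcal F_k)\big]+C_3h^2 .$$ -/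

import Mathlib

open MeasureTheory ProbabilityTheory

noncomputable section

namespace EWSG

/-- The Euclidean space `ℝ^d`. -/
abbrev E (d : ℕ) : Type := EuclideanSpace ℝ (Fin d)

/-- The phase space `ℝ^d × ℝ^d` of pairs `(θ, r)` (position, momentum). -/
abbrev Phase (d : ℕ) : Type := E d × E d

section Dynamics

variable {d n : ℕ}

/-- The full potential `V = ∑ i, V_i`. -/
def totalPotential (V : Fin n → E d → ℝ) (θ : E d) : ℝ := ∑ i, V i θ

/-- The Hamiltonian `V(θ) + ‖r‖² / 2`. -/
def hamiltonian (V : Fin n → E d → ℝ) (X : Phase d) : ℝ :=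
  totalPotential V X.1 + ‖X.2‖ ^ 2 / 2

/-- The partition function `Z = ∫ exp (-(V(θ) + ‖r‖² / 2)) dθ dr`. -/
def partitionFunction (V : Fin n → E d → ℝ) : ℝ :=
  ∫ X : Phase d, Real.exp (-hamiltonian V X)

/-- The Gibbs measure `π(dθ, dr) = Z⁻¹ exp (-(V(θ) + ‖r‖² / 2)) dθ dr` (unit temperature). -/
def gibbs (V : Fin n → E d → ℝ) : Measure (Phase d) :=
  (volume : Measure (Phase d)).withDensity
    fun X => ENNReal.ofReal ((partitionFunction V)⁻¹ * Real.exp (-hamiltonian V X))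

/-- The partial gradient `∇_θ f` at `X = (θ, r)`. -/
def gradPos (f : Phase d → ℝ) (X : Phase d) : E d := gradient (fun θ => f (θ, X.2)) X.1

/-- The partial gradient `∇_r f` at `X = (θ, r)`. -/
def gradMom (f : Phase d → ℝ) (X : Phase d) : E d := gradient (fun r => f (X.1, r)) X.2

/-- The partial Laplacian `Δ_r f` at `X = (θ, r)`. -/
def laplacianMom (f : Phase d → ℝ) (X : Phase d) : ℝ :=
  Laplacian.laplacian (fun r => f (X.1, r)) X.2

/-- The generator of `dθ = r dt`, `dr = -(∇V(θ) + γ r) dt + √(2γ) dW`: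
`L f = r ⬝ ∇_θ f - (γ r + ∇V(θ)) ⬝ ∇_r f + γ Δ_r f`. -/
def generator (γ : ℝ) (V : Fin n → E d → ℝ) (f : Phase d → ℝ) (X : Phase d) : ℝ :=
  inner ℝ X.2 (gradPos f X)
    - inner ℝ (γ • X.2 + gradient (totalPotential V) X.1) (gradMom f X)
    + γ * laplacianMom f X

end Dynamics

section Sampling

variable {d n : ℕ}

/-- The noise amplitude `σ = √(2γ)`. -/
def noiseAmp (γ : ℝ) : ℝ := Real.sqrt (2 * γ)

/-- The scaled gradient `a_i = √h ∇V_i(θ) / σ`. -/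
def scaledGrad (γ h : ℝ) (V : Fin n → E d → ℝ) (θ : E d) (i : Fin n) : E d :=
  (Real.sqrt h / noiseAmp γ) • gradient (V i) θ

/-- The unnormalized EWSG weight `exp (-‖x + ∑_j a_j‖² / 2 + ‖x + n a_i‖² / 2)`. -/
def expWeight (γ h : ℝ) (V : Fin n → E d → ℝ) (x θ : E d) (i : Fin n) : ℝ :=
  Real.exp (-(‖x + ∑ j, scaledGrad γ h V θ j‖ ^ 2 / 2)
    + ‖x + (n : ℝ) • scaledGrad γ h V θ i‖ ^ 2 / 2)

/-- The EWSG probability `p_i`, the normalization of `expWeight`. -/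
def ewsgProb (γ h : ℝ) (V : Fin n → E d → ℝ) (x θ : E d) (i : Fin n) : ℝ :=
  expWeight γ h V x θ i / ∑ j, expWeight γ h V x θ j

/-- The Metropolis probability of accepting the move from `i` to the proposed index `j`:
`min {1, exp (‖x + n a_j‖² / 2 - ‖x + n a_i‖² / 2)}`. -/
def acceptProb (γ h : ℝ) (V : Fin n → E d → ℝ) (x θ : E d) (i j : Fin n) : ℝ :=
  min 1 (Real.exp (‖x + (n : ℝ) • scaledGrad γ h V θ j‖ ^ 2 / 2
    - ‖x + (n : ℝ) • scaledGrad γ h V θ i‖ ^ 2 / 2))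

/-- Transition probability from `i` to `j` of the Metropolis index chain: propose an index
uniformly, move to it if it is accepted, and stay at `i` otherwise. -/
def metropolisKernel (γ h : ℝ) (V : Fin n → E d → ℝ) (x θ : E d) (i j : Fin n) : ℝ :=
  (1 / (n : ℝ)) * acceptProb γ h V x θ i j
    + (if i = j then ∑ l, (1 / (n : ℝ)) * (1 - acceptProb γ h V x θ i l) else 0)

/-- Law of the index after `M` Metropolis steps, started from the uniform distribution. -/
def metropolisProb (γ h : ℝ) (V : Fin n → E d → ℝ) (x θ : E d) : ℕ → Fin n → ℝ
  | 0 => fun _ => 1 / (n : ℝ)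
  | M + 1 => fun j =>
      ∑ i, metropolisProb γ h V x θ M i * metropolisKernel γ h V x θ i j

/-- How the data index is drawn from the current state `(θ, r)`. The (possibly state-dependent)
hyper-parameter of EWSG is a function `x` of `(θ, r)`. -/
inductive IndexScheme (d : ℕ) : Type
  /-- SGHMC: uniform subsampling. -/
  | uniform : IndexScheme d
  /-- EWSG with the exact exponential weights. -/
  | ewsg (x : Phase d → E d) : IndexScheme d
  /-- EWSG with the weights approximated by `M` steps of the Metropolis index chain. -/
  | ewsgMetropolis (x : Phase d → E d) (M : ℕ) : IndexScheme d

/-- The probability that the index `i` is drawn in the state `X = (θ, r)`. -/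
def IndexScheme.prob (S : IndexScheme d) (γ h : ℝ) (V : Fin n → E d → ℝ) (X : Phase d)
    (i : Fin n) : ℝ :=
  match S with
  | .uniform => 1 / (n : ℝ)
  | .ewsg x => ewsgProb γ h V (x X) X.1 i
  | .ewsgMetropolis x M => metropolisProb γ h V (x X) X.1 M i

/-- `x = O(√h)` for a hyper-parameter function: `‖x(θ, r)‖ ≤ c √h (1 + ‖r‖)`. This covers a
constant vector of norm at most `c √h`, and `x = √h γ r / σ`. -/
def HyperparamBound (c h : ℝ) (x : Phase d → E d) : Prop :=
  Measurable x ∧ ∀ X : Phase d, ‖x X‖ ≤ c * Real.sqrt h * (1 + ‖X.2‖)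

/-- The hyper-parameter of the scheme, if there is one, is `O(√h)` with constant `c`. -/
def IndexScheme.Admissible (S : IndexScheme d) (c h : ℝ) : Prop :=
  match S with
  | .uniform => True
  | .ewsg x => HyperparamBound c h x
  | .ewsgMetropolis x _ => HyperparamBound c h x

/-- The Euler-Maruyama chain of stochastic-gradient underdamped Langevin dynamics with step size
`h`: `I k` is the datum used in the `k`-th iteration, `ξ (k + 1)` is the Gaussian noise injected in
it, and `ℱ k` is the information available before it. -/
structure IsSGLangevinChain {Ω : Type*} {mΩ : MeasurableSpace Ω} (P : Measure Ω)
    (ℱ : Filtration ℕ mΩ) (γ h : ℝ) (V : Fin n → E d → ℝ) (S : IndexScheme d)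
    (θ r : ℕ → Ω → E d) (I : ℕ → Ω → Fin n) (ξ : ℕ → Ω → E d) : Prop where
  pos_init_measurable : Measurable[ℱ 0] (θ 0)
  mom_init_measurable : Measurable[ℱ 0] (r 0)
  index_measurable : ∀ k, Measurable[ℱ (k + 1)] (I k)
  noise_measurable : ∀ k, Measurable[ℱ (k + 1)] (ξ (k + 1))
  /-- Given the past, the index is drawn according to the scheme at the current state. -/
  index_law : ∀ k i, P[Set.indicator {ω | I k ω = i} (fun _ => (1 : ℝ)) | ℱ k]
    =ᵐ[P] fun ω => S.prob γ h V (θ k ω, r k ω) i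
  noise_law : ∀ k, P.map (ξ (k + 1)) = stdGaussian (E d)
  /-- The noise is independent of the past and of the current index. -/
  noise_indep : ∀ k, Indep (MeasurableSpace.comap (ξ (k + 1)) inferInstance)
    (ℱ k ⊔ MeasurableSpace.comap (I k) ⊤) P
  pos_step : ∀ k ω, θ (k + 1) ω = θ k ω + h • r k ω
  mom_step : ∀ k ω, r (k + 1) ω = r k ω
    - h • ((n : ℝ) • gradient (V (I k ω)) (θ k ω) + γ • r k ω)
    + (noiseAmp γ * Real.sqrt h) • ξ (k + 1) ω

/-- The stochastic gradient `n ∇V_{I_k}(θ_k)` of the `k`-th iteration. -/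
def stochGrad {Ω : Type*} (V : Fin n → E d → ℝ) (θ : ℕ → Ω → E d) (I : ℕ → Ω → Fin n)
    (k : ℕ) (ω : Ω) : E d :=
  (n : ℝ) • gradient (V (I k ω)) (θ k ω)

/-- The conditional covariance matrix `cov(Z | m)` of a random vector `Z`, with entries
`E[(Z_a - E[Z_a | m]) (Z_b - E[Z_b | m]) | m]`. -/
def condCov {Ω : Type*} {mΩ : MeasurableSpace Ω} (P : Measure Ω) (m : MeasurableSpace Ω)
    (Z : Ω → E d) (ω : Ω) : Matrix (Fin d) (Fin d) ℝ :=
  Matrix.of fun a b =>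
    (P[fun ω' => (Z ω' a - (P[fun ω'' => Z ω'' a | m]) ω')
      * (Z ω' b - (P[fun ω'' => Z ω'' b | m]) ω') | m]) ω

/-- The time average `(1/K) ∑_{k=1}^K φ(θ_k, r_k)`. -/
def timeAverage {Ω : Type*} (φ : Phase d → ℝ) (θ r : ℕ → Ω → E d) (K : ℕ) (ω : Ω) : ℝ :=
  (1 / (K : ℝ)) * ∑ k ∈ Finset.Icc 1 K, φ (θ k ω, r k ω)

end Sampling

end EWSG

end

noncomputable section

namespace EWSG

open Filter Topology Laplacian
open scoped NNReal ENNReal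

/-! ### Domination of a Gaussian by a dilated Gaussian -/

section PiDomination

/-! Write `X_k = (θ_k, r_k)`. By the Poisson equation the error of the time average is the mean of
`ℒψ(X_k)`. If `ψ(X_{k+1}) - ψ(X_k)` equals `h ℒψ(X_k)` plus centred increments plus a bias `O(h²)`,
summation telescopes. After division by `T = Kh`, the boundary term has mean square `O(1/T²)`. The
Gaussian increments are orthogonal with variance `O(h)` and give `O(1/T)`. The subsampling
increments are orthogonal with variance at most `h² M₃²` times the mean trace of the conditional
covariance, and give the middle term. The bias gives `O(h²)`.

The obstacle is that `ψ` is only `C³`. Let `P_t` be the heat semigroup in the momentum and `τ =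
2γh`. The defect `q = P_τ ψ - ψ - (τ/2) Δ_r ψ` is then only `O(τ^{3/2})`, which is too large. So `ψ`
is replaced by `ψ + u` with `u = ∑_{j<J} P_{jτ} q` and `J ≥ 1/h`. Since `P_τ u - u = P_{Jτ} q - q`,
the defect becomes `P_{Jτ} q` (`heat_add_corrector`). The semigroup is regular in time, `|P_{t+s} g
- P_t g| ≤ d (s/t) sup |g|` (`abs_heat_add_sub_le`), because a dilated Gaussian dominates a multiple
of the original one; hence `P_{Jτ} q = O(τ/J) = O(h²)`. Summing such bounds for `u` would cost a
logarithm of `J`. Comparison with the trapezoidal rule instead leaves a telescoping sum and second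
differences of order `τ/j²`, so `u = O(τ)` uniformly in `J` (`abs_corrector_le`). Everything depends
linearly on `Δ_r ψ`, which is Lipschitz by the bound on third derivatives, so `u` also has Lipschitz
constant `O(τ)`. This yields the one-step expansion `abs_one_step_le`.

For the index law, the weights are `exp w_i` with `0 ≤ w_i ≤ B = O(h)`, up to a polynomial factor in
the gradients and the momentum. A probability vector with all entries at least `(1 - B)/n` is within
`B` of uniform. The exact weights satisfy this, and so does the Metropolis law after any number of
steps (`exp_div_le_metropolisProb`). The conditional mean of the stochastic gradient is thus off by
`O(h)`, which costs `O(h²)` per step.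

The estimates are assembled in `integral_sq_sum_generator_le` for `h ≤ 1`. When `h > 1` or `T < 1`,
a uniform `L²` bound on `ℒψ(X_k)` suffices (`div_sq_le_of_bounds`). -/

lemma smul_pi_le_pi {ι : Type*} [Fintype ι] {α : ι → Type*} [∀ i, MeasurableSpace (α i)]
    (μ ν : ∀ i, Measure (α i)) [∀ i, SigmaFinite (μ i)] [∀ i, SigmaFinite (ν i)] (a : ℝ≥0∞)
    (h : ∀ i s, a * μ i s ≤ ν i s) :
    a ^ Fintype.card ι • Measure.pi μ ≤ Measure.pi ν := by
  -- An inequality on boxes does not by itself extend to all measurable sets. It does here because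
  -- `OuterMeasure.pi` is the largest outer measure below the box products, and it agrees with
  -- `Measure.pi ν` on measurable sets.
  have key : (a ^ Fintype.card ι • Measure.pi μ).toOuterMeasure
      ≤ OuterMeasure.pi fun i => (ν i).toOuterMeasure := by
    rw [OuterMeasure.le_pi]
    intro s _
    change (a ^ Fintype.card ι • Measure.pi μ) (Set.pi Set.univ s) ≤ ∏ i, ν i (s i)
    rw [Measure.smul_apply, Measure.pi_pi, smul_eq_mul]
    calc a ^ Fintype.card ι * ∏ i, μ i (s i) = ∏ i, a * μ i (s i) := by
          rw [Finset.prod_mul_distrib, Finset.prod_const, Finset.card_univ]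
      _ ≤ ∏ i, ν i (s i) := Finset.prod_le_prod' fun i _ => h i (s i)
  rw [Measure.le_iff]
  intro s hs
  refine (key s).trans ?_
  rw [Measure.pi, toMeasure_apply _ _ hs]

/-- Up to the factor `c⁻¹` of the normalization, widening a centred Gaussian only increases its
density. -/
lemma gaussianReal_domination {c : ℝ} (hc : 1 ≤ c) (s : Set ℝ) :
    ENNReal.ofReal c⁻¹ * gaussianReal 0 1 s ≤ ((gaussianReal 0 1).map (fun x => c * x)) s := by
  have hc0 : 0 < c := by linarith
  have h1 : (gaussianReal 0 1).map (fun x => c * x)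
      = gaussianReal 0 (.mk (c ^ 2) (sq_nonneg _)) := by
    have := gaussianReal_map_const_mul (μ := 0) (v := 1) c
    simpa using this
  have hv : (NNReal.mk (c ^ 2) (sq_nonneg _)) ≠ 0 := by
    intro h; have := congrArg NNReal.toReal h; simp at this; linarith
  rw [h1, gaussianReal_of_var_ne_zero _ hv, gaussianReal_of_var_ne_zero _ one_ne_zero]
  have h2 : ENNReal.ofReal c⁻¹ • volume.withDensity (gaussianPDF 0 1)
      ≤ volume.withDensity (gaussianPDF 0 (.mk (c ^ 2) (sq_nonneg _))) := by
    rw [← withDensity_smul _ (measurable_gaussianPDF 0 1)]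
    refine withDensity_mono (ae_of_all _ fun x => ?_)
    simp only [Pi.smul_apply, smul_eq_mul, gaussianPDF]
    rw [← ENNReal.ofReal_mul (by positivity)]
    refine ENNReal.ofReal_le_ofReal ?_
    simp only [gaussianPDFReal, NNReal.coe_one, NNReal.coe_mk, sub_zero, mul_one]
    have e1 : (√(2 * Real.pi * c ^ 2))⁻¹ = c⁻¹ * (√(2 * Real.pi))⁻¹ := by
      rw [Real.sqrt_mul (by positivity), Real.sqrt_sq hc0.le, mul_inv, mul_comm]
    rw [e1, ← mul_assoc]
    refine mul_le_mul_of_nonneg_left (Real.exp_le_exp.2 ?_) (by positivity)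
    rw [neg_div, neg_div, neg_le_neg_iff]
    refine div_le_div_of_nonneg_left (sq_nonneg x) (by norm_num) ?_
    nlinarith
  simpa using h2 s

lemma stdGaussian_domination (d : ℕ) {c : ℝ} (hc : 1 ≤ c) :
    ENNReal.ofReal c⁻¹ ^ d • stdGaussian (E d) ≤ (stdGaussian (E d)).map (fun z => c • z) := by
  have h := smul_pi_le_pi (fun _ : Fin d => gaussianReal 0 1)
    (fun _ : Fin d => (gaussianReal 0 1).map (fun x => c * x)) (ENNReal.ofReal c⁻¹)
    (fun _ s => gaussianReal_domination hc s)
  rw [Fintype.card_fin, ← Measure.pi_map_pi (fun _ => by fun_prop)] at h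
  have h' := Measure.map_mono h (f := WithLp.toLp 2) (by fun_prop)
  rw [Measure.map_smul, map_pi_eq_stdGaussian, Measure.map_map (by fun_prop) (by fun_prop)] at h'
  rw [← map_pi_eq_stdGaussian (ι := Fin d), Measure.map_map (by fun_prop) (by fun_prop)]
  rw [← map_pi_eq_stdGaussian (ι := Fin d)] at h'
  exact h'

end PiDomination

/-! ### The heat semigroup and its regularity in time -/

section Heat

variable {d : ℕ}

/-- The heat semigroup `P_t f(r) = E f(r + √t Z)`, with generator `Δ / 2`. -/
def heat (t : ℝ) (f : E d → ℝ) (r : E d) : ℝ := ∫ z, f (r + √t • z) ∂(stdGaussian (E d))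

lemma heat_zero (f : E d → ℝ) (r : E d) : heat 0 f r = f r := by simp [heat]

lemma integrable_of_abs_le {α : Type*} [MeasurableSpace α] {μ : Measure α} [IsFiniteMeasure μ]
    {f : α → ℝ} (hf : AEStronglyMeasurable f μ) {B : ℝ} (hB : ∀ x, |f x| ≤ B) : Integrable f μ :=
  Integrable.of_bound hf B (ae_of_all _ hB)

lemma heat_integrable {f : E d → ℝ} (hf : Continuous f) {B : ℝ} (hB : ∀ x, |f x| ≤ B) (t : ℝ)
    (r : E d) : Integrable (fun z => f (r + √t • z)) (stdGaussian (E d)) :=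
  integrable_of_abs_le (by fun_prop) fun _ => hB _

lemma abs_integral_le_of_abs_le {α : Type*} [MeasurableSpace α] {μ : Measure α}
    [IsProbabilityMeasure μ] {f : α → ℝ} {B : ℝ} (hB : ∀ x, |f x| ≤ B) : |∫ x, f x ∂μ| ≤ B := by
  have := norm_integral_le_of_norm_le_const (μ := μ) (f := f) (C := B) (ae_of_all _ hB)
  simpa using this

lemma abs_heat_le {f : E d → ℝ} {B : ℝ} (hB : ∀ x, |f x| ≤ B) (t : ℝ) (r : E d) :
    |heat t f r| ≤ B :=
  abs_integral_le_of_abs_le fun _ => hB _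

lemma heat_sub {f g : E d → ℝ} (hf : Continuous f) (hg : Continuous g) {B B' : ℝ}
    (hB : ∀ x, |f x| ≤ B) (hB' : ∀ x, |g x| ≤ B') (t : ℝ) (r : E d) :
    heat t (fun x => f x - g x) r = heat t f r - heat t g r :=
  integral_sub (heat_integrable hf hB t r) (heat_integrable hg hB' t r)

lemma heat_add {f g : E d → ℝ} (hf : Continuous f) (hg : Continuous g) {B B' : ℝ}
    (hB : ∀ x, |f x| ≤ B) (hB' : ∀ x, |g x| ≤ B') (t : ℝ) (r : E d) :
    heat t (fun x => f x + g x) r = heat t f r + heat t g r :=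
  integral_add (heat_integrable hf hB t r) (heat_integrable hg hB' t r)

lemma heat_const_mul (a : ℝ) (f : E d → ℝ) (t : ℝ) (r : E d) :
    heat t (fun x => a * f x) r = a * heat t f r :=
  integral_const_mul _ _

lemma continuous_heat_uncurry {f : E d → ℝ} (hf : Continuous f) {B : ℝ} (hB : ∀ x, |f x| ≤ B) :
    Continuous fun p : ℝ × E d => heat p.1 f p.2 := by
  refine continuous_of_dominated (bound := fun _ => B) (fun p => by fun_prop)
    (fun p => ae_of_all _ fun z => hB _) (integrable_const _) (ae_of_all _ fun z => ?_)
  fun_prop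

lemma continuous_heat {f : E d → ℝ} (hf : Continuous f) {B : ℝ} (hB : ∀ x, |f x| ≤ B) (t : ℝ) :
    Continuous (heat t f) :=
  (continuous_heat_uncurry hf hB).comp (by fun_prop : Continuous fun r : E d => (t, r))

lemma continuous_heat_time {f : E d → ℝ} (hf : Continuous f) {B : ℝ} (hB : ∀ x, |f x| ≤ B)
    (r : E d) : Continuous fun t => heat t f r :=
  (continuous_heat_uncurry hf hB).comp (by fun_prop : Continuous fun t : ℝ => (t, r))

/-- Variances of independent Gaussians add, as the characteristic functions show. This is the
semigroup law. -/
lemma stdGaussian_conv {s t : ℝ} (hs : 0 ≤ s) (ht : 0 ≤ t) :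
    ((stdGaussian (E d)).map (fun z => √s • z)) ∗ ((stdGaussian (E d)).map (fun z => √t • z))
      = (stdGaussian (E d)).map (fun z => √(s + t) • z) := by
  have : IsProbabilityMeasure ((stdGaussian (E d)).map (fun z => √s • z)) :=
    Measure.isProbabilityMeasure_map (by fun_prop)
  have : IsProbabilityMeasure ((stdGaussian (E d)).map (fun z => √t • z)) :=
    Measure.isProbabilityMeasure_map (by fun_prop)
  have : IsProbabilityMeasure ((stdGaussian (E d)).map (fun z => √(s + t) • z)) :=
    Measure.isProbabilityMeasure_map (by fun_prop)
  refine Measure.ext_of_charFun (funext fun x => ?_)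
  rw [charFun_conv, charFun_map_smul, charFun_map_smul, charFun_map_smul, charFun_stdGaussian,
    charFun_stdGaussian, charFun_stdGaussian, ← Complex.exp_add]
  congr 1
  have hs' : ((√s : ℝ) : ℂ) ^ 2 = s := by rw [← Complex.ofReal_pow, Real.sq_sqrt hs]
  have ht' : ((√t : ℝ) : ℂ) ^ 2 = t := by rw [← Complex.ofReal_pow, Real.sq_sqrt ht]
  have hst' : ((√(s + t) : ℝ) : ℂ) ^ 2 = s + t := by
    rw [← Complex.ofReal_pow, Real.sq_sqrt (by positivity)]; push_cast; rfl
  simp only [norm_smul, Real.norm_eq_abs, abs_of_nonneg (Real.sqrt_nonneg _), Complex.ofReal_mul,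
    mul_pow, hs', ht', hst']
  ring

lemma heat_heat {f : E d → ℝ} (hf : Continuous f) {B : ℝ} (hB : ∀ x, |f x| ≤ B) {s t : ℝ}
    (hs : 0 ≤ s) (ht : 0 ≤ t) (r : E d) : heat s (heat t f) r = heat (s + t) f r := by
  have : IsProbabilityMeasure ((stdGaussian (E d)).map (fun z => √s • z)) :=
    Measure.isProbabilityMeasure_map (by fun_prop)
  have : IsProbabilityMeasure ((stdGaussian (E d)).map (fun z => √t • z)) :=
    Measure.isProbabilityMeasure_map (by fun_prop)
  have h1 : heat (s + t) f r
      = ∫ v, f (r + v) ∂((stdGaussian (E d)).map (fun z => √(s + t) • z)) := by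
    rw [integral_map (by fun_prop) (by fun_prop)]; rfl
  rw [h1, ← stdGaussian_conv hs ht, integral_conv]
  · rw [integral_map (by fun_prop)]
    · refine integral_congr_ae (ae_of_all _ fun z => ?_)
      simp only
      rw [integral_map (by fun_prop) (by fun_prop)]
      simp [heat, add_assoc]
    · refine Continuous.aestronglyMeasurable ?_
      refine continuous_of_dominated (bound := fun _ => B) (fun p => by fun_prop)
        (fun p => ae_of_all _ fun z => hB _) (integrable_const _) (ae_of_all _ fun z => ?_)
      fun_prop
  · exact integrable_of_abs_le (by fun_prop) fun _ => hB _

/-- Both laws contain the measure `c⁻¹ ^ d • stdGaussian`. What remains of each after removing it is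
a positive measure of mass `1 - c⁻¹ ^ d`, which gives the two contributions. -/
lemma abs_integral_smul_sub_le {g : E d → ℝ} (hg : Continuous g) {B : ℝ} (hB : ∀ x, |g x| ≤ B)
    {c : ℝ} (hc : 1 ≤ c) :
    |∫ z, g (c • z) ∂(stdGaussian (E d)) - ∫ z, g z ∂(stdGaussian (E d))|
      ≤ 2 * (1 - c⁻¹ ^ d) * B := by
  set μ := stdGaussian (E d)
  set ν := μ.map (fun z => c • z) with hν
  have hc0 : 0 < c := by linarith
  have : IsProbabilityMeasure ν := Measure.isProbabilityMeasure_map (by fun_prop)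
  set κ := ENNReal.ofReal c⁻¹ ^ d • μ with hκ
  have hle : κ ≤ ν := stdGaussian_domination d hc
  have hfin : IsFiniteMeasure κ := isFiniteMeasure_of_le ν hle
  have hadd : ν - κ + κ = ν := Measure.sub_add_cancel_of_le hle
  have hfin' : IsFiniteMeasure (ν - κ) := isFiniteMeasure_of_le ν Measure.sub_le
  have hpow : (ENNReal.ofReal c⁻¹ ^ d).toReal = c⁻¹ ^ d := by
    rw [ENNReal.toReal_pow, ENNReal.toReal_ofReal (by positivity)]
  have hκu : κ.real Set.univ = c⁻¹ ^ d := by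
    rw [hκ, measureReal_ennreal_smul_apply, hpow]; simp
  have hmass : (ν - κ).real Set.univ = 1 - c⁻¹ ^ d := by
    have : (ν - κ + κ).real Set.univ = 1 := by rw [hadd]; simp
    rw [measureReal_add_apply] at this
    linarith
  have hint : ∀ ρ : Measure (E d), IsFiniteMeasure ρ → Integrable g ρ := fun ρ _ =>
    integrable_of_abs_le hg.aestronglyMeasurable hB
  have h1 : ∫ z, g (c • z) ∂μ = ∫ z, g z ∂(ν - κ) + c⁻¹ ^ d * ∫ z, g z ∂μ := by
    rw [← integral_map (φ := fun z => c • z) (by fun_prop) (by fun_prop), ← hν]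
    conv_lhs => rw [← hadd]
    rw [integral_add_measure (hint _ hfin') (hint _ hfin), hκ, integral_smul_measure, hpow,
      smul_eq_mul]
  have h2 : |∫ z, g z ∂(ν - κ)| ≤ B * (1 - c⁻¹ ^ d) := by
    rw [← hmass]
    simpa using norm_integral_le_of_norm_le_const (μ := ν - κ) (f := g) (C := B) (ae_of_all _ hB)
  have h3 : |∫ z, g z ∂μ| ≤ B := abs_integral_le_of_abs_le hB
  have h4 : 0 ≤ 1 - c⁻¹ ^ d := by rw [← hmass]; positivity
  rw [h1]
  have h5 : |(1 - c⁻¹ ^ d) * ∫ z, g z ∂μ| ≤ (1 - c⁻¹ ^ d) * B := by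
    rw [abs_mul, abs_of_nonneg h4]; gcongr
  calc _ = |∫ z, g z ∂(ν - κ) - (1 - c⁻¹ ^ d) * ∫ z, g z ∂μ| := by congr 1; ring
    _ ≤ _ := (abs_sub _ _).trans (by linarith)

/-- Total variation regularity of the heat semigroup in time. -/
lemma abs_heat_add_sub_le {g : E d → ℝ} (hg : Continuous g) {B : ℝ} (hB : ∀ x, |g x| ≤ B)
    {s t : ℝ} (hs : 0 ≤ s) (ht : 0 < t) (r : E d) :
    |heat (t + s) g r - heat t g r| ≤ d * (s / t) * B := by
  have hB0 : 0 ≤ B := (abs_nonneg _).trans (hB 0)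
  -- Passing from time `t` to `t + s` dilates the Gaussian by this `c`. Bernoulli's inequality and
  -- `c - 1 ≤ s / (2t)` turn `2 (1 - c⁻¹ ^ d)` into `d s / t`.
  set c := √((t + s) / t) with hcdef
  have hc2 : c ^ 2 = 1 + s / t := by
    rw [hcdef, Real.sq_sqrt (by positivity)]; field_simp
  have hst : 0 ≤ s / t := by positivity
  have hc : 1 ≤ c := by
    rw [hcdef, Real.one_le_sqrt, le_div_iff₀ ht]; linarith
  have hc0 : 0 < c := by linarith
  have key := abs_integral_smul_sub_le (g := fun z => g (r + √t • z)) (by fun_prop)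
    (fun _ => hB _) hc
  have e : ∀ z : E d, r + √t • c • z = r + √(t + s) • z := by
    intro z
    rw [smul_smul, hcdef, ← Real.sqrt_mul ht.le]
    congr 3
    field_simp
  simp only [e] at key
  refine key.trans ?_
  have hbern : 1 + (d : ℝ) * (c⁻¹ - 1) ≤ c⁻¹ ^ d := by
    have := one_add_mul_le_pow (a := c⁻¹ - 1) (by
      have : 0 < c⁻¹ := by positivity
      linarith) d
    simpa using this
  have hci : 1 - c⁻¹ ≤ s / t / 2 := by
    have h1 : 1 - c⁻¹ ≤ c - 1 := by
      have : c * c⁻¹ = 1 := mul_inv_cancel₀ hc0.ne'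
      nlinarith [inv_pos.2 hc0]
    nlinarith
  have : 2 * (1 - c⁻¹ ^ d) ≤ d * (s / t) := by
    have hd : (0 : ℝ) ≤ d := by positivity
    nlinarith
  gcongr

end Heat

end EWSG
end

noncomputable section

namespace EWSG

open Filter Topology Laplacian
open scoped NNReal ENNReal

/-! ### The heat equation for functions with bounded Hessian -/

section HeatEquation

/-- Rolle's theorem twice, after subtracting the quadratic that matches value and slope at `0` and
the value at `1`. The Lagrange form keeps the intermediate point, which the limit in
`tendsto_heat_sub_div` follows. -/
lemma exists_taylor_two_real {φ φ' φ'' : ℝ → ℝ} (h1 : ∀ t, HasDerivAt φ (φ' t) t)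
    (h2 : ∀ t, HasDerivAt φ' (φ'' t) t) :
    ∃ s ∈ Set.Ioo (0 : ℝ) 1, φ 1 = φ 0 + φ' 0 + φ'' s / 2 := by
  set c := φ 1 - φ 0 - φ' 0 with hc
  have hG : ∀ t, HasDerivAt (fun t => φ t - φ' 0 * t - c * t ^ 2) (φ' t - φ' 0 - c * (2 * t)) t :=
    fun t => (((h1 t).sub ((hasDerivAt_id t).const_mul (φ' 0))).sub
      (((hasDerivAt_id t).pow 2).const_mul c)).congr_deriv (by simp)
  have hG' : ∀ t, HasDerivAt (fun t => φ' t - φ' 0 - c * (2 * t)) (φ'' t - c * 2) t := fun t =>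
    (((h2 t).sub_const (φ' 0)).sub (((hasDerivAt_id t).const_mul 2).const_mul c)).congr_deriv
      (by simp)
  obtain ⟨s₁, hs₁, e₁⟩ := exists_hasDerivAt_eq_zero (f := fun t => φ t - φ' 0 * t - c * t ^ 2)
    one_pos (fun t _ => (hG t).continuousAt.continuousWithinAt) (by simp [hc]) fun t _ => hG t
  obtain ⟨s, hs, e⟩ := exists_hasDerivAt_eq_zero (f := fun t => φ' t - φ' 0 - c * (2 * t))
    hs₁.1 (fun t _ => (hG' t).continuousAt.continuousWithinAt) (by simpa using e₁.symm)
    fun t _ => hG' t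
  exact ⟨s, ⟨hs.1, hs.2.trans hs₁.2⟩, by linarith⟩

lemma exists_taylor_two {F : Type*} [NormedAddCommGroup F] [NormedSpace ℝ F] {f : F → ℝ}
    (hf : ContDiff ℝ 2 f) (x v : F) :
    ∃ s ∈ Set.Ioo (0 : ℝ) 1,
      f (x + v) = f x + fderiv ℝ f x v + fderiv ℝ (fderiv ℝ f) (x + s • v) v v / 2 := by
  have hf1 : Differentiable ℝ f := hf.differentiable (by norm_num)
  have hf2 : Differentiable ℝ (fderiv ℝ f) :=
    (hf.fderiv_right (m := 1) (by norm_num)).differentiable (by norm_num)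
  have hline : ∀ t : ℝ, HasDerivAt (fun t : ℝ => x + t • v) v t := fun t => by
    simpa using ((hasDerivAt_id t).smul_const v).const_add x
  have hd1 : ∀ t : ℝ, HasDerivAt (fun t : ℝ => f (x + t • v)) (fderiv ℝ f (x + t • v) v) t :=
    fun t => (hf1 (x + t • v)).hasFDerivAt.comp_hasDerivAt t (hline t)
  have hd2 : ∀ t : ℝ, HasDerivAt (fun t : ℝ => fderiv ℝ f (x + t • v) v)
      (fderiv ℝ (fderiv ℝ f) (x + t • v) v v) t := fun t => by
    have h1 : HasDerivAt (fun t : ℝ => fderiv ℝ f (x + t • v))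
        (fderiv ℝ (fderiv ℝ f) (x + t • v) v) t :=
      (hf2 (x + t • v)).hasFDerivAt.comp_hasDerivAt t (hline t)
    exact ((ContinuousLinearMap.apply ℝ ℝ v).hasFDerivAt).comp_hasDerivAt t h1
  obtain ⟨s, hs, h⟩ := exists_taylor_two_real hd1 hd2
  refine ⟨s, hs, ?_⟩
  rw [one_smul, zero_smul, add_zero] at h
  exact h

variable {d : ℕ}

lemma integral_inner_mul_inner_stdGaussian (u v : E d) :
    ∫ z, inner ℝ u z * inner ℝ v z ∂(stdGaussian (E d)) = inner ℝ u v := by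
  have h := congrFun (congrArg DFunLike.coe
    (congrFun (congrArg DFunLike.coe (covarianceBilin_stdGaussian (E := E d))) u)) v
  rw [covarianceBilin_apply IsGaussian.memLp_two_id] at h
  have h0 : ∫ x, id x ∂(stdGaussian (E d)) = 0 := integral_id_stdGaussian
  rw [h0] at h
  simp only [sub_zero] at h
  exact h

lemma integrable_norm_pow_stdGaussian (k : ℕ) :
    Integrable (fun z : E d => ‖z‖ ^ k) (stdGaussian (E d)) := by
  rcases Nat.eq_zero_or_pos k with rfl | hk
  · simp
  · have := (IsGaussian.memLp_id (stdGaussian (E d)) (k : ℝ≥0∞) (by simp)).integrable_norm_pow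
      hk.ne'
    simpa using this

lemma laplacian_eq_sum (f : E d → ℝ) (x : E d) :
    Laplacian.laplacian f x = ∑ i, fderiv ℝ (fderiv ℝ f) x (EuclideanSpace.basisFun (Fin d) ℝ i)
      (EuclideanSpace.basisFun (Fin d) ℝ i) := by
  rw [InnerProductSpace.laplacian_eq_iteratedFDeriv_orthonormalBasis f
    (EuclideanSpace.basisFun (Fin d) ℝ)]
  simp [iteratedFDeriv_two_apply]

lemma integral_quadratic_stdGaussian (A : E d →L[ℝ] E d →L[ℝ] ℝ) :
    ∫ z, A z z ∂(stdGaussian (E d)) = ∑ i, A (EuclideanSpace.basisFun (Fin d) ℝ i)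
      (EuclideanSpace.basisFun (Fin d) ℝ i) := by
  set b := EuclideanSpace.basisFun (Fin d) ℝ
  have e : ∀ z, A z z = ∑ i, ∑ j, A (b i) (b j) * (inner ℝ (b i) z * inner ℝ (b j) z) := by
    intro z
    conv_lhs => rw [← b.sum_repr' z]
    simp only [map_sum, map_smul, sum_apply, smul_apply,
      smul_eq_mul, Finset.mul_sum]
    rw [Finset.sum_comm]
    refine Finset.sum_congr rfl fun i _ => Finset.sum_congr rfl fun j _ => ?_
    ring
  have hint : ∀ i j, Integrable (fun z => A (b i) (b j) * (inner ℝ (b i) z * inner ℝ (b j) z))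
      (stdGaussian (E d)) := by
    intro i j
    refine Integrable.const_mul ((integrable_norm_pow_stdGaussian 2).mono' (by fun_prop)
      (ae_of_all _ fun z => ?_)) _
    rw [norm_mul, pow_two]
    have h1 := norm_inner_le_norm (𝕜 := ℝ) (b i) z
    have h2 := norm_inner_le_norm (𝕜 := ℝ) (b j) z
    simp only [b.norm_eq_one, one_mul] at h1 h2
    gcongr
  simp_rw [e]
  rw [integral_finsetSum _ fun i _ => integrable_finsetSum _ fun j _ => hint i j]
  refine Finset.sum_congr rfl fun i _ => ?_
  rw [integral_finsetSum _ fun j _ => hint i j]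
  simp_rw [integral_const_mul, integral_inner_mul_inner_stdGaussian, b.inner_eq_ite]
  simp

lemma abs_second_deriv_le {F : Type*} [NormedAddCommGroup F] [NormedSpace ℝ F]
    {A : F →L[ℝ] F →L[ℝ] ℝ} {B : ℝ} (h : ‖A‖ ≤ B) (z : F) : |A z z| ≤ B * ‖z‖ ^ 2 := by
  have := A.le_opNorm₂ z z
  rw [Real.norm_eq_abs] at this
  calc _ ≤ _ := this
    _ = ‖A‖ * ‖z‖ ^ 2 := by ring
    _ ≤ _ := by gcongr

/-- The functions on which the heat equation is used: `C²`, bounded with bounded Hessian. -/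
structure BoundedHessian (f : E d → ℝ) : Prop where
  contDiff : ContDiff ℝ 2 f
  bounded : ∃ B, ∀ x, |f x| ≤ B
  hessian : ∃ B, ∀ x, ‖fderiv ℝ (fderiv ℝ f) x‖ ≤ B

namespace BoundedHessian

variable {f : E d → ℝ}

lemma continuous_laplacian (hf : BoundedHessian f) : Continuous (Laplacian.laplacian f) := by
  have h : Continuous (fderiv ℝ (fderiv ℝ f)) :=
    (hf.contDiff.fderiv_right (m := 1) (by norm_num)).continuous_fderiv (by norm_num)
  have : Laplacian.laplacian f = fun x => _ := funext (laplacian_eq_sum f)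
  rw [this]
  fun_prop

lemma laplacian_bounded (hf : BoundedHessian f) : ∃ B, ∀ x, |Laplacian.laplacian f x| ≤ B := by
  obtain ⟨B, hB⟩ := hf.hessian
  refine ⟨∑ _i : Fin d, B * 1 ^ 2, fun x => ?_⟩
  rw [laplacian_eq_sum]
  refine (Finset.abs_sum_le_sum_abs _ _).trans (Finset.sum_le_sum fun i _ => ?_)
  refine (abs_second_deriv_le (hB x) _).trans_eq ?_
  rw [OrthonormalBasis.norm_eq_one]

/-- The linear term has mean zero under the centred Gaussian. Subtracting it inside the integral
makes the integrand `O(ε)` instead of `O(√ε)`. -/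
lemma heat_sub_eq (hf : BoundedHessian f) (r : E d) (ε : ℝ) :
    heat ε f r - f r
      = ∫ z, (f (r + √ε • z) - f r - fderiv ℝ f r (√ε • z)) ∂(stdGaussian (E d)) := by
  obtain ⟨B, hB⟩ := hf.bounded
  have h1 := heat_integrable hf.contDiff.continuous hB ε r
  have h2 : Integrable (fun z => fderiv ℝ f r (√ε • z)) (stdGaussian (E d)) := by
    simp only [map_smul, smul_eq_mul]
    exact (IsGaussian.integrable_dual _ _).const_mul _
  have h3 : ∫ z, (f (r + √ε • z) - f r - fderiv ℝ f r (√ε • z)) ∂(stdGaussian (E d))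
      = ∫ z, (f (r + √ε • z) - f r) ∂(stdGaussian (E d))
        - ∫ z, fderiv ℝ f r (√ε • z) ∂(stdGaussian (E d)) :=
    integral_sub (h1.sub (integrable_const _)) h2
  rw [h3, integral_sub h1 (integrable_const _)]
  simp only [map_smul, smul_eq_mul, integral_const_mul, integral_strongDual_stdGaussian]
  simp [heat]

lemma abs_remainder_le (hf : BoundedHessian f) {B : ℝ}
    (hB : ∀ x, ‖fderiv ℝ (fderiv ℝ f) x‖ ≤ B) (r : E d) {ε : ℝ} (hε : 0 ≤ ε) (z : E d) :
    |f (r + √ε • z) - f r - fderiv ℝ f r (√ε • z)| ≤ ε * (B / 2 * ‖z‖ ^ 2) := by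
  obtain ⟨s, -, h⟩ := exists_taylor_two hf.contDiff r (√ε • z)
  rw [h]
  have := abs_second_deriv_le (hB (r + s • √ε • z)) (√ε • z)
  rw [norm_smul, mul_pow, Real.norm_eq_abs, sq_abs, Real.sq_sqrt hε] at this
  rw [show ∀ a b c : ℝ, a + b + c / 2 - a - b = c / 2 by intros; ring, abs_div, abs_two]
  linarith

lemma abs_heat_sub_le (hf : BoundedHessian f) {B : ℝ}
    (hB : ∀ x, ‖fderiv ℝ (fderiv ℝ f) x‖ ≤ B) (r : E d) {ε : ℝ} (hε : 0 ≤ ε) :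
    |heat ε f r - f r| ≤ ε * (B / 2 * ∫ z, ‖z‖ ^ 2 ∂(stdGaussian (E d))) := by
  rw [hf.heat_sub_eq r ε, ← integral_const_mul, ← integral_const_mul]
  have hbd : Integrable (fun z : E d => ε * (B / 2 * ‖z‖ ^ 2)) (stdGaussian (E d)) :=
    ((integrable_norm_pow_stdGaussian 2).const_mul _).const_mul _
  rw [← Real.norm_eq_abs]
  exact norm_integral_le_of_norm_le hbd (ae_of_all _ fun z => hf.abs_remainder_le hB r hε z)

/-- The intermediate point of the Taylor formula tends to `r`, the Hessian bound provides the
dominating function, and the Gaussian mean of a quadratic form is its trace. -/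
lemma tendsto_heat_sub_div (hf : BoundedHessian f) (r : E d) :
    Tendsto (fun ε => (heat ε f r - f r) / ε) (𝓝[>] 0) (𝓝 (Laplacian.laplacian f r / 2)) := by
  obtain ⟨B, hB⟩ := hf.hessian
  have hcont : Continuous (fderiv ℝ (fderiv ℝ f)) :=
    (hf.contDiff.fderiv_right (m := 1) (by norm_num)).continuous_fderiv (by norm_num)
  have hlim : Laplacian.laplacian f r / 2
      = ∫ z, fderiv ℝ (fderiv ℝ f) r z z / 2 ∂(stdGaussian (E d)) := by
    rw [integral_div, integral_quadratic_stdGaussian, laplacian_eq_sum]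
  rw [hlim]
  have heq : ∀ ε, (heat ε f r - f r) / ε
      = ∫ z, (f (r + √ε • z) - f r - fderiv ℝ f r (√ε • z)) / ε ∂(stdGaussian (E d)) := fun ε => by
    rw [integral_div, ← hf.heat_sub_eq]
  simp_rw [heq]
  have hfc := hf.contDiff.continuous
  refine tendsto_integral_filter_of_dominated_convergence (fun z => B / 2 * ‖z‖ ^ 2)
    (Eventually.of_forall fun ε => by fun_prop) ?_
    ((integrable_norm_pow_stdGaussian 2).const_mul _) (ae_of_all _ fun z => ?_)
  · filter_upwards [self_mem_nhdsWithin] with ε hε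
    have hε' : (0 : ℝ) < ε := hε
    refine ae_of_all _ fun z => ?_
    rw [norm_div, Real.norm_eq_abs, Real.norm_eq_abs, abs_of_pos hε', div_le_iff₀ hε', mul_comm]
    exact hf.abs_remainder_le hB r hε'.le z
  · choose s hs h using fun ε : ℝ => exists_taylor_two hf.contDiff r (√ε • z)
    have hs0 : Tendsto (fun ε => s ε * √ε) (𝓝[>] 0) (𝓝 0) := by
      have h0 : Tendsto (fun ε : ℝ => √ε) (𝓝[>] 0) (𝓝 0) := by
        have : Tendsto (fun ε : ℝ => √ε) (𝓝 0) (𝓝 √0) := Real.continuous_sqrt.tendsto 0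
        rw [Real.sqrt_zero] at this
        exact this.mono_left nhdsWithin_le_nhds
      refine squeeze_zero (fun ε => mul_nonneg (hs ε).1.le (Real.sqrt_nonneg _)) (fun ε => ?_) h0
      nlinarith [(hs ε).2, Real.sqrt_nonneg ε]
    have hpt : Tendsto (fun ε => r + (s ε * √ε) • z) (𝓝[>] 0) (𝓝 r) := by
      have := (hs0.smul_const z).const_add r
      simpa using this
    have hA : Tendsto (fun ε => fderiv ℝ (fderiv ℝ f) (r + (s ε * √ε) • z) z z / 2) (𝓝[>] 0)
        (𝓝 (fderiv ℝ (fderiv ℝ f) r z z / 2)) := by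
      have hc : Continuous fun x => fderiv ℝ (fderiv ℝ f) x z z / 2 := by fun_prop
      exact (hc.tendsto r).comp hpt
    refine hA.congr' ?_
    filter_upwards [self_mem_nhdsWithin] with ε hε
    have hε' : (0 : ℝ) < ε := hε
    rw [h ε, smul_smul]
    simp only [map_smul, smul_apply, smul_eq_mul]
    have hsq : √ε * √ε = ε := Real.mul_self_sqrt hε'.le
    rw [eq_div_iff hε'.ne']
    linear_combination (-(fderiv ℝ (fderiv ℝ f) (r + (s ε * √ε) • z) z z / 2)) * hsq

/-- By the semigroup law, the right difference quotient at time `s` is `P_s` applied to the one at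
time `0`. So the heat flow is never differentiated in space, and a right derivative is enough for
the fundamental theorem of calculus. -/
lemma hasDerivWithinAt_heat (hf : BoundedHessian f) (r : E d) {s : ℝ} (hs : 0 ≤ s) :
    HasDerivWithinAt (fun t => heat t f r)
      (heat s (Laplacian.laplacian f) r / 2) (Set.Ioi s) s := by
  obtain ⟨B, hB⟩ := hf.bounded
  obtain ⟨B₂, hB₂⟩ := hf.hessian
  have hfc := hf.contDiff.continuous
  rw [hasDerivWithinAt_iff_tendsto_slope' (by simp)]
  have key : Tendsto (fun ε => heat s (fun x => (heat ε f x - f x) / ε) r) (𝓝[>] 0)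
      (𝓝 (heat s (Laplacian.laplacian f) r / 2)) := by
    rw [heat, ← integral_div]
    refine tendsto_integral_filter_of_dominated_convergence
      (fun _ => B₂ / 2 * ∫ z, ‖z‖ ^ 2 ∂(stdGaussian (E d)))
      (Eventually.of_forall fun ε => ?_) ?_ (integrable_const _)
      (ae_of_all _ fun z => hf.tendsto_heat_sub_div _)
    · have := continuous_heat hfc hB ε
      fun_prop
    · filter_upwards [self_mem_nhdsWithin] with ε hε
      have hε' : (0 : ℝ) < ε := hε
      refine ae_of_all _ fun z => ?_
      rw [norm_div, Real.norm_eq_abs, Real.norm_eq_abs, abs_of_pos hε', div_le_iff₀ hε', mul_comm]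
      exact hf.abs_heat_sub_le hB₂ _ hε'.le
  have hshift : Tendsto (fun t => t - s) (𝓝[>] s) (𝓝[>] 0) := by
    refine tendsto_nhdsWithin_iff.2 ⟨?_, ?_⟩
    · have : Tendsto (fun t => t - s) (𝓝 s) (𝓝 (s - s)) := (continuous_sub_right s).tendsto s
      rw [sub_self] at this
      exact this.mono_left nhdsWithin_le_nhds
    · filter_upwards [self_mem_nhdsWithin] with t ht
      simpa using ht
  refine (key.comp hshift).congr' ?_
  filter_upwards [self_mem_nhdsWithin] with t ht
  have ht' : s < t := ht
  have e : (fun x => (heat (t - s) f x - f x) / (t - s))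
      = fun x => (t - s)⁻¹ * (heat (t - s) f x - f x) := funext fun x => by rw [div_eq_inv_mul]
  simp only [Function.comp]
  rw [e, heat_const_mul, heat_sub (continuous_heat hfc hB _) hfc (abs_heat_le hB _) hB,
    heat_heat hfc hB hs (by linarith), slope_def_field, div_eq_inv_mul]
  congr 3
  ring

/-- The heat equation in integrated form. -/
lemma heat_sub_heat (hf : BoundedHessian f) (r : E d) {a b : ℝ} (ha : 0 ≤ a) (hab : a ≤ b) :
    heat b f r - heat a f r = ∫ s in a..b, heat s (Laplacian.laplacian f) r / 2 := by
  obtain ⟨B, hB⟩ := hf.bounded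
  obtain ⟨B', hB'⟩ := hf.laplacian_bounded
  refine (intervalIntegral.integral_eq_sub_of_hasDeriv_right_of_le hab
    (continuous_heat_time hf.contDiff.continuous hB r).continuousOn
    (fun s hs => hf.hasDerivWithinAt_heat r (ha.trans hs.1.le)) ?_).symm
  have := continuous_heat_time hf.continuous_laplacian hB' r
  exact (this.div_const 2).intervalIntegrable _ _

end BoundedHessian

end HeatEquation

end EWSG
end

noncomputable section

namespace EWSG

open Filter Topology Laplacian
open scoped NNReal ENNReal

/-! ### The corrector: trading fourth derivatives for smoothing -/

section Corrector

variable {d : ℕ}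

/-- The first-difference estimate is used twice, each time spending half of the smoothing time `t`.
The two factors `s / (t/2)` and `s' / (t/2)` produce the `4`. -/
lemma abs_heat_second_difference_le {g : E d → ℝ} (hg : Continuous g) {G : ℝ}
    (hG : ∀ x, |g x| ≤ G) {s s' t : ℝ} (hs : 0 ≤ s) (hs' : 0 ≤ s') (ht : 0 < t) (r : E d) :
    |heat (t + s) g r + heat (t + s') g r - heat t g r - heat (t + (s + s')) g r|
      ≤ d ^ 2 * (4 * s * s' / t ^ 2) * G := by
  have ht2 : 0 < t / 2 := by linarith
  set k : E d → ℝ := fun x => heat (t / 2) g x - heat (t / 2 + s') g x with hk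
  have hkc : Continuous k := (continuous_heat hg hG _).sub (continuous_heat hg hG _)
  have hkb : ∀ x, |k x| ≤ d * (s' / (t / 2)) * G := fun x => by
    rw [hk, abs_sub_comm]
    exact abs_heat_add_sub_le hg hG hs' ht2 x
  have h := abs_heat_add_sub_le hkc hkb hs ht2 r
  have e : ∀ a, 0 ≤ a → heat a k r = heat (a + t / 2) g r - heat (a + (t / 2 + s')) g r := by
    intro a ha
    rw [hk, heat_sub (continuous_heat hg hG _) (continuous_heat hg hG _) (abs_heat_le hG _)
      (abs_heat_le hG _), heat_heat hg hG ha ht2.le, heat_heat hg hG ha (by linarith)]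
  rw [e _ (by linarith), e _ ht2.le] at h
  have e1 : t / 2 + s + t / 2 = t + s := by ring
  have e2 : t / 2 + s + (t / 2 + s') = t + (s + s') := by ring
  have e3 : t / 2 + t / 2 = t := by ring
  have e4 : t / 2 + (t / 2 + s') = t + s' := by ring
  rw [e1, e2, e3, e4] at h
  calc _ = _ := by congr 1; ring
    _ ≤ _ := h
    _ = _ := by field_simp; ring

/-- `P_t` applied to the local error `P_τ f - f - (τ/2) Δ f` of the Gaussian noise. -/
def noiseResidual (τ t : ℝ) (f : E d → ℝ) (r : E d) : ℝ :=
  heat (t + τ) f r - heat t f r - τ / 2 * heat t (Laplacian.laplacian f) r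

/-- The corrector `u = ∑_{j<J} P_{jτ} q`, where `q = P_τ f - f - (τ/2) Δ f`. -/
def corrector (τ : ℝ) (J : ℕ) (f : E d → ℝ) (r : E d) : ℝ :=
  ∑ j ∈ Finset.range J, noiseResidual τ (j * τ) f r

namespace BoundedHessian

variable {f g : E d → ℝ} {τ t G : ℝ}

lemma sub (hf : BoundedHessian f) (hg : BoundedHessian g) : BoundedHessian fun x => f x - g x := by
  obtain ⟨B, hB⟩ := hf.bounded
  obtain ⟨B', hB'⟩ := hg.bounded
  obtain ⟨C, hC⟩ := hf.hessian
  obtain ⟨C', hC'⟩ := hg.hessian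
  have d1 : ∀ {f : E d → ℝ}, BoundedHessian f → Differentiable ℝ f := fun h =>
    h.contDiff.differentiable (by norm_num)
  have d2 : ∀ {f : E d → ℝ}, BoundedHessian f → Differentiable ℝ (fderiv ℝ f) := fun h =>
    (h.contDiff.fderiv_right (m := 1) (by norm_num)).differentiable (by norm_num)
  refine ⟨hf.contDiff.sub hg.contDiff, ⟨B + B', fun x => ?_⟩, ⟨C + C', fun x => ?_⟩⟩
  · exact (abs_sub _ _).trans (add_le_add (hB x) (hB' x))
  · have e : fderiv ℝ (fun x => f x - g x) = fun x => fderiv ℝ f x - fderiv ℝ g x :=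
      funext fun x => fderiv_fun_sub (d1 hf x) (d1 hg x)
    rw [e, fderiv_fun_sub (d2 hf x) (d2 hg x)]
    have := norm_sub_le (fderiv ℝ (fderiv ℝ f) x) (fderiv ℝ (fderiv ℝ g) x)
    linarith [hC x, hC' x]

lemma laplacian_sub (hf : BoundedHessian f) (hg : BoundedHessian g) (x : E d) :
    Laplacian.laplacian (fun x => f x - g x) x
      = Laplacian.laplacian f x - Laplacian.laplacian g x :=
  hf.contDiff.contDiffAt.laplacian_sub hg.contDiff.contDiffAt

lemma noiseResidual_sub (hf : BoundedHessian f) (hg : BoundedHessian g) (r : E d) :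
    noiseResidual τ t (fun x => f x - g x) r = noiseResidual τ t f r - noiseResidual τ t g r := by
  obtain ⟨B, hB⟩ := hf.bounded
  obtain ⟨B', hB'⟩ := hg.bounded
  obtain ⟨C, hC⟩ := hf.laplacian_bounded
  obtain ⟨C', hC'⟩ := hg.laplacian_bounded
  have hfc := hf.contDiff.continuous
  have hgc := hg.contDiff.continuous
  have e : Laplacian.laplacian (fun x => f x - g x)
      = fun x => Laplacian.laplacian f x - Laplacian.laplacian g x := funext (hf.laplacian_sub hg)
  simp only [noiseResidual]
  rw [e, heat_sub hfc hgc hB hB', heat_sub hfc hgc hB hB',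
    heat_sub hf.continuous_laplacian hg.continuous_laplacian hC hC']
  ring

lemma corrector_sub (hf : BoundedHessian f) (hg : BoundedHessian g) (J : ℕ) (r : E d) :
    corrector τ J (fun x => f x - g x) r = corrector τ J f r - corrector τ J g r := by
  simp only [corrector, hf.noiseResidual_sub hg, Finset.sum_sub_distrib]

/-- The residual is the error of the left-endpoint rule for the integrated heat equation. In
particular it depends on `f` only through its Laplacian. -/
lemma noiseResidual_eq_integral (hf : BoundedHessian f) (hτ : 0 ≤ τ) (ht : 0 ≤ t) (r : E d) :
    noiseResidual τ t f r = (∫ s in (0 : ℝ)..τ,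
      (heat (t + s) (Laplacian.laplacian f) r - heat t (Laplacian.laplacian f) r)) / 2 := by
  obtain ⟨C, hC⟩ := hf.laplacian_bounded
  have hH := continuous_heat_time hf.continuous_laplacian hC r
  have h1 : ∫ s in t..(t + τ), heat s (Laplacian.laplacian f) r
      = ∫ s in (0 : ℝ)..τ, heat (t + s) (Laplacian.laplacian f) r := by
    rw [intervalIntegral.integral_comp_add_left (fun s => heat s (Laplacian.laplacian f) r) t]
    simp
  rw [noiseResidual, hf.heat_sub_heat r ht (by linarith), intervalIntegral.integral_div, h1,
    intervalIntegral.integral_sub ((by fun_prop : Continuous fun s =>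
      heat (t + s) (Laplacian.laplacian f) r).intervalIntegrable _ _) (by simp)]
  simp only [intervalIntegral.integral_const, sub_zero, smul_eq_mul]
  ring

lemma abs_noiseResidual_le (hf : BoundedHessian f) (hG : ∀ x, |Laplacian.laplacian f x| ≤ G)
    (hτ : 0 ≤ τ) (ht : 0 < t) (r : E d) :
    |noiseResidual τ t f r| ≤ d * (τ / t) * G * τ / 2 := by
  have hG0 : 0 ≤ G := (abs_nonneg _).trans (hG 0)
  rw [hf.noiseResidual_eq_integral hτ ht.le, abs_div, abs_two]
  have := intervalIntegral.norm_integral_le_of_norm_le_const (a := 0) (b := τ)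
    (f := fun s => heat (t + s) (Laplacian.laplacian f) r - heat t (Laplacian.laplacian f) r)
    (C := d * (τ / t) * G) (fun s hs => by
      rw [Set.uIoc_of_le hτ] at hs
      refine (abs_heat_add_sub_le hf.continuous_laplacian hG hs.1.le ht r).trans ?_
      have := hs.2
      gcongr)
  rw [sub_zero, abs_of_nonneg hτ, Real.norm_eq_abs] at this
  linarith

/-- Averaging the integral with its reflection `s ↦ τ - s` shows that the error of the trapezoidal
rule is an integral of second differences. -/
lemma abs_noiseResidual_sub_le (hf : BoundedHessian f) (hτ : 0 ≤ τ) (ht : 0 ≤ t) (r : E d) {D : ℝ}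
    (hD : ∀ s, 0 ≤ s → s ≤ τ → |heat (t + s) (Laplacian.laplacian f) r
      + heat (t + (τ - s)) (Laplacian.laplacian f) r - heat t (Laplacian.laplacian f) r
      - heat (t + τ) (Laplacian.laplacian f) r| ≤ D) :
    |noiseResidual τ t f r - τ / 4 * (heat (t + τ) (Laplacian.laplacian f) r
      - heat t (Laplacian.laplacian f) r)| ≤ D * τ / 4 := by
  obtain ⟨C, hC⟩ := hf.laplacian_bounded
  set H : ℝ → ℝ := fun s => heat s (Laplacian.laplacian f) r with hHdef
  have hH : Continuous H := continuous_heat_time hf.continuous_laplacian hC r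
  have hii : ∀ {k : ℝ → ℝ}, Continuous k → IntervalIntegrable k volume 0 τ :=
    fun h => h.intervalIntegrable _ _
  have hA : noiseResidual τ t f r = (∫ s in (0 : ℝ)..τ, (H (t + s) - H t)) / 2 :=
    hf.noiseResidual_eq_integral hτ ht r
  have hrefl : ∫ s in (0 : ℝ)..τ, (H (t + (τ - s)) - H t)
      = ∫ s in (0 : ℝ)..τ, (H (t + s) - H t) := by
    rw [intervalIntegral.integral_comp_sub_left (fun s => H (t + s) - H t) τ]
    simp
  have hsum : ∫ s in (0 : ℝ)..τ, (H (t + s) + H (t + (τ - s)) - H t - H (t + τ))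
      = 2 * (∫ s in (0 : ℝ)..τ, (H (t + s) - H t)) - τ * (H (t + τ) - H t) := by
    have e : ∀ s, H (t + s) + H (t + (τ - s)) - H t - H (t + τ)
        -- The first two brackets have equal integrals by reflection; the third is constant in `s`
        -- and is the trapezoidal term.
        = (H (t + s) - H t) + (H (t + (τ - s)) - H t) - (H (t + τ) - H t) := fun s => by ring
    simp_rw [e]
    rw [intervalIntegral.integral_sub (hii (by fun_prop)) (hii (by fun_prop)),
      intervalIntegral.integral_add (hii (by fun_prop)) (hii (by fun_prop)), hrefl]
    simp only [intervalIntegral.integral_const, sub_zero, smul_eq_mul]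
    ring
  have hb := intervalIntegral.norm_integral_le_of_norm_le_const (a := 0) (b := τ)
    (f := fun s => H (t + s) + H (t + (τ - s)) - H t - H (t + τ)) (C := D) (fun s hs => by
      rw [Set.uIoc_of_le hτ] at hs
      exact hD s hs.1.le hs.2)
  rw [hsum, sub_zero, abs_of_nonneg hτ, Real.norm_eq_abs] at hb
  rw [hA]
  calc _ = |(2 * (∫ s in (0 : ℝ)..τ, (H (t + s) - H t)) - τ * (H (t + τ) - H t)) / 4| := by
        congr 1; ring
    _ ≤ _ := by rw [abs_div, abs_of_pos (by norm_num : (0 : ℝ) < 4)]; linarith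

lemma _root_.EWSG.sum_inv_sq_le (J : ℕ) :
    ∑ j ∈ Finset.range J, ((j : ℝ) + 1)⁻¹ ^ 2 ≤ 2 - (J : ℝ)⁻¹ := by
  induction J with
  | zero => norm_num
  | succ J ih =>
    rw [Finset.sum_range_succ]
    rcases Nat.eq_zero_or_pos J with rfl | hJ
    · norm_num
    have h0 : (0 : ℝ) < J := by exact_mod_cast hJ
    have h1 : ((J : ℝ) + 1)⁻¹ ^ 2 ≤ (J : ℝ)⁻¹ - ((J : ℝ) + 1)⁻¹ := by
      have e : (J : ℝ)⁻¹ - ((J : ℝ) + 1)⁻¹ = (J * (J + 1) : ℝ)⁻¹ := by field_simp; ring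
      rw [e, inv_pow]
      exact inv_anti₀ (by positivity) (by nlinarith)
    push_cast
    linarith

/-- The direct bound on the `j`-th term is of order `τ/j` and would sum to `τ log J`. Removing the
trapezoidal terms, whose sum telescopes, leaves terms of order `τ/j²`, so the bound does not depend
on `J`. -/
lemma abs_corrector_le (hf : BoundedHessian f) (hG : ∀ x, |Laplacian.laplacian f x| ≤ G)
    (hτ : 0 < τ) (J : ℕ) (r : E d) :
    |corrector τ J f r| ≤ (2 + d ^ 2) * G * τ := by
  have hG0 : 0 ≤ G := (abs_nonneg _).trans (hG 0)
  set H : ℝ → ℝ := fun s => heat s (Laplacian.laplacian f) r with hHdef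
  have hHG : ∀ s, |H s| ≤ G := fun s => abs_heat_le hG s r
  have hterm : ∀ j : ℕ, |noiseResidual τ ((j + 1 : ℕ) * τ) f r
      - τ / 4 * (H ((j + 1 + 1 : ℕ) * τ) - H ((j + 1 : ℕ) * τ))|
      ≤ d ^ 2 * ((j : ℝ) + 1)⁻¹ ^ 2 * G * τ / 4 := by
    intro j
    have hj : (0 : ℝ) < ((j + 1 : ℕ) : ℝ) * τ := by positivity
    have := hf.abs_noiseResidual_sub_le hτ.le hj.le r
      (D := d ^ 2 * ((j : ℝ) + 1)⁻¹ ^ 2 * G) (fun s hs hsτ => by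
        have h := abs_heat_second_difference_le hf.continuous_laplacian hG hs
          (sub_nonneg.2 hsτ) hj r
        rw [add_sub_cancel] at h
        refine h.trans ?_
        have h4 : 4 * s * (τ - s) ≤ τ ^ 2 := by nlinarith [sq_nonneg (τ - 2 * s)]
        have e : τ ^ 2 / (((j + 1 : ℕ) : ℝ) * τ) ^ 2 = ((j : ℝ) + 1)⁻¹ ^ 2 := by
          push_cast; field_simp
        rw [← e]
        gcongr)
    have e2 : ((j + 1 + 1 : ℕ) : ℝ) * τ = ((j + 1 : ℕ) : ℝ) * τ + τ := by push_cast; ring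
    rw [e2]
    exact this
  -- The smoothing estimate is singular at time `0`, so the first term gets the trivial bound `4 G`
  -- on the second difference.
  have hzero : |noiseResidual τ ((0 : ℕ) * τ) f r
      - τ / 4 * (H ((0 + 1 : ℕ) * τ) - H ((0 : ℕ) * τ))| ≤ 4 * G * τ / 4 := by
    have := hf.abs_noiseResidual_sub_le hτ.le (le_refl 0) r (D := 4 * G) (fun s _ _ => by
      have h1 := abs_le.1 (hHG (0 + s))
      have h2 := abs_le.1 (hHG (0 + (τ - s)))
      have h3 := abs_le.1 (hHG 0)
      have h4 := abs_le.1 (hHG (0 + τ))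
      simp only [hHdef] at h1 h2 h3 h4
      rw [abs_le]
      constructor <;> linarith)
    simpa [hHdef] using this
  have htel : ∑ j ∈ Finset.range J, τ / 4 * (H ((j + 1 : ℕ) * τ) - H ((j : ℕ) * τ))
      = τ / 4 * (H (J * τ) - H 0) := by
    rw [← Finset.mul_sum, Finset.sum_range_sub fun j : ℕ => H (j * τ)]
    simp
  have hsplit : corrector τ J f r = τ / 4 * (H (J * τ) - H 0)
      + ∑ j ∈ Finset.range J, (noiseResidual τ (j * τ) f r
        - τ / 4 * (H ((j + 1 : ℕ) * τ) - H ((j : ℕ) * τ))) := by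
    rw [Finset.sum_sub_distrib, htel, corrector]; ring
  have hfirst : |τ / 4 * (H (J * τ) - H 0)| ≤ τ / 4 * (2 * G) := by
    rw [abs_mul, abs_of_pos (by positivity)]
    have := abs_sub (H (J * τ)) (H 0)
    have h1 := hHG (J * τ)
    have h2 := hHG 0
    gcongr
    linarith
  have hsum : |∑ j ∈ Finset.range J, (noiseResidual τ (j * τ) f r
        - τ / 4 * (H ((j + 1 : ℕ) * τ) - H ((j : ℕ) * τ)))|
      ≤ 4 * G * τ / 4 + d ^ 2 * 2 * G * τ / 4 := by
    refine (Finset.abs_sum_le_sum_abs _ _).trans ?_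
    rcases J with _ | J
    · simp only [Finset.range_zero, Finset.sum_empty]; positivity
    rw [Finset.sum_range_succ', add_comm]
    refine add_le_add hzero ((Finset.sum_le_sum fun j _ => hterm j).trans ?_)
    have hs := sum_inv_sq_le J
    have hs' : ∑ j ∈ Finset.range J, ((j : ℝ) + 1)⁻¹ ^ 2 ≤ 2 := by
      have : (0 : ℝ) ≤ (J : ℝ)⁻¹ := by positivity
      linarith
    rw [← Finset.sum_div, ← Finset.sum_mul, ← Finset.sum_mul, ← Finset.mul_sum]
    gcongr
  rw [hsplit]
  refine (abs_add_le _ _).trans ((add_le_add hfirst hsum).trans ?_)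
  have : 0 ≤ G * τ := by positivity
  nlinarith [mul_nonneg (sq_nonneg (d : ℝ)) this]

lemma continuous_noiseResidual (hf : BoundedHessian f) (τ t : ℝ) :
    Continuous (noiseResidual τ t f) := by
  obtain ⟨B, hB⟩ := hf.bounded
  obtain ⟨C, hC⟩ := hf.laplacian_bounded
  have h1 := continuous_heat hf.contDiff.continuous hB
  have h2 := continuous_heat hf.continuous_laplacian hC
  exact ((h1 _).sub (h1 _)).sub (continuous_const.mul (h2 _))

lemma noiseResidual_bounded (hf : BoundedHessian f) (τ t : ℝ) :
    ∃ B, ∀ r, |noiseResidual τ t f r| ≤ B := by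
  obtain ⟨B, hB⟩ := hf.bounded
  obtain ⟨C, hC⟩ := hf.laplacian_bounded
  refine ⟨B + B + |τ / 2| * C, fun r => ?_⟩
  refine (abs_sub _ _).trans (add_le_add ((abs_sub _ _).trans
    (add_le_add (abs_heat_le hB _ _) (abs_heat_le hB _ _))) ?_)
  rw [abs_mul]
  gcongr
  exact abs_heat_le hC _ _

lemma heat_noiseResidual (hf : BoundedHessian f) (hτ : 0 ≤ τ) (ht : 0 ≤ t) (r : E d) :
    heat τ (noiseResidual τ t f) r = noiseResidual τ (τ + t) f r := by
  obtain ⟨B, hB⟩ := hf.bounded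
  obtain ⟨C, hC⟩ := hf.laplacian_bounded
  have h1 := continuous_heat hf.contDiff.continuous hB
  have h2 := continuous_heat hf.continuous_laplacian hC
  have e : noiseResidual τ t f = fun x => (heat (t + τ) f x - heat t f x)
      - τ / 2 * heat t (Laplacian.laplacian f) x := rfl
  rw [e, heat_sub (f := fun x => heat (t + τ) f x - heat t f x)
    (g := fun x => τ / 2 * heat t (Laplacian.laplacian f) x)
    ((h1 _).sub (h1 _)) (continuous_const.mul (h2 _))
    (fun x => (abs_sub _ _).trans (add_le_add (abs_heat_le hB _ _) (abs_heat_le hB _ _)))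
    (B' := |τ / 2| * C) (fun x => by rw [abs_mul]; gcongr; exact abs_heat_le hC _ _),
    heat_sub (h1 _) (h1 _) (abs_heat_le hB _) (abs_heat_le hB _), heat_const_mul,
    heat_heat hf.contDiff.continuous hB hτ (by linarith),
    heat_heat hf.contDiff.continuous hB hτ ht, heat_heat hf.continuous_laplacian hC hτ ht,
    noiseResidual]
  rw [add_assoc]

lemma continuous_corrector (hf : BoundedHessian f) (τ : ℝ) (J : ℕ) :
    Continuous (corrector τ J f) :=
  continuous_finsetSum _ fun _ _ => hf.continuous_noiseResidual _ _

/-- Applying `P_τ` shifts the summation index by one, so the sum changes only by its end terms. -/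
lemma heat_corrector (hf : BoundedHessian f) (hτ : 0 ≤ τ) (J : ℕ) (r : E d) :
    heat τ (corrector τ J f) r
      = corrector τ J f r + noiseResidual τ (J * τ) f r - noiseResidual τ 0 f r := by
  have h1 : heat τ (corrector τ J f) r
      = ∑ j ∈ Finset.range J, heat τ (noiseResidual τ (j * τ) f) r := by
    simp only [heat, corrector]
    rw [integral_finsetSum]
    intro j _
    obtain ⟨B, hB⟩ := hf.noiseResidual_bounded τ (j * τ)
    exact heat_integrable (hf.continuous_noiseResidual _ _) hB τ r
  have h2 : ∀ j : ℕ, heat τ (noiseResidual τ (j * τ) f) r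
      = noiseResidual τ ((j + 1 : ℕ) * τ) f r := fun j => by
    rw [hf.heat_noiseResidual hτ (by positivity)]
    congr 1; push_cast; ring
  rw [h1, Finset.sum_congr rfl fun j _ => h2 j, corrector]
  have := Finset.sum_range_succ (fun j : ℕ => noiseResidual τ (j * τ) f r) J
  rw [Finset.sum_range_succ'] at this
  simp only [Nat.cast_zero, zero_mul] at this
  linarith

/-- The corrected function solves the discrete heat equation up to `P_{Jτ} q`. -/
lemma heat_add_corrector (hf : BoundedHessian f) (hτ : 0 < τ) (J : ℕ) (r : E d) :
    heat τ (fun x => f x + corrector τ J f x) r = f r + corrector τ J f r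
      + τ / 2 * Laplacian.laplacian f r + noiseResidual τ (J * τ) f r := by
  obtain ⟨B, hB⟩ := hf.bounded
  obtain ⟨C, hC⟩ := hf.laplacian_bounded
  rw [heat_add hf.contDiff.continuous (hf.continuous_corrector τ J) hB
    (hf.abs_corrector_le hC hτ J), hf.heat_corrector hτ.le]
  have : noiseResidual τ 0 f r
      = heat τ f r - f r - τ / 2 * Laplacian.laplacian f r := by
    simp only [noiseResidual, zero_add, heat_zero]
  rw [this]
  ring

end BoundedHessian

end Corrector

end EWSG
end

noncomputable section

namespace EWSG

open Filter Topology Laplacian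
open scoped NNReal ENNReal

/-! ### Transfer of the corrector to phase space -/

section PhaseCorrector

variable {d : ℕ}

/-- `C³` functions whose derivatives of order at most three are bounded by `M`. -/
structure BoundedC3 {F : Type*} [NormedAddCommGroup F] [NormedSpace ℝ F] (ψ : F → ℝ) (M : ℝ) :
    Prop where
  contDiff : ContDiff ℝ 3 ψ
  bound : ∀ l ∈ Finset.range 4, ∀ X, ‖iteratedFDeriv ℝ l ψ X‖ ≤ M

namespace BoundedC3

variable {F : Type*} [NormedAddCommGroup F] [NormedSpace ℝ F] {ψ : F → ℝ} {M : ℝ}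

lemma nonneg (h : BoundedC3 ψ M) : 0 ≤ M := (norm_nonneg _).trans (h.bound 0 (by simp) 0)

lemma abs_le (h : BoundedC3 ψ M) (X : F) : |ψ X| ≤ M := by
  simpa using h.bound 0 (by simp) X

lemma differentiable (h : BoundedC3 ψ M) : Differentiable ℝ ψ :=
  h.contDiff.differentiable (by norm_num)

lemma contDiff_fderiv (h : BoundedC3 ψ M) : ContDiff ℝ 2 (fderiv ℝ ψ) :=
  h.contDiff.fderiv_right (by norm_num)

lemma contDiff_fderiv_fderiv (h : BoundedC3 ψ M) : ContDiff ℝ 1 (fderiv ℝ (fderiv ℝ ψ)) :=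
  h.contDiff_fderiv.fderiv_right (by norm_num)

lemma norm_fderiv_le (h : BoundedC3 ψ M) (X : F) : ‖fderiv ℝ ψ X‖ ≤ M := by
  rw [← norm_iteratedFDeriv_one]
  exact h.bound 1 (by simp) X

lemma norm_fderiv_fderiv_le (h : BoundedC3 ψ M) (X : F) : ‖fderiv ℝ (fderiv ℝ ψ) X‖ ≤ M := by
  rw [← norm_iteratedFDeriv_one, norm_iteratedFDeriv_fderiv]
  exact h.bound 2 (by simp) X

set_option maxSynthPendingDepth 6 in
set_option synthInstance.maxHeartbeats 100000 in
lemma norm_fderiv_fderiv_fderiv_le (h : BoundedC3 ψ M) (X : F) :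
    ‖fderiv ℝ (fderiv ℝ (fderiv ℝ ψ)) X‖ ≤ M := by
  rw [← norm_iteratedFDeriv_one, norm_iteratedFDeriv_fderiv, norm_iteratedFDeriv_fderiv]
  exact h.bound 3 (by simp) X

lemma abs_sub_le (h : BoundedC3 ψ M) (X Y : F) : |ψ X - ψ Y| ≤ M * ‖X - Y‖ :=
  convex_univ.norm_image_sub_le_of_norm_fderiv_le (𝕜 := ℝ) (fun x _ => h.differentiable x)
    (fun x _ => h.norm_fderiv_le x) (Set.mem_univ Y) (Set.mem_univ X)

/-- This turns the third-derivative bound into a Lipschitz bound on `Δ_r ψ`, hence on the corrector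
and on the residual. -/
lemma norm_hessian_sub_le (h : BoundedC3 ψ M) (X Y : F) :
    ‖fderiv ℝ (fderiv ℝ ψ) X - fderiv ℝ (fderiv ℝ ψ) Y‖ ≤ M * ‖X - Y‖ :=
  convex_univ.norm_image_sub_le_of_norm_fderiv_le (𝕜 := ℝ)
    (fun x _ => h.contDiff_fderiv_fderiv.differentiable (by norm_num) x)
    (fun x _ => h.norm_fderiv_fderiv_fderiv_le x) (Set.mem_univ Y) (Set.mem_univ X)

lemma abs_taylor_le (h : BoundedC3 ψ M) (X v : F) :
    |ψ (X + v) - ψ X - fderiv ℝ ψ X v| ≤ M * ‖v‖ ^ 2 := by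
  obtain ⟨s, -, e⟩ := exists_taylor_two (h.contDiff.of_le (by norm_num)) X v
  rw [e, show ∀ a b c : ℝ, a + b + c / 2 - a - b = c / 2 by intros; ring, abs_div, abs_two]
  have := abs_second_deriv_le (h.norm_fderiv_fderiv_le (X + s • v)) v
  linarith [abs_nonneg (fderiv ℝ (fderiv ℝ ψ) (X + s • v) v v)]

end BoundedC3

/-- The function `z ↦ ψ(θ, r + z)` of a momentum increment at `X = (θ, r)`. -/
def momSlice (ψ : Phase d → ℝ) (X : Phase d) (z : E d) : ℝ := ψ (X + (0, z))

lemma norm_zero_prod (v : E d) : ‖((0, v) : Phase d)‖ = ‖v‖ := by simp [Prod.norm_def]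

section

variable {ψ : Phase d → ℝ} {M : ℝ}

lemma hasFDerivAt_mom_add (X : Phase d) (z : E d) :
    HasFDerivAt (fun z : E d => X + (0, z)) (ContinuousLinearMap.inr ℝ (E d) (E d)) z :=
  (ContinuousLinearMap.inr ℝ (E d) (E d)).hasFDerivAt.const_add X

lemma fderiv_momSlice (h : BoundedC3 ψ M) (X : Phase d) :
    fderiv ℝ (momSlice ψ X)
      = fun z => (fderiv ℝ ψ (X + (0, z))).comp (ContinuousLinearMap.inr ℝ (E d) (E d)) :=
  funext fun z => ((h.differentiable _).hasFDerivAt.comp z (hasFDerivAt_mom_add X z)).fderiv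

lemma fderiv_fderiv_momSlice (h : BoundedC3 ψ M) (X : Phase d) (z v w : E d) :
    fderiv ℝ (fderiv ℝ (momSlice ψ X)) z v w
      = fderiv ℝ (fderiv ℝ ψ) (X + (0, z)) (0, v) (0, w) := by
  rw [fderiv_momSlice h X]
  have h1 : HasFDerivAt (fun z => fderiv ℝ ψ (X + (0, z)))
      ((fderiv ℝ (fderiv ℝ ψ) (X + (0, z))).comp (ContinuousLinearMap.inr ℝ (E d) (E d))) z :=
    ((h.contDiff_fderiv.differentiable (by norm_num)) _).hasFDerivAt.comp z
      (hasFDerivAt_mom_add X z)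
  rw [(h1.clm_comp (hasFDerivAt_const (ContinuousLinearMap.inr ℝ (E d) (E d)) z)).fderiv]
  simp

lemma boundedHessian_momSlice (h : BoundedC3 ψ M) (X : Phase d) :
    BoundedHessian (momSlice ψ X) := by
  refine ⟨?_, ⟨M, fun z => h.abs_le _⟩, ⟨M, fun z => ?_⟩⟩
  · have h2 : ContDiff ℝ 2 ψ := h.contDiff.of_le (by norm_num)
    exact h2.comp (contDiff_const.add (contDiff_const.prodMk contDiff_id))
  · refine ContinuousLinearMap.opNorm_le_bound₂ _ h.nonneg fun v w => ?_
    rw [fderiv_fderiv_momSlice h]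
    refine ((fderiv ℝ (fderiv ℝ ψ) (X + (0, z))).le_opNorm₂ _ _).trans ?_
    rw [norm_zero_prod, norm_zero_prod]
    gcongr
    exact h.norm_fderiv_fderiv_le _

lemma laplacian_momSlice (h : BoundedC3 ψ M) (X : Phase d) (z : E d) :
    Laplacian.laplacian (momSlice ψ X) z = laplacianMom ψ (X + (0, z)) := by
  have key : ∀ X z, Laplacian.laplacian (momSlice ψ X) z
      = ∑ i, fderiv ℝ (fderiv ℝ ψ) (X + (0, z)) (0, EuclideanSpace.basisFun (Fin d) ℝ i)
        (0, EuclideanSpace.basisFun (Fin d) ℝ i) := fun X z => by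
    simp_rw [laplacian_eq_sum, fderiv_fderiv_momSlice h]
  have e : laplacianMom ψ (X + (0, z))
      = Laplacian.laplacian (momSlice ψ ((X + (0, z)).1, 0)) (X + (0, z)).2 := by
    unfold laplacianMom momSlice
    simp
  have e' : ((((X + (0, z)).1, 0) + (0, (X + (0, z)).2) : Phase d)) = X + (0, z) :=
    Prod.ext (by simp) (by simp)
  rw [e, key, key, e']

lemma laplacianMom_eq_sum (h : BoundedC3 ψ M) (X : Phase d) :
    laplacianMom ψ X = ∑ i, fderiv ℝ (fderiv ℝ ψ) X (0, EuclideanSpace.basisFun (Fin d) ℝ i)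
        (0, EuclideanSpace.basisFun (Fin d) ℝ i) := by
  have h1 := laplacian_momSlice h X 0
  rw [laplacian_eq_sum] at h1
  simp_rw [fderiv_fderiv_momSlice h] at h1
  simpa [← Prod.zero_eq_mk] using h1.symm

lemma abs_laplacianMom_le (h : BoundedC3 ψ M) (X : Phase d) : |laplacianMom ψ X| ≤ d * M := by
  rw [laplacianMom_eq_sum h]
  refine (Finset.abs_sum_le_sum_abs _ _).trans ?_
  refine (Finset.sum_le_sum fun i _ => abs_second_deriv_le (h.norm_fderiv_fderiv_le X) _).trans ?_
  simp

lemma abs_laplacianMom_sub_le (h : BoundedC3 ψ M) (X Y : Phase d) :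
    |laplacianMom ψ X - laplacianMom ψ Y| ≤ d * M * ‖X - Y‖ := by
  rw [laplacianMom_eq_sum h, laplacianMom_eq_sum h, ← Finset.sum_sub_distrib]
  refine (Finset.abs_sum_le_sum_abs _ _).trans ?_
  have : ∀ i ∈ Finset.univ, |fderiv ℝ (fderiv ℝ ψ) X (0, EuclideanSpace.basisFun (Fin d) ℝ i)
        (0, EuclideanSpace.basisFun (Fin d) ℝ i)
      - fderiv ℝ (fderiv ℝ ψ) Y (0, EuclideanSpace.basisFun (Fin d) ℝ i)
        (0, EuclideanSpace.basisFun (Fin d) ℝ i)| ≤ M * ‖X - Y‖ := fun i _ => by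
    have := abs_second_deriv_le (h.norm_hessian_sub_le X Y)
      ((0, EuclideanSpace.basisFun (Fin d) ℝ i) : Phase d)
    rw [norm_zero_prod] at this
    simpa using this
  refine (Finset.sum_le_sum this).trans ?_
  simp [mul_assoc]

/-- The corrector in the momentum variable, as a function on phase space. -/
def phaseCorrector (τ : ℝ) (J : ℕ) (ψ : Phase d → ℝ) (X : Phase d) : ℝ :=
  corrector τ J (momSlice ψ X) 0

/-- The noise residual at time `Jτ`, as a function on phase space. -/
def phaseResidual (τ : ℝ) (J : ℕ) (ψ : Phase d → ℝ) (X : Phase d) : ℝ :=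
  noiseResidual τ (J * τ) (momSlice ψ X) 0

lemma abs_laplacian_momSlice_le (h : BoundedC3 ψ M) (X : Phase d) (z : E d) :
    |Laplacian.laplacian (momSlice ψ X) z| ≤ d * M := by
  rw [laplacian_momSlice h]; exact abs_laplacianMom_le h _

lemma abs_laplacian_momSlice_sub_le (h : BoundedC3 ψ M) (X Y : Phase d) (z : E d) :
    |Laplacian.laplacian (fun z => momSlice ψ X z - momSlice ψ Y z) z| ≤ d * M * ‖X - Y‖ := by
  rw [(boundedHessian_momSlice h X).laplacian_sub (boundedHessian_momSlice h Y),
    laplacian_momSlice h, laplacian_momSlice h]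
  have := abs_laplacianMom_sub_le h (X + (0, z)) (Y + (0, z))
  rwa [add_sub_add_right_eq_sub] at this

variable {τ : ℝ} {J : ℕ}

lemma abs_phaseCorrector_le (h : BoundedC3 ψ M) (hτ : 0 < τ) (X : Phase d) :
    |phaseCorrector τ J ψ X| ≤ (2 + d ^ 2) * (d * M) * τ :=
  (boundedHessian_momSlice h X).abs_corrector_le (abs_laplacian_momSlice_le h X) hτ J 0

/-- By linearity the difference is the corrector of the difference of two slices, whose Laplacian is
at most `d M ‖X - Y‖`. The sup bound thus becomes a Lipschitz bound without differentiating the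
corrector. -/
lemma abs_phaseCorrector_sub_le (h : BoundedC3 ψ M) (hτ : 0 < τ) (X Y : Phase d) :
    |phaseCorrector τ J ψ X - phaseCorrector τ J ψ Y|
      ≤ (2 + d ^ 2) * (d * M * ‖X - Y‖) * τ := by
  have hX := boundedHessian_momSlice h X
  have hY := boundedHessian_momSlice h Y
  rw [phaseCorrector, phaseCorrector, ← hX.corrector_sub hY]
  exact (hX.sub hY).abs_corrector_le (abs_laplacian_momSlice_sub_le h X Y) hτ J 0

lemma abs_phaseResidual_le (h : BoundedC3 ψ M) (hτ : 0 < τ) (hJ : 0 < J) (X : Phase d) :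
    |phaseResidual τ J ψ X| ≤ d * (τ / (J * τ)) * (d * M) * τ / 2 :=
  (boundedHessian_momSlice h X).abs_noiseResidual_le (abs_laplacian_momSlice_le h X) hτ.le
    (by positivity) 0

lemma abs_phaseResidual_sub_le (h : BoundedC3 ψ M) (hτ : 0 < τ) (hJ : 0 < J) (X Y : Phase d) :
    |phaseResidual τ J ψ X - phaseResidual τ J ψ Y|
      ≤ d * (τ / (J * τ)) * (d * M * ‖X - Y‖) * τ / 2 := by
  have hX := boundedHessian_momSlice h X
  have hY := boundedHessian_momSlice h Y
  rw [phaseResidual, phaseResidual, ← hX.noiseResidual_sub hY]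
  exact (hX.sub hY).abs_noiseResidual_le (abs_laplacian_momSlice_sub_le h X Y) hτ.le
    (by positivity) 0

lemma heat_momSlice_add (t : ℝ) (f : E d → ℝ) (a z : E d) :
    heat t (fun z => f (a + z)) z = heat t f (a + z) := by
  simp [heat, add_assoc]

/-- The heat flow commutes with translations, so the correctors of the different slices are
restrictions of one function on phase space. -/
lemma corrector_momSlice (h : BoundedC3 ψ M) (X : Phase d) (z : E d) :
    corrector τ J (momSlice ψ X) z = phaseCorrector τ J ψ (X + (0, z)) := by
  have e : momSlice ψ (X + (0, z)) = fun w => momSlice ψ X (z + w) := by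
    funext w; simp [momSlice, add_assoc]
  have e' : Laplacian.laplacian (momSlice ψ (X + (0, z)))
      = fun w => Laplacian.laplacian (momSlice ψ X) (z + w) := by
    funext w; simp [laplacian_momSlice h, add_assoc]
  simp only [phaseCorrector, corrector, noiseResidual, e']
  simp only [e, heat_momSlice_add, add_zero]

lemma integral_corrected (h : BoundedC3 ψ M) (hτ : 0 < τ) (X : Phase d) :
    ∫ z, (ψ (X + (0, √τ • z)) + phaseCorrector τ J ψ (X + (0, √τ • z))) ∂(stdGaussian (E d))
      = ψ X + phaseCorrector τ J ψ X + τ / 2 * laplacianMom ψ X + phaseResidual τ J ψ X := by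
  have := (boundedHessian_momSlice h X).heat_add_corrector hτ J 0
  simp only [heat, zero_add, corrector_momSlice h, laplacian_momSlice h] at this
  simpa [momSlice, phaseResidual, ← Prod.zero_eq_mk] using this

end

end PhaseCorrector

end EWSG
end

noncomputable section

namespace EWSG

/-! ### Closeness of the index laws to the uniform law -/

section IndexBias

variable {d n : ℕ}

/-- A lower bound on all entries is also an upper bound on each: the other `n - 1` entries leave at
most `1/n + B` of the total mass. -/
lemma abs_sub_inv_le_of_le {p : Fin n → ℝ} {B : ℝ} (hB : 0 ≤ B) (hsum : ∑ i, p i = 1)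
    (hp : ∀ i, (1 - B) / n ≤ p i) (i : Fin n) : |p i - 1 / n| ≤ B := by
  have hn : (0 : ℝ) < n := by exact_mod_cast i.pos
  have hn1 : (1 : ℝ) ≤ n := by exact_mod_cast i.pos
  have h1 : ∑ j ∈ Finset.univ.erase i, (1 - B) / n ≤ ∑ j ∈ Finset.univ.erase i, p j :=
    Finset.sum_le_sum fun j _ => hp j
  have h2 := Finset.add_sum_erase Finset.univ p (Finset.mem_univ i)
  rw [Finset.sum_const, Finset.card_erase_of_mem (Finset.mem_univ i), Finset.card_univ,
    Fintype.card_fin, nsmul_eq_mul, Nat.cast_pred i.pos] at h1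
  have h3 : ((n : ℝ) - 1) * ((1 - B) / n) = 1 - 1 / n - B + B / n := by field_simp; ring
  have h4 : B / n ≤ B := div_le_self hB hn1
  have h5 : 0 ≤ B / n := by positivity
  have h6 := hp i
  rw [sub_div] at h6
  rw [abs_le]
  constructor <;> linarith

/-- The logarithm of the unnormalized index weight, up to a constant. -/
def halfSq (γ h : ℝ) (V : Fin n → E d → ℝ) (x θ : E d) (i : Fin n) : ℝ :=
  ‖x + (n : ℝ) • scaledGrad γ h V θ i‖ ^ 2 / 2

variable {γ h : ℝ} {V : Fin n → E d → ℝ} {x θ : E d}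

lemma halfSq_nonneg (i : Fin n) : 0 ≤ halfSq γ h V x θ i := by unfold halfSq; positivity

lemma ewsgProb_eq (i : Fin n) : ewsgProb γ h V x θ i
    = Real.exp (halfSq γ h V x θ i) / ∑ j, Real.exp (halfSq γ h V x θ j) := by
  simp only [ewsgProb, expWeight, Real.exp_add, ← Finset.mul_sum]
  rw [mul_div_mul_left _ _ (Real.exp_ne_zero _)]
  rfl

lemma one_sub_div_le_exp {y B : ℝ} (hy : 0 ≤ y) : (1 - B) / (n : ℝ) ≤ Real.exp (y - B) / n := by
  gcongr
  linarith [Real.add_one_le_exp (y - B)]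

lemma abs_ewsgProb_sub_le {B : ℝ} (hB : ∀ i, halfSq γ h V x θ i ≤ B) (i : Fin n) :
    |ewsgProb γ h V x θ i - 1 / n| ≤ B := by
  have hn : (0 : ℝ) < n := by exact_mod_cast i.pos
  have : Nonempty (Fin n) := ⟨i⟩
  have hpos : 0 < ∑ j, Real.exp (halfSq γ h V x θ j) :=
    Finset.sum_pos (fun j _ => Real.exp_pos _) Finset.univ_nonempty
  refine abs_sub_inv_le_of_le ((halfSq_nonneg i).trans (hB i)) ?_ (fun j => ?_) i
  · simp_rw [ewsgProb_eq, ← Finset.sum_div]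
    exact div_self hpos.ne'
  · refine (one_sub_div_le_exp (halfSq_nonneg (γ := γ) (h := h) (V := V) (x := x) (θ := θ) j)).trans
      ?_
    rw [ewsgProb_eq, Real.exp_sub, div_div]
    refine div_le_div_of_nonneg_left (Real.exp_nonneg _) hpos ?_
    refine (Finset.sum_le_sum fun k _ => Real.exp_le_exp.2 (hB k)).trans_eq ?_
    simp [mul_comm]

lemma exp_mul_acceptProb (i j : Fin n) :
    Real.exp (halfSq γ h V x θ i) * acceptProb γ h V x θ i j
      = min (Real.exp (halfSq γ h V x θ i)) (Real.exp (halfSq γ h V x θ j)) := by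
  have e : acceptProb γ h V x θ i j
      = min 1 (Real.exp (halfSq γ h V x θ j - halfSq γ h V x θ i)) := rfl
  rw [e, mul_min_of_nonneg _ _ (Real.exp_nonneg _), mul_one, ← Real.exp_add, add_sub_cancel]

lemma acceptProb_le_one (i j : Fin n) : acceptProb γ h V x θ i j ≤ 1 := min_le_left _ _

lemma acceptProb_nonneg (i j : Fin n) : 0 ≤ acceptProb γ h V x θ i j :=
  le_min zero_le_one (Real.exp_nonneg _)

lemma metropolisKernel_nonneg (i j : Fin n) : 0 ≤ metropolisKernel γ h V x θ i j := by
  unfold metropolisKernel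
  refine add_nonneg (mul_nonneg (by positivity) (acceptProb_nonneg i j)) ?_
  split_ifs
  · exact Finset.sum_nonneg fun l _ =>
      mul_nonneg (by positivity) (sub_nonneg.2 (acceptProb_le_one i l))
  · exact le_rfl

lemma sum_metropolisKernel (i : Fin n) : ∑ j, metropolisKernel γ h V x θ i j = 1 := by
  have hn : (n : ℝ) ≠ 0 := by exact_mod_cast i.pos.ne'
  unfold metropolisKernel
  rw [Finset.sum_add_distrib, Finset.sum_ite_eq, if_pos (Finset.mem_univ i),
    ← Finset.sum_add_distrib]
  simp_rw [← mul_add, add_sub_cancel]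
  simp [hn]

/-- Off the diagonal, both sides are `1/n` times the smaller of the two weights. -/
lemma metropolisKernel_detailed_balance (i j : Fin n) :
    Real.exp (halfSq γ h V x θ i) * metropolisKernel γ h V x θ i j
      = Real.exp (halfSq γ h V x θ j) * metropolisKernel γ h V x θ j i := by
  rcases eq_or_ne i j with rfl | hij
  · rfl
  · simp only [metropolisKernel, if_neg hij, if_neg hij.symm, add_zero]
    rw [mul_left_comm, exp_mul_acceptProb, mul_left_comm, exp_mul_acceptProb, min_comm]

lemma sum_exp_mul_metropolisKernel (j : Fin n) :
    ∑ i, Real.exp (halfSq γ h V x θ i) * metropolisKernel γ h V x θ i j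
      = Real.exp (halfSq γ h V x θ j) := by
  simp_rw [metropolisKernel_detailed_balance _ j]
  rw [← Finset.mul_sum, sum_metropolisKernel, mul_one]

lemma sum_metropolisProb (hn : 0 < n) (M : ℕ) : ∑ j, metropolisProb γ h V x θ M j = 1 := by
  induction M with
  | zero =>
    have : (n : ℝ) ≠ 0 := by exact_mod_cast hn.ne'
    simp [metropolisProb, this]
  | succ M ih =>
    simp only [metropolisProb]
    rw [Finset.sum_comm]
    simp_rw [← Finset.mul_sum, sum_metropolisKernel, mul_one, ih]

/-- The uniform initial law dominates the weights scaled by `exp (-B) / n`. The kernel is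
nonnegative and leaves the weights invariant, so domination persists for every `M`, with no mixing
estimate. -/
lemma exp_div_le_metropolisProb {B : ℝ} (hB : ∀ i, halfSq γ h V x θ i ≤ B) (M : ℕ) (j : Fin n) :
    Real.exp (halfSq γ h V x θ j - B) / n ≤ metropolisProb γ h V x θ M j := by
  induction M generalizing j with
  | zero =>
    simp only [metropolisProb]
    gcongr
    exact Real.exp_le_one_iff.2 (by linarith [hB j])
  | succ M ih =>
    simp only [metropolisProb]
    calc Real.exp (halfSq γ h V x θ j - B) / n
        = ∑ i, Real.exp (halfSq γ h V x θ i - B) / n * metropolisKernel γ h V x θ i j := by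
          simp_rw [Real.exp_sub]
          rw [← sum_exp_mul_metropolisKernel j, Finset.sum_div, Finset.sum_div]
          exact Finset.sum_congr rfl fun i _ => by ring
      _ ≤ _ := Finset.sum_le_sum fun i _ =>
          mul_le_mul_of_nonneg_right (ih i) (metropolisKernel_nonneg i j)

lemma abs_metropolisProb_sub_le {B : ℝ} (hB : ∀ i, halfSq γ h V x θ i ≤ B) (M : ℕ) (i : Fin n) :
    |metropolisProb γ h V x θ M i - 1 / n| ≤ B :=
  abs_sub_inv_le_of_le ((halfSq_nonneg i).trans (hB i)) (sum_metropolisProb i.pos M)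
    (fun j => (one_sub_div_le_exp (halfSq_nonneg j)).trans (exp_div_le_metropolisProb hB M j)) i

/-- The size `1 + ‖r‖ + ∑ ‖∇V_i(θ)‖` of the coefficients of the dynamics at `X = (θ, r)`. -/
def growth (V : Fin n → E d → ℝ) (X : Phase d) : ℝ := 1 + ‖X.2‖ + ∑ i, ‖gradient (V i) X.1‖

lemma one_add_norm_le_growth (V : Fin n → E d → ℝ) (X : Phase d) : 1 + ‖X.2‖ ≤ growth V X :=
  le_add_of_nonneg_right (Finset.sum_nonneg fun _ _ => norm_nonneg _)

lemma one_le_growth (V : Fin n → E d → ℝ) (X : Phase d) : 1 ≤ growth V X :=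
  (le_add_of_nonneg_right (norm_nonneg _)).trans (one_add_norm_le_growth V X)

lemma norm_snd_le_growth (V : Fin n → E d → ℝ) (X : Phase d) : ‖X.2‖ ≤ growth V X := by
  linarith [one_add_norm_le_growth V X]

lemma norm_gradient_le_growth (V : Fin n → E d → ℝ) (X : Phase d) (i : Fin n) :
    ‖gradient (V i) X.1‖ ≤ growth V X := by
  have := Finset.single_le_sum (f := fun i => ‖gradient (V i) X.1‖) (fun _ _ => norm_nonneg _)
    (Finset.mem_univ i)
  have h2 := norm_nonneg X.2
  unfold growth
  linarith

/-- Half the square of a sum is at most the sum of the squares. The hyper-parameter contributes `c ^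
2`, and `σ² = 2γ` in the scaled gradient contributes `n ^ 2 / (2γ)`. -/
lemma halfSq_le {c : ℝ} (hγ : 0 < γ) (hh : 0 ≤ h) {X : Phase d} {y : E d}
    (hy : ‖y‖ ≤ c * √h * (1 + ‖X.2‖)) (i : Fin n) :
    halfSq γ h V y X.1 i ≤ (c ^ 2 + n ^ 2 / (2 * γ)) * h * growth V X ^ 2 := by
  have h1 : ‖y‖ ^ 2 ≤ c ^ 2 * h * growth V X ^ 2 := by
    calc ‖y‖ ^ 2 ≤ (c * √h * (1 + ‖X.2‖)) ^ 2 := by gcongr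
      _ = c ^ 2 * h * (1 + ‖X.2‖) ^ 2 := by rw [mul_pow, mul_pow, Real.sq_sqrt hh]
      _ ≤ _ := by gcongr; exact one_add_norm_le_growth V X
  have h2 : ‖(n : ℝ) • scaledGrad γ h V X.1 i‖ ^ 2 ≤ n ^ 2 / (2 * γ) * h * growth V X ^ 2 := by
    rw [scaledGrad, norm_smul, norm_smul, mul_pow, mul_pow, norm_div, div_pow, Real.norm_eq_abs,
      Real.norm_eq_abs, Real.norm_eq_abs, sq_abs, sq_abs, sq_abs, noiseAmp, Real.sq_sqrt hh,
      Real.sq_sqrt (by positivity)]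
    calc _ = n ^ 2 / (2 * γ) * h * ‖gradient (V i) X.1‖ ^ 2 := by ring
      _ ≤ _ := by gcongr; exact norm_gradient_le_growth V X i
  have h3 := norm_add_le y ((n : ℝ) • scaledGrad γ h V X.1 i)
  have h4 : ‖y + (n : ℝ) • scaledGrad γ h V X.1 i‖ ^ 2
      ≤ 2 * (‖y‖ ^ 2 + ‖(n : ℝ) • scaledGrad γ h V X.1 i‖ ^ 2) :=
    (pow_le_pow_left₀ (norm_nonneg _) h3 2).trans add_sq_le
  unfold halfSq
  linarith

/-- The index probabilities of all schemes are uniform up to `O(h)`. -/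
lemma abs_prob_sub_le {c : ℝ} (hγ : 0 < γ) (hh : 0 ≤ h) {S : IndexScheme d}
    (hS : S.Admissible c h) (X : Phase d) (i : Fin n) :
    |S.prob γ h V X i - 1 / n| ≤ (c ^ 2 + n ^ 2 / (2 * γ)) * h * growth V X ^ 2 := by
  cases S with
  | uniform =>
    simp only [IndexScheme.prob, sub_self, abs_zero]
    positivity
  | ewsg x => exact abs_ewsgProb_sub_le (fun i => halfSq_le hγ hh (hS.2 X) i) i
  | ewsgMetropolis x M => exact abs_metropolisProb_sub_le (fun i => halfSq_le hγ hh (hS.2 X) i) M i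

end IndexBias

end EWSG
end

noncomputable section

namespace EWSG

/-! ### The one-step weak expansion -/

section OneStep

variable {d n : ℕ} {γ c h M : ℝ} {V : Fin n → E d → ℝ} {ψ : Phase d → ℝ} {J : ℕ}

lemma inner_gradPos (h : BoundedC3 ψ M) (X : Phase d) (v : E d) :
    inner ℝ v (gradPos ψ X) = fderiv ℝ ψ X (v, 0) := by
  have h1 : HasFDerivAt (fun θ : E d => ψ (θ, X.2))
      ((fderiv ℝ ψ X).comp (ContinuousLinearMap.inl ℝ (E d) (E d))) X.1 :=
    (h.differentiable X).hasFDerivAt.comp X.1 (hasFDerivAt_prodMk_left X.1 X.2)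
  rw [gradPos, gradient, h1.fderiv, real_inner_comm, InnerProductSpace.toDual_symm_apply]
  simp

lemma inner_gradMom (h : BoundedC3 ψ M) (X : Phase d) (v : E d) :
    inner ℝ v (gradMom ψ X) = fderiv ℝ ψ X (0, v) := by
  have h1 : HasFDerivAt (fun r : E d => ψ (X.1, r))
      ((fderiv ℝ ψ X).comp (ContinuousLinearMap.inr ℝ (E d) (E d))) X.2 :=
    (h.differentiable X).hasFDerivAt.comp X.2 (hasFDerivAt_prodMk_right X.1 X.2)
  rw [gradMom, gradient, h1.fderiv, real_inner_comm, InnerProductSpace.toDual_symm_apply]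
  simp

lemma abs_inner_gradMom_le (h : BoundedC3 ψ M) (X : Phase d) (v : E d) :
    |inner ℝ v (gradMom ψ X)| ≤ M * ‖v‖ := by
  rw [inner_gradMom h]
  refine ((fderiv ℝ ψ X).le_opNorm _).trans ?_
  rw [norm_zero_prod]
  gcongr
  exact h.norm_fderiv_le X

lemma abs_inner_gradPos_le (h : BoundedC3 ψ M) (X : Phase d) (v : E d) :
    |inner ℝ v (gradPos ψ X)| ≤ M * ‖v‖ := by
  rw [inner_gradPos h]
  refine ((fderiv ℝ ψ X).le_opNorm _).trans ?_
  have : ‖((v, 0) : Phase d)‖ = ‖v‖ := by simp [Prod.norm_def]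
  rw [this]
  gcongr
  exact h.norm_fderiv_le X

lemma gradient_totalPotential (hV : ∀ i, Differentiable ℝ (V i)) (θ : E d) :
    gradient (totalPotential V) θ = ∑ i, gradient (V i) θ := by
  have h1 : fderiv ℝ (totalPotential V) θ = ∑ i, fderiv ℝ (V i) θ :=
    fderiv_fun_sum fun i _ => hV i θ
  simp only [gradient, h1, map_sum]

/-- The conditional mean increment of the chain when the stochastic gradient is `G`. -/
def driftStep (γ h : ℝ) (G : E d) (X : Phase d) : Phase d :=
  (h • X.2, -(h • (G + γ • X.2)))

/-- The test function with the noise corrector added. -/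
def corrected (γ h : ℝ) (J : ℕ) (ψ : Phase d → ℝ) (X : Phase d) : ℝ :=
  ψ X + phaseCorrector (2 * γ * h) J ψ X

/-- The corrected test function averaged over the Gaussian noise of one step. -/
def smoothed (γ h : ℝ) (J : ℕ) (ψ : Phase d → ℝ) (X : Phase d) : ℝ :=
  corrected γ h J ψ X + γ * h * laplacianMom ψ X + phaseResidual (2 * γ * h) J ψ X

lemma integral_corrected_eq_smoothed (hψ : BoundedC3 ψ M) (hγ : 0 < γ) (hh : 0 < h)
    (X : Phase d) :
    ∫ z, corrected γ h J ψ (X + (0, √(2 * γ * h) • z)) ∂(stdGaussian (E d))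
      = smoothed γ h J ψ X := by
  have := integral_corrected (J := J) hψ (by positivity : 0 < 2 * γ * h) X
  simp only [corrected, smoothed]
  rw [this]
  ring

/-- A Lipschitz constant and bound of the corrected test function. -/
def correctedConst (d : ℕ) (γ M : ℝ) : ℝ := M + (2 + d ^ 2) * (d * M) * (2 * γ)

lemma abs_corrected_le (hψ : BoundedC3 ψ M) (hγ : 0 < γ) (hh : 0 < h) (hh1 : h ≤ 1)
    (X : Phase d) : |corrected γ h J ψ X| ≤ correctedConst d γ M := by
  have h1 := abs_phaseCorrector_le (J := J) hψ (by positivity : 0 < 2 * γ * h) X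
  have hM := hψ.nonneg
  have h2 : (2 + (d : ℝ) ^ 2) * (d * M) * (2 * γ * h) ≤ (2 + d ^ 2) * (d * M) * (2 * γ) := by
    exact mul_le_mul_of_nonneg_left (mul_le_of_le_one_right (by positivity) hh1) (by positivity)
  have h3 := abs_add_le (ψ X) (phaseCorrector (2 * γ * h) J ψ X)
  have h4 := hψ.abs_le X
  unfold corrected correctedConst
  linarith

lemma abs_corrected_sub_le (hψ : BoundedC3 ψ M) (hγ : 0 < γ) (hh : 0 < h) (hh1 : h ≤ 1)
    (X Y : Phase d) :
    |corrected γ h J ψ X - corrected γ h J ψ Y| ≤ correctedConst d γ M * ‖X - Y‖ := by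
  have h1 := abs_phaseCorrector_sub_le (J := J) hψ (by positivity : 0 < 2 * γ * h) X Y
  have hM := hψ.nonneg
  have h2 : (2 + (d : ℝ) ^ 2) * (d * M * ‖X - Y‖) * (2 * γ * h)
      ≤ (2 + d ^ 2) * (d * M * ‖X - Y‖) * (2 * γ) := by
    exact mul_le_mul_of_nonneg_left (mul_le_of_le_one_right (by positivity) hh1) (by positivity)
  have h3 := abs_add_le (ψ X - ψ Y)
    (phaseCorrector (2 * γ * h) J ψ X - phaseCorrector (2 * γ * h) J ψ Y)
  have h4 := hψ.abs_sub_le X Y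
  unfold corrected correctedConst
  rw [add_sub_add_comm]
  linarith

lemma continuous_of_abs_sub_le {F : Type*} [NormedAddCommGroup F] {f : F → ℝ} {L : ℝ}
    (hf : ∀ x y, |f x - f y| ≤ L * ‖x - y‖) : Continuous f :=
  (LipschitzWith.of_dist_le_mul (K := L.toNNReal) fun x y => by
    rw [Real.dist_eq, dist_eq_norm]
    exact (hf x y).trans (by gcongr; exact Real.le_coe_toNNReal L)).continuous

lemma continuous_corrected (hψ : BoundedC3 ψ M) (hγ : 0 < γ) (hh : 0 < h) (hh1 : h ≤ 1) :
    Continuous (corrected γ h J ψ) :=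
  continuous_of_abs_sub_le (abs_corrected_sub_le hψ hγ hh hh1)

lemma continuous_laplacianMom (hψ : BoundedC3 ψ M) : Continuous (laplacianMom ψ) :=
  continuous_of_abs_sub_le (abs_laplacianMom_sub_le hψ)

lemma continuous_smoothed (hψ : BoundedC3 ψ M) (hγ : 0 < γ) (hh : 0 < h) (hh1 : h ≤ 1)
    (hJ : 0 < J) : Continuous (smoothed γ h J ψ) := by
  have hS : Continuous (phaseResidual (2 * γ * h) J ψ) :=
    continuous_of_abs_sub_le (L := d * (2 * γ * h / (J * (2 * γ * h))) * (d * M) * (2 * γ * h) / 2)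
      fun X Y => (abs_phaseResidual_sub_le hψ (by positivity) hJ X Y).trans_eq (by ring)
  exact ((continuous_corrected hψ hγ hh hh1).add
    (continuous_const.mul (continuous_laplacianMom hψ))).add hS

/-- A constant bounding the one-step remainder. -/
def stepConst (d n : ℕ) (γ M : ℝ) : ℝ :=
  M * (1 + n + γ) ^ 2
    + ((2 + d ^ 2) * (d * M) * (2 * γ) + γ * (d * M) + d * (d * M) * γ) * (1 + n + γ)
    + d * (d * M) * γ

lemma norm_driftStep_le (hγ : 0 < γ) (hh : 0 < h) {X : Phase d} {G : E d} {Q : ℝ} (hQ : 1 ≤ Q)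
    (hr : ‖X.2‖ ≤ Q) (hG : ‖G‖ ≤ n * Q) : ‖driftStep γ h G X‖ ≤ h * ((1 + n + γ) * Q) := by
  have hn : (0 : ℝ) ≤ n := by positivity
  refine norm_prod_le_iff.2 ⟨?_, ?_⟩
  · simp only [driftStep, norm_smul, Real.norm_eq_abs, abs_of_pos hh]
    gcongr
    nlinarith
  · simp only [driftStep, norm_neg, norm_smul, Real.norm_eq_abs, abs_of_pos hh]
    gcongr
    refine (norm_add_le _ _).trans ?_
    rw [norm_smul, Real.norm_eq_abs, abs_of_pos hγ]
    nlinarith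

/-- One-step weak expansion: only `C³` regularity of `ψ` is used, thanks to the corrector. -/
lemma abs_one_step_le (hψ : BoundedC3 ψ M) (hγ : 0 < γ) (hh : 0 < h) (hh1 : h ≤ 1)
    (hJ : 1 ≤ J * h) {X : Phase d} {G : E d} {Q : ℝ} (hQ : 1 ≤ Q) (hr : ‖X.2‖ ≤ Q)
    (hG : ‖G‖ ≤ n * Q) :
    |smoothed γ h J ψ (X + driftStep γ h G X) - corrected γ h J ψ X - h * generator γ V ψ X
      + h * inner ℝ (G - gradient (totalPotential V) X.1) (gradMom ψ X)|
      ≤ stepConst d n γ M * h ^ 2 * Q ^ 2 := by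
  have hM := hψ.nonneg
  have hτ : 0 < 2 * γ * h := by positivity
  have hJ0 : 0 < J := by
    rcases Nat.eq_zero_or_pos J with rfl | hJ0
    · norm_num at hJ
    · exact hJ0
  -- The smoothing gain at time `Jτ` is `1/J`; this is where `1 ≤ J h` makes the residual `O(h²)`.
  have hJh : 2 * γ * h / (J * (2 * γ * h)) ≤ h := by
    rw [div_le_iff₀ (by positivity)]
    nlinarith
  set D := driftStep γ h G X with hD
  have hDn : ‖D‖ ≤ h * ((1 + n + γ) * Q) := norm_driftStep_le hγ hh hQ hr hG
  have hDf : fderiv ℝ ψ X D = h * inner ℝ X.2 (gradPos ψ X)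
      - h * inner ℝ (G + γ • X.2) (gradMom ψ X) := by
    have e : D = h • ((X.2, 0) : Phase d) - h • ((0, G + γ • X.2) : Phase d) := by
      rw [hD, driftStep]; ext1 <;> simp
    rw [e, map_sub, map_smul, map_smul, inner_gradPos hψ, inner_gradMom hψ]
    rfl
  have hgen : h * generator γ V ψ X = fderiv ℝ ψ X D
      + h * inner ℝ (G - gradient (totalPotential V) X.1) (gradMom ψ X)
      + γ * h * laplacianMom ψ X := by
    rw [hDf, generator]
    simp only [inner_add_left, inner_sub_left]
    ring
  have h1 := hψ.abs_taylor_le X D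
  have h2 := abs_phaseCorrector_sub_le (J := J) hψ hτ (X + D) X
  have h3 := abs_laplacianMom_sub_le hψ (X + D) X
  have h4 := abs_phaseResidual_sub_le hψ hτ hJ0 (X + D) X
  have h5 := abs_phaseResidual_le hψ hτ hJ0 X
  rw [add_sub_cancel_left] at h2 h3 h4
  have h4' : |phaseResidual (2 * γ * h) J ψ (X + D) - phaseResidual (2 * γ * h) J ψ X|
      ≤ d * 1 * (d * M * ‖D‖) * (2 * γ * h) / 2 :=
    h4.trans (by gcongr; exact hJh.trans hh1)
  have h5' : |phaseResidual (2 * γ * h) J ψ X| ≤ d * h * (d * M) * (2 * γ * h) / 2 :=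
    h5.trans (by gcongr)
  have h3' : |γ * h * (laplacianMom ψ (X + D) - laplacianMom ψ X)|
      ≤ γ * h * (d * M * ‖D‖) := by
    rw [abs_mul, abs_of_pos (by positivity)]; gcongr
  -- With the noise averaged out exactly, only the displacement `D = O(h)` is expanded. Taylor's
  -- formula is needed for `ψ` alone: the corrector, Laplacian and residual terms already carry a
  -- factor `h`, so their Lipschitz bounds suffice. The value of `γ h Δ_r ψ` at `X` cancels against
  -- the generator.
  have key : smoothed γ h J ψ (X + D) - corrected γ h J ψ X - h * generator γ V ψ X
      + h * inner ℝ (G - gradient (totalPotential V) X.1) (gradMom ψ X)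
      = (ψ (X + D) - ψ X - fderiv ℝ ψ X D)
        + (phaseCorrector (2 * γ * h) J ψ (X + D) - phaseCorrector (2 * γ * h) J ψ X)
        + γ * h * (laplacianMom ψ (X + D) - laplacianMom ψ X)
        + (phaseResidual (2 * γ * h) J ψ (X + D) - phaseResidual (2 * γ * h) J ψ X)
        + phaseResidual (2 * γ * h) J ψ X := by
    rw [hgen]; simp only [smoothed, corrected]; ring
  have hb : |smoothed γ h J ψ (X + D) - corrected γ h J ψ X - h * generator γ V ψ X
      + h * inner ℝ (G - gradient (totalPotential V) X.1) (gradMom ψ X)|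
      ≤ M * ‖D‖ ^ 2 + (2 + d ^ 2) * (d * M * ‖D‖) * (2 * γ * h) + γ * h * (d * M * ‖D‖)
        + d * 1 * (d * M * ‖D‖) * (2 * γ * h) / 2 + d * h * (d * M) * (2 * γ * h) / 2 := by
    rw [key]
    refine (abs_add_le _ _).trans (add_le_add ((abs_add_le _ _).trans (add_le_add
      ((abs_add_le _ _).trans (add_le_add ((abs_add_le _ _).trans (add_le_add h1 h2)) h3')) h4'))
      h5')
  refine hb.trans ?_
  calc _ = M * ‖D‖ ^ 2 + ((2 + d ^ 2) * (d * M) * (2 * γ) + γ * (d * M) + d * (d * M) * γ) * h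
          * ‖D‖ + d * (d * M) * γ * h ^ 2 * 1 := by ring
    _ ≤ M * (h * ((1 + n + γ) * Q)) ^ 2
        + ((2 + d ^ 2) * (d * M) * (2 * γ) + γ * (d * M) + d * (d * M) * γ) * h
          * (h * ((1 + n + γ) * (Q * Q))) + d * (d * M) * γ * h ^ 2 * (Q ^ 2) := by
        have hQ2 : 1 ≤ Q ^ 2 := one_le_pow₀ hQ
        have hQQ : Q ≤ Q * Q := by nlinarith
        have hD2 : ‖D‖ ≤ h * ((1 + n + γ) * (Q * Q)) := hDn.trans (by gcongr)
        gcongr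
    _ = _ := by unfold stepConst; ring

/-- The Poisson right-hand side grows at most linearly in the coefficients of the dynamics. -/
lemma abs_generator_le (hψ : BoundedC3 ψ M) (hγ : 0 < γ) (hV : ∀ i, Differentiable ℝ (V i))
    (X : Phase d) :
    |generator γ V ψ X| ≤ (M * (2 + γ) + γ * (d * M)) * growth V X := by
  have hM := hψ.nonneg
  have h1 := abs_inner_gradPos_le hψ X X.2
  have h2 := abs_inner_gradMom_le hψ X (γ • X.2 + gradient (totalPotential V) X.1)
  have h3 := abs_laplacianMom_le hψ X
  have hQ := one_le_growth V X
  have hr := norm_snd_le_growth V X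
  have hg : ‖γ • X.2 + gradient (totalPotential V) X.1‖ ≤ (γ + 1) * growth V X := by
    refine (norm_add_le _ _).trans ?_
    rw [norm_smul, Real.norm_eq_abs, abs_of_pos hγ, gradient_totalPotential hV, add_mul, one_mul]
    gcongr
    refine (norm_sum_le _ _).trans ?_
    unfold growth
    linarith [norm_nonneg X.2]
  have h4 : |γ * laplacianMom ψ X| ≤ γ * (d * M) * growth V X := by
    rw [abs_mul, abs_of_pos hγ]
    calc γ * |laplacianMom ψ X| ≤ γ * (d * M) * 1 := by rw [mul_one]; gcongr
      _ ≤ _ := by gcongr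
  unfold generator
  refine (abs_add_le _ _).trans ((add_le_add (abs_sub _ _) h4).trans ?_)
  have h1' : M * ‖X.2‖ ≤ M * growth V X := by gcongr
  have h2' : M * ‖γ • X.2 + gradient (totalPotential V) X.1‖ ≤ M * ((γ + 1) * growth V X) := by
    gcongr
  linarith

/-- The bias of the averaged stochastic gradient. -/
lemma abs_inner_bias_le {S : IndexScheme d} (hψ : BoundedC3 ψ M) (hγ : 0 < γ) (hh : 0 < h)
    (hV : ∀ i, Differentiable ℝ (V i)) (hS : S.Admissible c h) (hn : 0 < n) (X : Phase d) :
    |inner ℝ (∑ i, S.prob γ h V X i • ((n : ℝ) • gradient (V i) X.1)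
      - gradient (totalPotential V) X.1) (gradMom ψ X)|
      ≤ M * (n * (c ^ 2 + n ^ 2 / (2 * γ))) * h * growth V X ^ 3 := by
  have hM := hψ.nonneg
  have hn' : (n : ℝ) ≠ 0 := by exact_mod_cast hn.ne'
  have hQ := one_le_growth V X
  -- Uniform sampling is unbiased, so only the deviation from the uniform law remains.
  have e : ∑ i, S.prob γ h V X i • ((n : ℝ) • gradient (V i) X.1)
      - gradient (totalPotential V) X.1
      = ∑ i, (S.prob γ h V X i - 1 / n) • ((n : ℝ) • gradient (V i) X.1) := by
    rw [gradient_totalPotential hV, ← Finset.sum_sub_distrib]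
    refine Finset.sum_congr rfl fun i _ => ?_
    rw [sub_smul, smul_smul (1 / (n : ℝ)), one_div_mul_cancel hn', one_smul]
  have hb : ‖∑ i, (S.prob γ h V X i - 1 / n) • ((n : ℝ) • gradient (V i) X.1)‖
      ≤ (c ^ 2 + n ^ 2 / (2 * γ)) * h * growth V X ^ 2 * (n * growth V X) := by
    refine (norm_sum_le _ _).trans ?_
    calc ∑ i, ‖(S.prob γ h V X i - 1 / n) • ((n : ℝ) • gradient (V i) X.1)‖
        ≤ ∑ i, (c ^ 2 + n ^ 2 / (2 * γ)) * h * growth V X ^ 2 * (n * ‖gradient (V i) X.1‖) := by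
          refine Finset.sum_le_sum fun i _ => ?_
          rw [norm_smul, norm_smul, Real.norm_eq_abs, Real.norm_natCast]
          gcongr
          exact abs_prob_sub_le hγ hh.le hS X i
      _ = (c ^ 2 + n ^ 2 / (2 * γ)) * h * growth V X ^ 2
            * (n * ∑ i, ‖gradient (V i) X.1‖) := by rw [← Finset.mul_sum, ← Finset.mul_sum]
      _ ≤ _ := by
          gcongr
          unfold growth
          linarith [norm_nonneg X.2]
  refine (abs_inner_gradMom_le hψ X _).trans ?_
  rw [e]
  calc _ ≤ M * ((c ^ 2 + n ^ 2 / (2 * γ)) * h * growth V X ^ 2 * (n * growth V X)) := by gcongr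
    _ = _ := by ring

end OneStep

end EWSG
end

noncomputable section

namespace EWSG

/-! ### Conditional expectations, orthogonality and measurability -/

section Generic

variable {Ω : Type*} {m mΩ : MeasurableSpace Ω} {P : Measure Ω}

lemma integral_sub_condExp_mul [IsFiniteMeasure P] (hm : m ≤ mΩ)
    {f A : Ω → ℝ} (hf : Integrable f P) (hA : StronglyMeasurable[m] A)
    (hfA : Integrable (fun ω => f ω * A ω) P) :
    Integrable (fun ω => (f ω - (P[f | m]) ω) * A ω) P ∧
      ∫ ω, (f ω - (P[f | m]) ω) * A ω ∂P = 0 := by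
  have h := condExp_mul_of_stronglyMeasurable_right (μ := P) hA hfA hf
  have h1 : Integrable (fun ω => (P[f | m]) ω * A ω) P := integrable_condExp.congr h
  have e : (fun ω => (f ω - (P[f | m]) ω) * A ω) = fun ω => f ω * A ω - (P[f | m]) ω * A ω := by
    funext ω; ring
  rw [e]
  refine ⟨hfA.sub h1, ?_⟩
  rw [integral_sub hfA h1, sub_eq_zero]
  calc ∫ ω, f ω * A ω ∂P = ∫ ω, (P[fun ω => f ω * A ω | m]) ω ∂P := (integral_condExp hm).symm
    _ = ∫ ω, (P[f | m]) ω * A ω ∂P := integral_congr_ae h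

lemma integral_sq_sum_of_orthogonal {N : ℕ → Ω → ℝ} (hN : ∀ k, MemLp (N k) 2 P)
    (horth : ∀ j k, j < k → ∫ ω, N j ω * N k ω ∂P = 0) (K : ℕ) :
    ∫ ω, (∑ k ∈ Finset.range K, N k ω) ^ 2 ∂P = ∑ k ∈ Finset.range K, ∫ ω, N k ω ^ 2 ∂P := by
  induction K with
  | zero => simp
  | succ K ih =>
    have hS : MemLp (fun ω => ∑ k ∈ Finset.range K, N k ω) 2 P := memLp_finsetSum _ fun k _ => hN k
    have hprod : ∀ j, Integrable (fun ω => N j ω * N K ω) P := fun j =>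
      (hN j).integrable_mul (hN K)
    have hcross : ∫ ω, 2 * ∑ k ∈ Finset.range K, N k ω * N K ω ∂P = 0 := by
      rw [integral_const_mul, integral_finsetSum _ fun j _ => hprod j,
        Finset.sum_eq_zero fun j hj => horth j K (Finset.mem_range.1 hj), mul_zero]
    have e : ∀ ω, (∑ k ∈ Finset.range (K + 1), N k ω) ^ 2 = (∑ k ∈ Finset.range K, N k ω) ^ 2
        + 2 * ∑ k ∈ Finset.range K, N k ω * N K ω + N K ω ^ 2 := fun ω => by
      rw [Finset.sum_range_succ, ← Finset.sum_mul]; ring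
    have hi2 : Integrable (fun ω => 2 * ∑ k ∈ Finset.range K, N k ω * N K ω) P :=
      (integrable_finsetSum _ fun j _ => hprod j).const_mul 2
    simp_rw [e]
    have hi1 : Integrable (fun ω => (∑ k ∈ Finset.range K, N k ω) ^ 2
        + 2 * ∑ k ∈ Finset.range K, N k ω * N K ω) P := hS.integrable_sq.add hi2
    rw [integral_add hi1 (hN K).integrable_sq,
      integral_add hS.integrable_sq hi2, hcross, ih, Finset.sum_range_succ, add_zero]

/-- Independence makes the joint law a product; by Fubini it is enough that `F` integrates to zero
over the noise for each frozen `y`. -/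
lemma integral_eq_zero_of_indep [IsProbabilityMeasure P] {A B : Type*} [MeasurableSpace A]
    [MeasurableSpace B] (hm : m ≤ mΩ) {ξ : Ω → A} {Y : Ω → B}
    (hξ : Measurable ξ) (hY : Measurable[m] Y)
    (hind : Indep (MeasurableSpace.comap ξ inferInstance) m P) {F : A × B → ℝ} (hF : Measurable F)
    (hint : Integrable (fun ω => F (ξ ω, Y ω)) P) (h0 : ∀ y, ∫ z, F (z, y) ∂(P.map ξ) = 0) :
    ∫ ω, F (ξ ω, Y ω) ∂P = 0 := by
  have hY' : Measurable Y := hY.mono hm le_rfl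
  have hi : IndepFun ξ Y P :=
    (IndepFun_iff_Indep ξ Y P).2 (indep_of_indep_of_le_right hind hY.comap_le)
  have hmap := (indepFun_iff_map_prod_eq_prod_map_map hξ.aemeasurable hY'.aemeasurable).1 hi
  have hp : Measurable fun ω => (ξ ω, Y ω) := hξ.prodMk hY'
  have : IsProbabilityMeasure (P.map ξ) := Measure.isProbabilityMeasure_map hξ.aemeasurable
  have : IsProbabilityMeasure (P.map Y) := Measure.isProbabilityMeasure_map hY'.aemeasurable
  have hint' : Integrable F ((P.map ξ).prod (P.map Y)) := by
    rw [← hmap]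
    exact (integrable_map_measure hF.aestronglyMeasurable hp.aemeasurable).2 hint
  calc ∫ ω, F (ξ ω, Y ω) ∂P = ∫ p, F p ∂(P.map fun ω => (ξ ω, Y ω)) :=
        (integral_map hp.aemeasurable hF.aestronglyMeasurable).symm
    _ = 0 := by
        rw [hmap, integral_prod_symm _ hint']
        simp [h0]

/-- The gradients of the `V i` need not be continuous, but the derivative of any function here is
Borel measurable. -/
lemma measurable_gradient {d : ℕ} {f : E d → ℝ} : Measurable (gradient f) := by
  unfold gradient
  exact (InnerProductSpace.toDual ℝ (E d)).symm.continuous.measurable.comp (measurable_fderiv ℝ f)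

lemma measurable_stochGrad_of {d n : ℕ} {V : Fin n → E d → ℝ} {θ : ℕ → Ω → E d}
    {I : ℕ → Ω → Fin n} {k : ℕ} (hθ : Measurable[m] (θ k))
    (hI : Measurable[m] (I k)) : Measurable[m] (stochGrad V θ I k) := by
  have h1 : Measurable fun p : Fin n × E d => gradient (V p.1) p.2 :=
    measurable_from_prod_countable_right fun i => measurable_gradient (f := V i)
  exact (h1.comp (hI.prodMk hθ)).const_smul (n : ℝ)

end Generic

/-- The standing assumptions on the chain and the test function. -/
structure ChainSetup {d n : ℕ} {Ω : Type*} {mΩ : MeasurableSpace Ω} (P : Measure Ω)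
    (ℱ : Filtration ℕ mΩ) (γ c h M₁ M₂ M₃ : ℝ) (V : Fin n → E d → ℝ) (S : IndexScheme d)
    (θ r : ℕ → Ω → E d) (I : ℕ → Ω → Fin n) (ξ : ℕ → Ω → E d) (ψ : Phase d → ℝ) : Prop where
  n_pos : 0 < n
  γ_pos : 0 < γ
  h_pos : 0 < h
  differentiable : ∀ i, Differentiable ℝ (V i)
  admissible : S.Admissible c h
  chain : IsSGLangevinChain P ℱ γ h V S θ r I ξ
  grad_integrable : ∀ i k, Integrable (fun ω => ‖gradient (V i) (θ k ω)‖ ^ 6) P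
  grad_le : ∀ i k, ∫ ω, ‖gradient (V i) (θ k ω)‖ ^ 6 ∂P ≤ M₁
  mom_integrable : ∀ k, Integrable (fun ω => ‖r k ω‖ ^ 6) P
  mom_le : ∀ k, ∫ ω, ‖r k ω‖ ^ 6 ∂P ≤ M₂
  bounded : BoundedC3 ψ M₃

/-! ### Adaptedness and moments along the chain -/

namespace ChainSetup

variable {d n : ℕ} {Ω : Type*} {mΩ : MeasurableSpace Ω} {P : Measure Ω} {ℱ : Filtration ℕ mΩ}
  {γ c h M₁ M₂ M₃ : ℝ} {V : Fin n → E d → ℝ} {S : IndexScheme d} {θ r : ℕ → Ω → E d}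
  {I : ℕ → Ω → Fin n} {ξ : ℕ → Ω → E d} {ψ : Phase d → ℝ}

section Measurability

variable (H : ChainSetup P ℱ γ c h M₁ M₂ M₃ V S θ r I ξ ψ)

include H

lemma adapted (k : ℕ) : Measurable[ℱ k] (θ k) ∧ Measurable[ℱ k] (r k) := by
  induction k with
  | zero => exact ⟨H.chain.pos_init_measurable, H.chain.mom_init_measurable⟩
  | succ k ih =>
    have hle : ℱ k ≤ ℱ (k + 1) := ℱ.mono k.le_succ
    have hθ : Measurable[ℱ (k + 1)] (θ k) := ih.1.mono hle le_rfl
    have hr : Measurable[ℱ (k + 1)] (r k) := ih.2.mono hle le_rfl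
    have hG := measurable_stochGrad_of (V := V) hθ (H.chain.index_measurable k)
    refine ⟨?_, ?_⟩
    · rw [show θ (k + 1) = fun ω => θ k ω + h • r k ω from funext (H.chain.pos_step k)]
      exact hθ.add (hr.const_smul h)
    · rw [show r (k + 1) = fun ω => r k ω - h • (stochGrad V θ I k ω + γ • r k ω)
        + (noiseAmp γ * √h) • ξ (k + 1) ω from funext (H.chain.mom_step k)]
      exact (hr.sub ((hG.add (hr.const_smul γ)).const_smul h)).add
        ((H.chain.noise_measurable k).const_smul (noiseAmp γ * √h))

lemma measurable_pos (k : ℕ) : Measurable (θ k) := (H.adapted k).1.mono (ℱ.le k) le_rfl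

lemma measurable_mom (k : ℕ) : Measurable (r k) := (H.adapted k).2.mono (ℱ.le k) le_rfl

lemma measurable_state_adapted (k : ℕ) : Measurable[ℱ k] fun ω => (θ k ω, r k ω) :=
  (H.adapted k).1.prodMk (H.adapted k).2

lemma measurable_state (k : ℕ) : Measurable fun ω => (θ k ω, r k ω) :=
  (H.measurable_pos k).prodMk (H.measurable_mom k)

lemma measurable_index (k : ℕ) : Measurable (I k) :=
  (H.chain.index_measurable k).mono (ℱ.le _) le_rfl

lemma measurable_noise (k : ℕ) : Measurable (ξ (k + 1)) :=
  (H.chain.noise_measurable k).mono (ℱ.le _) le_rfl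

lemma measurable_growth (k : ℕ) : Measurable fun ω => growth V (θ k ω, r k ω) := by
  have h1 := H.measurable_mom k
  have h2 := H.measurable_pos k
  unfold growth
  exact (measurable_const.add h1.norm).add
    (Finset.measurable_sum _ fun i _ => (measurable_gradient.comp h2).norm)

end Measurability

/-- A bound for the sixth moment of `growth` along the chain. -/
def _root_.EWSG.growthMoment (n : ℕ) (M₁ M₂ : ℝ) : ℝ := 32 * (32 * (1 + M₂) + n ^ 5 * (n * M₁))

/-- Convexity of the sixth power: each splitting into two terms costs `2 ^ 5 = 32`, and the sum over
the data costs `n ^ 5`. -/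
lemma _root_.EWSG.growth_pow_six_le (V : Fin n → E d → ℝ) (X : Phase d) :
    growth V X ^ 6 ≤ 32 * (32 * (1 + ‖X.2‖ ^ 6)
      + n ^ 5 * ∑ i, ‖gradient (V i) X.1‖ ^ 6) := by
  have hs : 0 ≤ ∑ i, ‖gradient (V i) X.1‖ := Finset.sum_nonneg fun _ _ => norm_nonneg _
  have h1 := add_pow_le (add_nonneg zero_le_one (norm_nonneg X.2)) hs 6
  have h2 := add_pow_le zero_le_one (norm_nonneg X.2) 6
  have h3 := pow_sum_le_card_mul_sum_pow (s := Finset.univ) (f := fun i => ‖gradient (V i) X.1‖)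
    (fun _ _ => norm_nonneg _) 5
  simp only [Finset.card_univ, Fintype.card_fin] at h3
  norm_num at h1 h2 h3
  unfold growth
  linarith

section Moments

variable [IsProbabilityMeasure P] (H : ChainSetup P ℱ γ c h M₁ M₂ M₃ V S θ r I ξ ψ)

include H

lemma integrable_growth_pow_six (k : ℕ) :
    Integrable (fun ω => growth V (θ k ω, r k ω) ^ 6) P ∧
      ∫ ω, growth V (θ k ω, r k ω) ^ 6 ∂P ≤ growthMoment n M₁ M₂ := by
  have hi1 : Integrable (fun ω => 32 * (1 + ‖r k ω‖ ^ 6)) P :=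
    ((integrable_const 1).add (H.mom_integrable k)).const_mul 32
  have hi2 : Integrable (fun ω => (n : ℝ) ^ 5 * ∑ i, ‖gradient (V i) (θ k ω)‖ ^ 6) P :=
    (integrable_finsetSum _ fun i _ => H.grad_integrable i k).const_mul _
  have hi : Integrable (fun ω => 32 * (32 * (1 + ‖r k ω‖ ^ 6)
      + n ^ 5 * ∑ i, ‖gradient (V i) (θ k ω)‖ ^ 6)) P := (hi1.add hi2).const_mul 32
  have hle : ∀ ω, growth V (θ k ω, r k ω) ^ 6 ≤ 32 * (32 * (1 + ‖r k ω‖ ^ 6)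
      + n ^ 5 * ∑ i, ‖gradient (V i) (θ k ω)‖ ^ 6) := fun ω => growth_pow_six_le V _
  have hg : Integrable (fun ω => growth V (θ k ω, r k ω) ^ 6) P := by
    refine hi.mono' ((H.measurable_growth k).pow_const 6).aestronglyMeasurable
      (ae_of_all _ fun ω => ?_)
    rw [Real.norm_eq_abs, abs_of_nonneg (by positivity)]
    exact hle ω
  refine ⟨hg, (integral_mono hg hi hle).trans ?_⟩
  rw [integral_const_mul, integral_add hi1 hi2, integral_const_mul, integral_const_mul,
    integral_add (integrable_const 1) (H.mom_integrable k),
    integral_finsetSum _ fun i _ => H.grad_integrable i k]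
  have h1 := H.mom_le k
  have h2 : ∑ i, ∫ ω, ‖gradient (V i) (θ k ω)‖ ^ 6 ∂P ≤ n * M₁ := by
    refine (Finset.sum_le_sum fun i _ => H.grad_le i k).trans_eq ?_
    simp
  simp only [integral_const, probReal_univ, smul_eq_mul, mul_one]
  unfold growthMoment
  gcongr

lemma integrable_growth_pow {j : ℕ} (hj : j ≤ 6) (k : ℕ) :
    Integrable (fun ω => growth V (θ k ω, r k ω) ^ j) P ∧
      ∫ ω, growth V (θ k ω, r k ω) ^ j ∂P ≤ growthMoment n M₁ M₂ := by
  obtain ⟨h1, h2⟩ := H.integrable_growth_pow_six k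
  have hle : ∀ ω, growth V (θ k ω, r k ω) ^ j ≤ growth V (θ k ω, r k ω) ^ 6 := fun ω =>
    pow_le_pow_right₀ (one_le_growth V _) hj
  have hg : Integrable (fun ω => growth V (θ k ω, r k ω) ^ j) P := by
    refine h1.mono' ((H.measurable_growth k).pow_const j).aestronglyMeasurable
      (ae_of_all _ fun ω => ?_)
    have := (zero_le_one.trans (one_le_growth V (θ k ω, r k ω)))
    rw [Real.norm_eq_abs, abs_of_nonneg (by positivity)]
    exact hle ω
  exact ⟨hg, (integral_mono hg h1 hle).trans h2⟩

/-- Random variables dominated by a cubic polynomial in `growth` are square integrable. -/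
lemma memLp_of_abs_le {f : Ω → ℝ} (hf : AEStronglyMeasurable f P) {B : ℝ} {j : ℕ} (hj : j ≤ 3)
    (k : ℕ) (hB : ∀ᵐ ω ∂P, |f ω| ≤ B * growth V (θ k ω, r k ω) ^ j) :
    MemLp f 2 P ∧ ∫ ω, f ω ^ 2 ∂P ≤ B ^ 2 * growthMoment n M₁ M₂ := by
  obtain ⟨h1, h2⟩ := H.integrable_growth_pow (by omega : 2 * j ≤ 6) k
  have hle : ∀ᵐ ω ∂P, f ω ^ 2 ≤ B ^ 2 * growth V (θ k ω, r k ω) ^ (2 * j) := by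
    filter_upwards [hB] with ω hω
    have := pow_le_pow_left₀ (abs_nonneg _) hω 2
    rwa [sq_abs, mul_pow, ← pow_mul, mul_comm j] at this
  have hi : Integrable (fun ω => f ω ^ 2) P := by
    refine (h1.const_mul (B ^ 2)).mono' (hf.pow 2) ?_
    filter_upwards [hle] with ω hω
    rwa [Real.norm_eq_abs, abs_of_nonneg (sq_nonneg _)]
  refine ⟨(memLp_two_iff_integrable_sq hf).2 hi, ?_⟩
  refine (integral_mono_ae hi (h1.const_mul _) hle).trans ?_
  rw [integral_const_mul]
  gcongr

end Moments

end ChainSetup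

end EWSG
end

/-! ### Subsampling fluctuations and the conditional covariance -/

noncomputable section

namespace EWSG

/-- The indicator of the event that the datum `i` is used in the `k`-th iteration. -/
def indexIndicator {n : ℕ} {Ω : Type*} (I : ℕ → Ω → Fin n) (k : ℕ) (i : Fin n) : Ω → ℝ :=
  Set.indicator {ω | I k ω = i} fun _ => (1 : ℝ)

/-- The deviation of the stochastic gradient from its conditional mean. -/
def gradFluct {d n : ℕ} {Ω : Type*} {mΩ : MeasurableSpace Ω} (P : Measure Ω) (ℱ : Filtration ℕ mΩ)
    (V : Fin n → E d → ℝ) (θ : ℕ → Ω → E d) (I : ℕ → Ω → Fin n) (k : ℕ) (ω : Ω) : E d :=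
  ∑ i, (indexIndicator I k i ω - (P[indexIndicator I k i | ℱ k]) ω)
    • ((n : ℝ) • gradient (V i) (θ k ω))

/-- The martingale increment caused by subsampling. -/
def gradIncrement {d n : ℕ} {Ω : Type*} {mΩ : MeasurableSpace Ω} (P : Measure Ω)
    (ℱ : Filtration ℕ mΩ) (V : Fin n → E d → ℝ) (θ r : ℕ → Ω → E d) (I : ℕ → Ω → Fin n)
    (ψ : Phase d → ℝ) (k : ℕ) (ω : Ω) : ℝ :=
  fderiv ℝ ψ (θ k ω, r k ω) (0, gradFluct P ℱ V θ I k ω)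

/-- The martingale increment caused by the Gaussian noise. -/
def noiseIncrement {d n : ℕ} {Ω : Type*} (γ h : ℝ) (J : ℕ) (V : Fin n → E d → ℝ)
    (θ r : ℕ → Ω → E d) (I : ℕ → Ω → Fin n) (ψ : Phase d → ℝ) (k : ℕ) (ω : Ω) : ℝ :=
  corrected γ h J ψ (θ (k + 1) ω, r (k + 1) ω)
    - smoothed γ h J ψ ((θ k ω, r k ω) + driftStep γ h (stochGrad V θ I k ω) (θ k ω, r k ω))

namespace ChainSetup

variable {d n : ℕ} {Ω : Type*} {mΩ : MeasurableSpace Ω} {P : Measure Ω} {ℱ : Filtration ℕ mΩ}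
  {γ c h M₁ M₂ M₃ : ℝ} {V : Fin n → E d → ℝ} {S : IndexScheme d} {θ r : ℕ → Ω → E d}
  {I : ℕ → Ω → Fin n} {ξ : ℕ → Ω → E d} {ψ : Phase d → ℝ}

lemma stochGrad_eq_sum (k : ℕ) (ω : Ω) :
    stochGrad V θ I k ω = ∑ i, indexIndicator I k i ω • ((n : ℝ) • gradient (V i) (θ k ω)) := by
  have e : ∀ i, indexIndicator I k i ω = if I k ω = i then 1 else 0 := fun i => by
    simp [indexIndicator, Set.indicator_apply]
  simp_rw [e, ite_smul, one_smul, zero_smul]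
  simp [stochGrad]

lemma abs_indexIndicator_le (k : ℕ) (i : Fin n) (ω : Ω) : |indexIndicator I k i ω| ≤ 1 := by
  unfold indexIndicator
  rw [Set.indicator_apply]
  split_ifs <;> simp

lemma norm_stochGrad_le (k : ℕ) (ω : Ω) :
    ‖stochGrad V θ I k ω‖ ≤ n * growth V (θ k ω, r k ω) := by
  rw [stochGrad, norm_smul, Real.norm_natCast]
  gcongr
  exact norm_gradient_le_growth V (θ k ω, r k ω) (I k ω)

lemma ae_abs_condExp_indexIndicator_le [IsProbabilityMeasure P] (k : ℕ) :
    ∀ᵐ ω ∂P, ∀ i, |(P[indexIndicator I k i | ℱ k]) ω| ≤ 1 :=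
  ae_all_iff.2 fun i => ae_bdd_abs_condExp_of_ae_bdd_abs (R := (1 : ℝ))
    (ae_of_all _ fun ω => abs_indexIndicator_le k i ω)

lemma measurable_indexIndicator_of {m : MeasurableSpace Ω} {k : ℕ} (hI : Measurable[m] (I k))
    (i : Fin n) : Measurable[m] (indexIndicator I k i) :=
  Measurable.indicator measurable_const (hI (measurableSet_singleton i))

lemma ae_norm_gradFluct_le [IsProbabilityMeasure P] (k : ℕ) :
    ∀ᵐ ω ∂P, ‖gradFluct P ℱ V θ I k ω‖ ≤ 2 * n * growth V (θ k ω, r k ω) := by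
  filter_upwards [ae_abs_condExp_indexIndicator_le (P := P) (ℱ := ℱ) (I := I) k] with ω hω
  refine (norm_sum_le _ _).trans ?_
  calc _ ≤ ∑ i, 2 * (n * ‖gradient (V i) (θ k ω)‖) := Finset.sum_le_sum fun i _ => by
        rw [norm_smul, norm_smul, Real.norm_natCast, Real.norm_eq_abs]
        gcongr
        have h1 := abs_sub (indexIndicator I k i ω) ((P[indexIndicator I k i | ℱ k]) ω)
        have h2 := hω i
        have h3 := abs_indexIndicator_le (I := I) k i ω
        linarith
    _ = 2 * n * ∑ i, ‖gradient (V i) (θ k ω)‖ := by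
        rw [← Finset.mul_sum, ← Finset.mul_sum]; ring
    _ ≤ _ := by
        gcongr
        unfold growth
        linarith [norm_nonneg (r k ω)]

lemma _root_.EWSG.BoundedC3.continuous_fderiv_apply (H : BoundedC3 ψ M₃) :
    Continuous fun p : Phase d × E d => fderiv ℝ ψ p.1 (0, p.2) := by
  have := H.contDiff_fderiv.continuous
  fun_prop

lemma _root_.EWSG.BoundedC3.abs_fderiv_apply_le (H : BoundedC3 ψ M₃) (X : Phase d) (v : E d) :
    |fderiv ℝ ψ X (0, v)| ≤ M₃ * ‖v‖ := by
  rw [← inner_gradMom H]; exact abs_inner_gradMom_le H X v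

lemma gradIncrement_eq_sum (k : ℕ) (ω : Ω) : gradIncrement P ℱ V θ r I ψ k ω
    = ∑ i, (indexIndicator I k i ω - (P[indexIndicator I k i | ℱ k]) ω)
      * (n * fderiv ℝ ψ (θ k ω, r k ω) (0, gradient (V i) (θ k ω))) := by
  have e : ∀ v : E d, fderiv ℝ ψ (θ k ω, r k ω) (0, v)
      = ((fderiv ℝ ψ (θ k ω, r k ω)).comp (ContinuousLinearMap.inr ℝ (E d) (E d))) v := fun v => by
    simp
  simp only [gradIncrement, gradFluct, e, map_sum, map_smul, smul_eq_mul]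

lemma trace_condCov_eq (k : ℕ) (ω : Ω) : (condCov P (ℱ k) (stochGrad V θ I k) ω).trace
    = ∑ a, (P[fun ω' => (stochGrad V θ I k ω' a - (P[fun ω'' => stochGrad V θ I k ω'' a | ℱ k]) ω')
      * (stochGrad V θ I k ω' a - (P[fun ω'' => stochGrad V θ I k ω'' a | ℱ k]) ω') | ℱ k]) ω := rfl

lemma integrable_trace_condCov (k : ℕ) :
    Integrable (fun ω => (condCov P (ℱ k) (stochGrad V θ I k) ω).trace) P := by
  simp_rw [trace_condCov_eq]
  exact integrable_finsetSum _ fun _ _ => integrable_condExp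

section Fluctuation

variable [IsProbabilityMeasure P] (H : ChainSetup P ℱ γ c h M₁ M₂ M₃ V S θ r I ξ ψ)

include H

lemma integrable_indexIndicator (k : ℕ) (i : Fin n) : Integrable (indexIndicator I k i) P :=
  integrable_of_abs_le (measurable_indexIndicator_of (H.measurable_index k) i).aestronglyMeasurable
    (abs_indexIndicator_le k i)

omit [IsProbabilityMeasure P] in
lemma measurable_gradFluct (k : ℕ) : Measurable[ℱ (k + 1)] (gradFluct P ℱ V θ I k) := by
  have hle : ℱ k ≤ ℱ (k + 1) := ℱ.mono k.le_succ
  have hθ : Measurable[ℱ (k + 1)] (θ k) := (H.adapted k).1.mono hle le_rfl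
  refine Finset.measurable_sum _ fun i _ => ?_
  exact ((measurable_indexIndicator_of (H.chain.index_measurable k) i).sub
    (stronglyMeasurable_condExp.measurable.mono hle le_rfl)).smul
    ((measurable_gradient.comp hθ).const_smul (n : ℝ))

omit [IsProbabilityMeasure P] in
lemma measurable_gradIncrement (k : ℕ) :
    Measurable[ℱ (k + 1)] (gradIncrement P ℱ V θ r I ψ k) :=
  H.bounded.continuous_fderiv_apply.measurable.comp
    (((H.measurable_state_adapted k).mono (ℱ.mono k.le_succ) le_rfl).prodMk
      (H.measurable_gradFluct k))

lemma memLp_gradIncrement (k : ℕ) : MemLp (gradIncrement P ℱ V θ r I ψ k) 2 P := by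
  refine (H.memLp_of_abs_le (B := M₃ * (2 * n)) (j := 1)
    ((H.measurable_gradIncrement k).mono (ℱ.le _) le_rfl).aestronglyMeasurable (by norm_num) k ?_).1
  filter_upwards [ae_norm_gradFluct_le k] with ω hω
  refine (H.bounded.abs_fderiv_apply_le _ _).trans ?_
  have := H.bounded.nonneg
  rw [pow_one, mul_assoc]
  gcongr

/-- The later increment is a finite sum of centred index indicators with `ℱ k`-measurable
coefficients. The earlier increment is `ℱ k`-measurable and can be absorbed into them. -/
lemma gradIncrement_orthogonal {j k : ℕ} (hjk : j < k) :
    ∫ ω, gradIncrement P ℱ V θ r I ψ j ω * gradIncrement P ℱ V θ r I ψ k ω ∂P = 0 := by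
  set A : Fin n → Ω → ℝ := fun i ω =>
    n * fderiv ℝ ψ (θ k ω, r k ω) (0, gradient (V i) (θ k ω)) * gradIncrement P ℱ V θ r I ψ j ω
    with hA
  have hmeas1 : ∀ i, Measurable[ℱ k] fun ω =>
      n * fderiv ℝ ψ (θ k ω, r k ω) (0, gradient (V i) (θ k ω)) := fun i =>
    (H.bounded.continuous_fderiv_apply.measurable.comp ((H.measurable_state_adapted k).prodMk
      (measurable_gradient.comp (H.adapted k).1))).const_mul _
  have hAm : ∀ i, Measurable[ℱ k] (A i) := fun i =>
    (hmeas1 i).mul ((H.measurable_gradIncrement j).mono (ℱ.mono hjk) le_rfl)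
  have hAi : ∀ i, Integrable (A i) P := fun i => by
    refine MemLp.integrable_mul (H.memLp_of_abs_le (B := n * M₃) (j := 1)
      ((hmeas1 i).mono (ℱ.le _) le_rfl).aestronglyMeasurable (by norm_num) k
      (ae_of_all _ fun ω => ?_)).1 (H.memLp_gradIncrement j)
    rw [abs_mul, Nat.abs_cast, pow_one, mul_assoc]
    gcongr
    refine (H.bounded.abs_fderiv_apply_le _ _).trans ?_
    have := H.bounded.nonneg
    gcongr
    exact norm_gradient_le_growth V (θ k ω, r k ω) i
  have key : ∀ i, Integrable (fun ω => (indexIndicator I k i ω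
      - (P[indexIndicator I k i | ℱ k]) ω) * A i ω) P ∧
      ∫ ω, (indexIndicator I k i ω - (P[indexIndicator I k i | ℱ k]) ω) * A i ω ∂P = 0 := fun i =>
    integral_sub_condExp_mul (ℱ.le k) (H.integrable_indexIndicator k i) (hAm i).stronglyMeasurable
      ((hAi i).bdd_mul (c := 1)
        (measurable_indexIndicator_of (H.measurable_index k) i).aestronglyMeasurable
        (ae_of_all _ fun ω => abs_indexIndicator_le k i ω))
  have e : ∀ ω, gradIncrement P ℱ V θ r I ψ j ω * gradIncrement P ℱ V θ r I ψ k ω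
      = ∑ i, (indexIndicator I k i ω - (P[indexIndicator I k i | ℱ k]) ω) * A i ω := fun ω => by
    rw [gradIncrement_eq_sum k, Finset.mul_sum]
    exact Finset.sum_congr rfl fun i _ => by rw [hA]; ring
  simp_rw [e]
  rw [integral_finsetSum _ fun i _ => (key i).1]
  exact Finset.sum_eq_zero fun i _ => (key i).2

lemma integrable_gradient_coord (i : Fin n) (k : ℕ) (a : Fin d) :
    Integrable (fun ω => ((n : ℝ) • gradient (V i) (θ k ω)) a) P := by
  have hm : Measurable fun ω => (n : ℝ) • gradient (V i) (θ k ω) :=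
    (measurable_gradient.comp (H.measurable_pos k)).const_smul (n : ℝ)
  refine ((H.integrable_growth_pow (j := 1) (by norm_num) k).1.const_mul (n : ℝ)).mono'
    ((by fun_prop : Measurable fun x : E d => x a).comp hm).aestronglyMeasurable
    (ae_of_all _ fun ω => ?_)
  refine (PiLp.norm_apply_le _ a).trans ?_
  rw [norm_smul, Real.norm_natCast, pow_one]
  gcongr
  exact norm_gradient_le_growth V (θ k ω, r k ω) i

/-- `gradFluct` is the centred stochastic gradient. -/
lemma stochGrad_sub_condExp (k : ℕ) (a : Fin d) :
    (fun ω => stochGrad V θ I k ω a - (P[fun ω => stochGrad V θ I k ω a | ℱ k]) ω)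
      =ᵐ[P] fun ω => gradFluct P ℱ V θ I k ω a := by
  set g : Fin n → Ω → ℝ := fun i ω => ((n : ℝ) • gradient (V i) (θ k ω)) a with hg
  have hgm : ∀ i, StronglyMeasurable[ℱ k] (g i) := fun i => by
    have h1 : Measurable[ℱ k] fun ω => (n : ℝ) • gradient (V i) (θ k ω) :=
      (measurable_gradient.comp (H.adapted k).1).const_smul (n : ℝ)
    exact ((by fun_prop : Measurable fun x : E d => x a).comp h1).stronglyMeasurable
  have hprod : ∀ i, Integrable (indexIndicator I k i * g i) P := fun i =>
    (H.integrable_gradient_coord i k a).bdd_mul (c := 1)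
      (measurable_indexIndicator_of (H.measurable_index k) i).aestronglyMeasurable
      (ae_of_all _ fun ω => abs_indexIndicator_le k i ω)
  have e : (fun ω => stochGrad V θ I k ω a) = ∑ i, indexIndicator I k i * g i := by
    funext ω
    rw [stochGrad_eq_sum]
    simp [hg]
  have h1 := condExp_finsetSum (μ := P) (s := Finset.univ) (fun i _ => hprod i) (ℱ k)
  have h2 : ∀ᵐ ω ∂P, ∀ i, (P[indexIndicator I k i * g i | ℱ k]) ω
      = (P[indexIndicator I k i | ℱ k] * g i) ω := ae_all_iff.2 fun i =>
    condExp_mul_of_stronglyMeasurable_right (hgm i) (hprod i) (H.integrable_indexIndicator k i)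
  filter_upwards [e ▸ h1, h2] with ω hω1 hω2
  rw [hω1, congrFun e ω, Finset.sum_apply, Finset.sum_apply, Finset.sum_congr rfl fun i _ => hω2 i,
    ← Finset.sum_sub_distrib]
  simp [gradFluct, hg, sub_mul]

lemma integrable_norm_gradFluct_sq (k : ℕ) :
    Integrable (fun ω => ‖gradFluct P ℱ V θ I k ω‖ ^ 2) P ∧
      ∫ ω, ‖gradFluct P ℱ V θ I k ω‖ ^ 2 ∂P ≤ (2 * n) ^ 2 * growthMoment n M₁ M₂ := by
  have hm : Measurable (gradFluct P ℱ V θ I k) := (H.measurable_gradFluct k).mono (ℱ.le _) le_rfl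
  obtain ⟨h1, h2⟩ := H.memLp_of_abs_le (f := fun ω => ‖gradFluct P ℱ V θ I k ω‖) (B := 2 * n)
    (j := 1) hm.norm.aestronglyMeasurable (by norm_num) k (by
      filter_upwards [ae_norm_gradFluct_le k] with ω hω
      rwa [abs_norm, pow_one])
  exact ⟨h1.integrable_sq, h2⟩

/-- Coordinate by coordinate, the outer conditional expectation disappears under the integral, and
the centred stochastic gradient is `gradFluct` almost surely. -/
lemma integral_trace_condCov (k : ℕ) :
    ∫ ω, (condCov P (ℱ k) (stochGrad V θ I k) ω).trace ∂P
      = ∫ ω, ‖gradFluct P ℱ V θ I k ω‖ ^ 2 ∂P := by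
  have hm : Measurable (gradFluct P ℱ V θ I k) := (H.measurable_gradFluct k).mono (ℱ.le _) le_rfl
  have hi : ∀ a, Integrable (fun ω => gradFluct P ℱ V θ I k ω a * gradFluct P ℱ V θ I k ω a) P :=
    fun a => (H.integrable_norm_gradFluct_sq k).1.mono' (by fun_prop) (ae_of_all _ fun ω => by
      rw [norm_mul, pow_two]
      have := PiLp.norm_apply_le (gradFluct P ℱ V θ I k ω) a
      gcongr)
  simp_rw [trace_condCov_eq]
  rw [integral_finsetSum _ fun _ _ => integrable_condExp]
  have e : ∀ ω, ‖gradFluct P ℱ V θ I k ω‖ ^ 2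
      = ∑ a, gradFluct P ℱ V θ I k ω a * gradFluct P ℱ V θ I k ω a := fun ω => by
    rw [EuclideanSpace.real_norm_sq_eq]
    exact Finset.sum_congr rfl fun a _ => pow_two _
  simp_rw [e]
  rw [integral_finsetSum _ fun a _ => hi a]
  refine Finset.sum_congr rfl fun a _ => ?_
  rw [integral_condExp (ℱ.le k)]
  refine integral_congr_ae ?_
  filter_upwards [H.stochGrad_sub_condExp k a] with ω hω
  rw [hω]

lemma integral_gradIncrement_sq_le (k : ℕ) :
    ∫ ω, gradIncrement P ℱ V θ r I ψ k ω ^ 2 ∂P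
      ≤ M₃ ^ 2 * ∫ ω, (condCov P (ℱ k) (stochGrad V θ I k) ω).trace ∂P := by
  rw [H.integral_trace_condCov, ← integral_const_mul]
  refine integral_mono (H.memLp_gradIncrement k).integrable_sq
    ((H.integrable_norm_gradFluct_sq k).1.const_mul _) fun ω => ?_
  have := pow_le_pow_left₀ (abs_nonneg _) (H.bounded.abs_fderiv_apply_le (θ k ω, r k ω)
    (gradFluct P ℱ V θ I k ω)) 2
  rwa [sq_abs, mul_pow] at this

lemma integral_trace_condCov_nonneg (k : ℕ) :
    0 ≤ ∫ ω, (condCov P (ℱ k) (stochGrad V θ I k) ω).trace ∂P := by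
  rw [H.integral_trace_condCov]
  exact integral_nonneg fun ω => sq_nonneg _

lemma integral_trace_condCov_le (k : ℕ) :
    ∫ ω, (condCov P (ℱ k) (stochGrad V θ I k) ω).trace ∂P
      ≤ (2 * n) ^ 2 * growthMoment n M₁ M₂ :=
  (H.integral_trace_condCov k).trans_le (H.integrable_norm_gradFluct_sq k).2

end Fluctuation

end ChainSetup

end EWSG
end

/-! ### Noise increments, the one-step bias and the mean-square bound -/

noncomputable section

namespace EWSG

/-- A bound for the second moment of the noise increments, relative to the step size. -/
def noiseConst (d : ℕ) (γ M : ℝ) : ℝ :=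
  correctedConst d γ M ^ 2 * (2 * γ) * (2 * (∫ z, ‖z‖ ^ 2 ∂(stdGaussian (E d))
    + (∫ z, ‖z‖ ∂(stdGaussian (E d))) ^ 2))

/-- A constant bounding the conditional bias of one step. -/
def biasConst (d n : ℕ) (γ c M : ℝ) : ℝ :=
  stepConst d n γ M + M * (n * (c ^ 2 + n ^ 2 / (2 * γ)))

/-- The one-step bias of the corrected test function. -/
def stepBias {d n : ℕ} {Ω : Type*} {mΩ : MeasurableSpace Ω} (P : Measure Ω) (ℱ : Filtration ℕ mΩ)
    (γ h : ℝ) (J : ℕ) (V : Fin n → E d → ℝ) (θ r : ℕ → Ω → E d) (I : ℕ → Ω → Fin n)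
    (ψ : Phase d → ℝ) (k : ℕ) (ω : Ω) : ℝ :=
  corrected γ h J ψ (θ (k + 1) ω, r (k + 1) ω) - corrected γ h J ψ (θ k ω, r k ω)
    - h * generator γ V ψ (θ k ω, r k ω) - noiseIncrement γ h J V θ r I ψ k ω
    + h * gradIncrement P ℱ V θ r I ψ k ω

namespace ChainSetup

variable {d n : ℕ} {Ω : Type*} {mΩ : MeasurableSpace Ω} {P : Measure Ω} {ℱ : Filtration ℕ mΩ}
  {γ c h M₁ M₂ M₃ : ℝ} {V : Fin n → E d → ℝ} {S : IndexScheme d} {θ r : ℕ → Ω → E d}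
  {I : ℕ → Ω → Fin n} {ξ : ℕ → Ω → E d} {ψ : Phase d → ℝ} {J : ℕ}

/-- Pure algebra, since `stepBias` is by definition what is left over. The time average runs over
`1, …, K`, so the telescoping starts at the state of time `1` and ends at time `K + 1`. -/
lemma sum_generator_eq (K : ℕ) (ω : Ω) :
    h * ∑ k ∈ Finset.range K, generator γ V ψ (θ (k + 1) ω, r (k + 1) ω)
      = (corrected γ h J ψ (θ (K + 1) ω, r (K + 1) ω) - corrected γ h J ψ (θ 1 ω, r 1 ω))
        - ∑ k ∈ Finset.range K, noiseIncrement γ h J V θ r I ψ (k + 1) ω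
        + h * ∑ k ∈ Finset.range K, gradIncrement P ℱ V θ r I ψ (k + 1) ω
        - ∑ k ∈ Finset.range K, stepBias P ℱ γ h J V θ r I ψ (k + 1) ω := by
  have htel := Finset.sum_range_sub
    (fun k => corrected γ h J ψ (θ (k + 1) ω, r (k + 1) ω)) K
  rw [zero_add] at htel
  rw [← htel, Finset.mul_sum, Finset.mul_sum, ← Finset.sum_sub_distrib, ← Finset.sum_add_distrib,
    ← Finset.sum_sub_distrib]
  refine Finset.sum_congr rfl fun k _ => ?_
  unfold stepBias
  ring

section Noise

variable (H : ChainSetup P ℱ γ c h M₁ M₂ M₃ V S θ r I ξ ψ)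

include H

lemma state_succ (k : ℕ) (ω : Ω) : (θ (k + 1) ω, r (k + 1) ω)
    = (θ k ω, r k ω) + driftStep γ h (stochGrad V θ I k ω) (θ k ω, r k ω)
      + (0, √(2 * γ * h) • ξ (k + 1) ω) := by
  have hγ := H.γ_pos
  have e : noiseAmp γ * √h = √(2 * γ * h) := (Real.sqrt_mul (by positivity) h).symm
  refine Prod.ext ?_ ?_
  · simp [driftStep, H.chain.pos_step k ω]
  · simp only [driftStep, H.chain.mom_step k ω, e, stochGrad, Prod.snd_add]
    abel

lemma noiseIncrement_eq (k : ℕ) (ω : Ω) : noiseIncrement γ h J V θ r I ψ k ω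
    = corrected γ h J ψ ((θ k ω, r k ω) + driftStep γ h (stochGrad V θ I k ω) (θ k ω, r k ω)
        + (0, √(2 * γ * h) • ξ (k + 1) ω))
      - smoothed γ h J ψ ((θ k ω, r k ω)
        + driftStep γ h (stochGrad V θ I k ω) (θ k ω, r k ω)) := by
  rw [noiseIncrement, H.state_succ]

lemma measurable_predicted {m : MeasurableSpace Ω} (k : ℕ) (hle : ℱ k ≤ m)
    (hI : Measurable[m] (I k)) :
    Measurable[m] fun ω => (θ k ω, r k ω)
      + driftStep γ h (stochGrad V θ I k ω) (θ k ω, r k ω) := by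
  have hθ : Measurable[m] (θ k) := (H.adapted k).1.mono hle le_rfl
  have hr : Measurable[m] (r k) := (H.adapted k).2.mono hle le_rfl
  have hG := measurable_stochGrad_of (V := V) hθ hI
  exact (hθ.prodMk hr).add
    ((hr.const_smul h).prodMk ((hG.add (hr.const_smul γ)).const_smul h).neg)

lemma measurable_noiseIncrement (hh1 : h ≤ 1) (hJ : 0 < J) (k : ℕ) :
    Measurable[ℱ (k + 1)] (noiseIncrement γ h J V θ r I ψ k) :=
  ((continuous_corrected H.bounded H.γ_pos H.h_pos hh1).measurable.comp
    (H.measurable_state_adapted (k + 1))).sub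
    ((continuous_smoothed H.bounded H.γ_pos H.h_pos hh1 hJ).measurable.comp
      (H.measurable_predicted k (ℱ.mono k.le_succ) (H.chain.index_measurable k)))

lemma abs_corrected_noise_sub_le (hh1 : h ≤ 1) (Y : Phase d) (z : E d) :
    |corrected γ h J ψ (Y + (0, √(2 * γ * h) • z)) - corrected γ h J ψ Y|
      ≤ correctedConst d γ M₃ * √(2 * γ * h) * ‖z‖ := by
  refine (abs_corrected_sub_le H.bounded H.γ_pos H.h_pos hh1 _ _).trans_eq ?_
  rw [add_sub_cancel_left, norm_zero_prod, norm_smul, Real.norm_eq_abs,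
    abs_of_nonneg (Real.sqrt_nonneg _), ← mul_assoc]

lemma integrable_corrected_noise (hh1 : h ≤ 1) (Y : Phase d) :
    Integrable (fun z => corrected γ h J ψ (Y + (0, √(2 * γ * h) • z))) (stdGaussian (E d)) := by
  have := continuous_corrected (J := J) H.bounded H.γ_pos H.h_pos hh1
  exact integrable_of_abs_le (by fun_prop)
    fun z => abs_corrected_le H.bounded H.γ_pos H.h_pos hh1 _

/-- `smoothed` is the Gaussian mean of `corrected`, so the Lipschitz bound can be averaged. This
makes the noise increments `O(√h)` and their variance `O(h)`. -/
lemma abs_smoothed_sub_corrected_le (hh1 : h ≤ 1) (Y : Phase d) :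
    |smoothed γ h J ψ Y - corrected γ h J ψ Y|
      ≤ correctedConst d γ M₃ * √(2 * γ * h) * ∫ z, ‖z‖ ∂(stdGaussian (E d)) := by
  have hi : Integrable (fun z : E d => ‖z‖) (stdGaussian (E d)) := by
    simpa using integrable_norm_pow_stdGaussian (d := d) 1
  have e : smoothed γ h J ψ Y - corrected γ h J ψ Y
      = ∫ z, (corrected γ h J ψ (Y + (0, √(2 * γ * h) • z)) - corrected γ h J ψ Y)
        ∂(stdGaussian (E d)) := by
    rw [integral_sub (H.integrable_corrected_noise hh1 Y) (integrable_const _),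
      integral_corrected_eq_smoothed H.bounded H.γ_pos H.h_pos]
    simp
  rw [e, ← integral_const_mul, ← Real.norm_eq_abs]
  exact norm_integral_le_of_norm_le (hi.const_mul _)
    (ae_of_all _ fun z => H.abs_corrected_noise_sub_le hh1 Y z)

lemma abs_noiseIncrement_le (hh1 : h ≤ 1) (k : ℕ) (ω : Ω) :
    |noiseIncrement γ h J V θ r I ψ k ω| ≤ correctedConst d γ M₃ * √(2 * γ * h)
      * (‖ξ (k + 1) ω‖ + ∫ z, ‖z‖ ∂(stdGaussian (E d))) := by
  rw [H.noiseIncrement_eq]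
  set Y := (θ k ω, r k ω) + driftStep γ h (stochGrad V θ I k ω) (θ k ω, r k ω)
  have h1 := H.abs_corrected_noise_sub_le (J := J) hh1 Y (ξ (k + 1) ω)
  have h2 := H.abs_smoothed_sub_corrected_le (J := J) hh1 Y
  have h3 := abs_sub_le (corrected γ h J ψ (Y + (0, √(2 * γ * h) • ξ (k + 1) ω)))
    (corrected γ h J ψ Y) (smoothed γ h J ψ Y)
  rw [abs_sub_comm (corrected γ h J ψ Y)] at h3
  linarith

lemma integral_norm_noise_sq (k : ℕ) : Integrable (fun ω => ‖ξ (k + 1) ω‖ ^ 2) P ∧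
    ∫ ω, ‖ξ (k + 1) ω‖ ^ 2 ∂P = ∫ z, ‖z‖ ^ 2 ∂(stdGaussian (E d)) := by
  have hm := H.measurable_noise k
  have hi := integrable_norm_pow_stdGaussian (d := d) 2
  rw [← H.chain.noise_law k] at hi ⊢
  have hc : AEStronglyMeasurable (fun z : E d => ‖z‖ ^ 2) (P.map (ξ (k + 1))) := by fun_prop
  exact ⟨(integrable_map_measure hc hm.aemeasurable).1 hi, (integral_map hm.aemeasurable hc).symm⟩

variable [IsProbabilityMeasure P]

lemma memLp_noiseIncrement (hh1 : h ≤ 1) (hJ : 0 < J) (k : ℕ) :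
    MemLp (noiseIncrement γ h J V θ r I ψ k) 2 P ∧
      ∫ ω, noiseIncrement γ h J V θ r I ψ k ω ^ 2 ∂P ≤ noiseConst d γ M₃ * h := by
  have hγ := H.γ_pos
  have hh := H.h_pos
  have hm : AEStronglyMeasurable (noiseIncrement γ h J V θ r I ψ k) P :=
    ((H.measurable_noiseIncrement hh1 hJ k).mono (ℱ.le _) le_rfl).aestronglyMeasurable
  obtain ⟨hi, hint⟩ := H.integral_norm_noise_sq k
  set m := ∫ z, ‖z‖ ∂(stdGaussian (E d)) with hmdef
  set L := correctedConst d γ M₃ with hL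
  have hle : ∀ ω, noiseIncrement γ h J V θ r I ψ k ω ^ 2
      ≤ L ^ 2 * (2 * γ * h) * (2 * (‖ξ (k + 1) ω‖ ^ 2 + m ^ 2)) := fun ω => by
    have h1 := pow_le_pow_left₀ (abs_nonneg _) (H.abs_noiseIncrement_le (J := J) hh1 k ω) 2
    rw [sq_abs, mul_pow, mul_pow, Real.sq_sqrt (by positivity)] at h1
    refine h1.trans ?_
    gcongr
    exact add_sq_le
  have hb : Integrable (fun ω => L ^ 2 * (2 * γ * h) * (2 * (‖ξ (k + 1) ω‖ ^ 2 + m ^ 2))) P :=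
    ((hi.add (integrable_const _)).const_mul 2).const_mul _
  have hsq : Integrable (fun ω => noiseIncrement γ h J V θ r I ψ k ω ^ 2) P :=
    hb.mono' (hm.pow 2) (ae_of_all _ fun ω => by
      rw [Real.norm_eq_abs, abs_of_nonneg (sq_nonneg _)]; exact hle ω)
  refine ⟨(memLp_two_iff_integrable_sq hm).2 hsq, (integral_mono hsq hb hle).trans_eq ?_⟩
  rw [integral_const_mul, integral_const_mul, integral_add hi (integrable_const _), hint]
  simp only [integral_const, probReal_univ, smul_eq_mul, one_mul, noiseConst]
  ring

/-- The point to which the noise is added depends on the current index as well as on the past.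
Freezing both, together with the earlier increment, leaves a function with Gaussian mean zero, by
the definition of `smoothed`. -/
lemma noiseIncrement_orthogonal (hh1 : h ≤ 1) (hJ : 0 < J) {j k : ℕ} (hjk : j < k) :
    ∫ ω, noiseIncrement γ h J V θ r I ψ j ω * noiseIncrement γ h J V θ r I ψ k ω ∂P = 0 := by
  set m : MeasurableSpace Ω := ℱ k ⊔ MeasurableSpace.comap (I k) ⊤ with hm
  have hIm : Measurable[m] (I k) := Measurable.of_comap_le le_sup_right
  have hmle : m ≤ mΩ := sup_le (ℱ.le k) (H.measurable_index k).comap_le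
  have hY : Measurable[m] fun ω => ((θ k ω, r k ω)
      + driftStep γ h (stochGrad V θ I k ω) (θ k ω, r k ω), noiseIncrement γ h J V θ r I ψ j ω) :=
    (H.measurable_predicted k le_sup_left hIm).prodMk
      ((H.measurable_noiseIncrement hh1 hJ j).mono ((ℱ.mono hjk).trans le_sup_left) le_rfl)
  have hc := continuous_corrected (J := J) H.bounded H.γ_pos H.h_pos hh1
  have hs := continuous_smoothed H.bounded H.γ_pos H.h_pos hh1 hJ
  have key := integral_eq_zero_of_indep hmle (H.measurable_noise k) hY (H.chain.noise_indep k)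
    (F := fun p : E d × Phase d × ℝ => p.2.2 * (corrected γ h J ψ (p.2.1
      + (0, √(2 * γ * h) • p.1)) - smoothed γ h J ψ p.2.1)) (by fun_prop) ?_ ?_
  · simp_rw [H.noiseIncrement_eq k]
    exact key
  · have := (H.memLp_noiseIncrement hh1 hJ j).1.integrable_mul
      (H.memLp_noiseIncrement (J := J) hh1 hJ k).1
    refine this.congr (ae_of_all _ fun ω => ?_)
    simp only [Pi.mul_apply, H.noiseIncrement_eq k]
  · intro y
    rw [H.chain.noise_law k]
    simp only
    rw [integral_const_mul, integral_sub (H.integrable_corrected_noise hh1 y.1)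
      (integrable_const _), integral_corrected_eq_smoothed H.bounded H.γ_pos H.h_pos]
    simp

omit [IsProbabilityMeasure P] in
-- Subtracting the noise increment replaces the next corrected value by `smoothed` at the predicted
-- point, so the one-step expansion applies. The error of the stochastic gradient splits into the
-- centred part, which is `gradIncrement`, and the bias of the conditional mean. That bias brings
-- the cube of `growth`, whence sixth moments in mean square.
lemma ae_abs_stepBias_le (hh1 : h ≤ 1) (hJ : 1 ≤ J * h) (k : ℕ) :
    ∀ᵐ ω ∂P, |stepBias P ℱ γ h J V θ r I ψ k ω|
      ≤ biasConst d n γ c M₃ * h ^ 2 * growth V (θ k ω, r k ω) ^ 3 := by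
  have hlaw : ∀ᵐ ω ∂P, ∀ i, (P[indexIndicator I k i | ℱ k]) ω
      = S.prob γ h V (θ k ω, r k ω) i := ae_all_iff.2 fun i => H.chain.index_law k i
  filter_upwards [hlaw] with ω hω
  have hM := H.bounded.nonneg
  have hh := H.h_pos
  have hγ := H.γ_pos
  set X : Phase d := (θ k ω, r k ω) with hX
  have hQ := one_le_growth V X
  set G := stochGrad V θ I k ω with hG
  set mean := ∑ i, S.prob γ h V X i • ((n : ℝ) • gradient (V i) X.1) with hmean
  have hfl : gradFluct P ℱ V θ I k ω = G - mean := by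
    rw [hG, stochGrad_eq_sum, hmean, ← Finset.sum_sub_distrib]
    refine Finset.sum_congr rfl fun i _ => ?_
    rw [hω i, sub_smul]
  have hinc : gradIncrement P ℱ V θ r I ψ k ω
      = inner ℝ (G - gradient (totalPotential V) X.1) (gradMom ψ X)
        - inner ℝ (mean - gradient (totalPotential V) X.1) (gradMom ψ X) := by
    rw [← inner_sub_left, sub_sub_sub_cancel_right, ← hfl, inner_gradMom H.bounded, gradIncrement]
  have h1 := abs_one_step_le (V := V) (n := n) H.bounded H.γ_pos H.h_pos hh1 hJ hQ
    (norm_snd_le_growth V X) (norm_stochGrad_le (V := V) (θ := θ) (r := r) (I := I) k ω)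
  have h2 := abs_inner_bias_le H.bounded H.γ_pos H.h_pos H.differentiable H.admissible H.n_pos X
  have e : stepBias P ℱ γ h J V θ r I ψ k ω
      = (smoothed γ h J ψ (X + driftStep γ h G X) - corrected γ h J ψ X - h * generator γ V ψ X
          + h * inner ℝ (G - gradient (totalPotential V) X.1) (gradMom ψ X))
        - h * inner ℝ (mean - gradient (totalPotential V) X.1) (gradMom ψ X) := by
    rw [stepBias, hinc, noiseIncrement]
    ring
  rw [e]
  refine (abs_sub _ _).trans ((add_le_add h1 ?_).trans (b := stepConst d n γ M₃ * h ^ 2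
    * growth V X ^ 2 + h * (M₃ * (n * (c ^ 2 + n ^ 2 / (2 * γ))) * h * growth V X ^ 3)) ?_)
  · rw [abs_mul, abs_of_pos hh]
    gcongr
  · have hst : 0 ≤ stepConst d n γ M₃ := by unfold stepConst; positivity
    have hp : growth V X ^ 2 ≤ growth V X ^ 3 := pow_le_pow_right₀ hQ (by norm_num)
    calc _ ≤ stepConst d n γ M₃ * h ^ 2 * growth V X ^ 3
          + h * (M₃ * (n * (c ^ 2 + n ^ 2 / (2 * γ))) * h * growth V X ^ 3) := by gcongr
      _ = _ := by unfold biasConst; ring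

omit [IsProbabilityMeasure P] in
lemma measurable_generator_state (k : ℕ) : Measurable fun ω => generator γ V ψ (θ k ω, r k ω) := by
  have h1 := H.bounded.contDiff_fderiv.continuous
  have hp := H.measurable_pos k
  have hr := H.measurable_mom k
  have hg : Measurable fun ω => gradient (totalPotential V) (θ k ω) := measurable_gradient.comp hp
  have hl : Measurable fun ω => laplacianMom ψ (θ k ω, r k ω) :=
    (continuous_laplacianMom H.bounded).measurable.comp (hp.prodMk hr)
  have hc1 : Continuous fun p : Phase d × E d => fderiv ℝ ψ p.1 (p.2, 0) := by fun_prop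
  simp only [generator, inner_gradPos H.bounded, inner_gradMom H.bounded]
  exact ((hc1.measurable.comp ((hp.prodMk hr).prodMk hr)).sub
    (H.bounded.continuous_fderiv_apply.measurable.comp
      ((hp.prodMk hr).prodMk ((hr.const_smul γ).add hg)))).add (hl.const_mul γ)

lemma memLp_generator (k : ℕ) : MemLp (fun ω => generator γ V ψ (θ k ω, r k ω)) 2 P ∧
    ∫ ω, generator γ V ψ (θ k ω, r k ω) ^ 2 ∂P
      ≤ (M₃ * (2 + γ) + γ * (d * M₃)) ^ 2 * growthMoment n M₁ M₂ :=
  H.memLp_of_abs_le (j := 1) (H.measurable_generator_state k).aestronglyMeasurable (by norm_num) k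
    (ae_of_all _ fun ω => by
      rw [pow_one]; exact abs_generator_le H.bounded H.γ_pos H.differentiable _)

lemma memLp_stepBias (hh1 : h ≤ 1) (hJ : 1 ≤ J * h) (k : ℕ) :
    MemLp (stepBias P ℱ γ h J V θ r I ψ k) 2 P ∧
      ∫ ω, stepBias P ℱ γ h J V θ r I ψ k ω ^ 2 ∂P
        ≤ (biasConst d n γ c M₃ * h ^ 2) ^ 2 * growthMoment n M₁ M₂ := by
  have hJ0 : 0 < J := by
    rcases Nat.eq_zero_or_pos J with rfl | hJ0
    · norm_num at hJ
    · exact hJ0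
  have hc := (continuous_corrected (J := J) H.bounded H.γ_pos H.h_pos hh1).measurable
  have h1 : Measurable (noiseIncrement γ h J V θ r I ψ k) :=
    (H.measurable_noiseIncrement hh1 hJ0 k).mono (ℱ.le _) le_rfl
  have h2 : Measurable (gradIncrement P ℱ V θ r I ψ k) :=
    (H.measurable_gradIncrement k).mono (ℱ.le _) le_rfl
  refine H.memLp_of_abs_le ?_ le_rfl k (H.ae_abs_stepBias_le hh1 hJ k)
  exact (((((hc.comp (H.measurable_state (k + 1))).sub (hc.comp (H.measurable_state k))).sub
    ((H.measurable_generator_state k).const_mul h)).sub h1).add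
    (h2.const_mul h)).aestronglyMeasurable

end Noise

section MeanSquare

variable [IsProbabilityMeasure P] (H : ChainSetup P ℱ γ c h M₁ M₂ M₃ V S θ r I ξ ψ)

include H

lemma memLp_sum_generator (K : ℕ) :
    MemLp (fun ω => ∑ k ∈ Finset.range K, generator γ V ψ (θ (k + 1) ω, r (k + 1) ω)) 2 P :=
  memLp_finsetSum _ fun k _ => (H.memLp_generator (k + 1)).1

/-- The a priori bound, without any use of the dynamics. -/
lemma integral_sq_sum_generator_le_apriori (K : ℕ) :
    ∫ ω, (∑ k ∈ Finset.range K, generator γ V ψ (θ (k + 1) ω, r (k + 1) ω)) ^ 2 ∂P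
      ≤ K ^ 2 * ((M₃ * (2 + γ) + γ * (d * M₃)) ^ 2 * growthMoment n M₁ M₂) := by
  have hi : Integrable (fun ω => (K : ℝ) * ∑ k ∈ Finset.range K,
      generator γ V ψ (θ (k + 1) ω, r (k + 1) ω) ^ 2) P :=
    (integrable_finsetSum _ fun k _ => (H.memLp_generator (k + 1)).1.integrable_sq).const_mul _
  refine (integral_mono (H.memLp_sum_generator K).integrable_sq hi fun ω => ?_).trans ?_
  · have := sq_sum_le_card_mul_sum_sq (s := Finset.range K)
      (f := fun k => generator γ V ψ (θ (k + 1) ω, r (k + 1) ω))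
    rwa [Finset.card_range] at this
  · rw [integral_const_mul, integral_finsetSum _ fun k _ =>
      (H.memLp_generator (k + 1)).1.integrable_sq]
    refine (mul_le_mul_of_nonneg_left (Finset.sum_le_sum fun k _ =>
      (H.memLp_generator (k + 1)).2) (Nat.cast_nonneg K)).trans_eq ?_
    rw [Finset.sum_const, Finset.card_range, nsmul_eq_mul]
    ring

lemma integral_sq_sum_generator_le (hh1 : h ≤ 1) (K : ℕ) :
    ∫ ω, (h * ∑ k ∈ Finset.range K, generator γ V ψ (θ (k + 1) ω, r (k + 1) ω)) ^ 2 ∂P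
      ≤ 4 * ((2 * correctedConst d γ M₃) ^ 2 + K * (noiseConst d γ M₃ * h)
        + h ^ 2 * (M₃ ^ 2 * ∑ k ∈ Finset.range K,
          ∫ ω, (condCov P (ℱ (k + 1)) (stochGrad V θ I (k + 1)) ω).trace ∂P)
        + K ^ 2 * ((biasConst d n γ c M₃ * h ^ 2) ^ 2 * growthMoment n M₁ M₂)) := by
  have hh := H.h_pos
  -- Any `J ≥ 1/h` would do, since the bounds on the corrected function do not involve `J`.
  obtain ⟨J, hJ0, hJ⟩ : ∃ J : ℕ, 0 < J ∧ 1 ≤ J * h := by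
    refine ⟨⌈1 / h⌉₊, Nat.ceil_pos.2 (by positivity), ?_⟩
    have := Nat.le_ceil (1 / h)
    rwa [div_le_iff₀ hh] at this
  set A : Ω → ℝ := fun ω => corrected γ h J ψ (θ (K + 1) ω, r (K + 1) ω)
    - corrected γ h J ψ (θ 1 ω, r 1 ω) with hA
  set N : Ω → ℝ := fun ω => ∑ k ∈ Finset.range K, noiseIncrement γ h J V θ r I ψ (k + 1) ω with hN
  set D : Ω → ℝ := fun ω => ∑ k ∈ Finset.range K, gradIncrement P ℱ V θ r I ψ (k + 1) ω with hD
  set R : Ω → ℝ := fun ω => ∑ k ∈ Finset.range K, stepBias P ℱ γ h J V θ r I ψ (k + 1) ω with hR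
  have hc := (continuous_corrected (J := J) H.bounded H.γ_pos hh hh1).measurable
  have hAm : Measurable A :=
    (hc.comp (H.measurable_state (K + 1))).sub (hc.comp (H.measurable_state 1))
  have hAb : ∀ ω, A ω ^ 2 ≤ (2 * correctedConst d γ M₃) ^ 2 := fun ω => by
    have h1 := abs_corrected_le (J := J) H.bounded H.γ_pos hh hh1 (θ (K + 1) ω, r (K + 1) ω)
    have h2 := abs_corrected_le (J := J) H.bounded H.γ_pos hh hh1 (θ 1 ω, r 1 ω)
    have h3 : |A ω| ≤ 2 * correctedConst d γ M₃ := (abs_sub _ _).trans (by linarith)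
    have := pow_le_pow_left₀ (abs_nonneg _) h3 2
    rwa [sq_abs] at this
  have hAi : Integrable (fun ω => A ω ^ 2) P :=
    Integrable.of_bound (hAm.pow_const 2).aestronglyMeasurable _ (ae_of_all _ fun ω => by
      rw [Real.norm_eq_abs, abs_of_nonneg (sq_nonneg _)]; exact hAb ω)
  have hNL : MemLp N 2 P := memLp_finsetSum _ fun k _ => (H.memLp_noiseIncrement hh1 hJ0 (k + 1)).1
  have hDL : MemLp D 2 P := memLp_finsetSum _ fun k _ => H.memLp_gradIncrement (k + 1)
  have hRL : MemLp R 2 P := memLp_finsetSum _ fun k _ => (H.memLp_stepBias hh1 hJ (k + 1)).1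
  have hNb : ∫ ω, N ω ^ 2 ∂P ≤ K * (noiseConst d γ M₃ * h) := by
    rw [hN, integral_sq_sum_of_orthogonal
      (N := fun k ω => noiseIncrement γ h J V θ r I ψ (k + 1) ω)
      (fun k => (H.memLp_noiseIncrement hh1 hJ0 (k + 1)).1)
      (fun j k hjk => H.noiseIncrement_orthogonal hh1 hJ0 (Nat.succ_lt_succ hjk))]
    refine (Finset.sum_le_sum fun k _ => (H.memLp_noiseIncrement hh1 hJ0 (k + 1)).2).trans_eq ?_
    rw [Finset.sum_const, Finset.card_range, nsmul_eq_mul]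
  have hDb : ∫ ω, D ω ^ 2 ∂P ≤ M₃ ^ 2 * ∑ k ∈ Finset.range K,
      ∫ ω, (condCov P (ℱ (k + 1)) (stochGrad V θ I (k + 1)) ω).trace ∂P := by
    rw [hD, integral_sq_sum_of_orthogonal
      (N := fun k ω => gradIncrement P ℱ V θ r I ψ (k + 1) ω)
      (fun k => H.memLp_gradIncrement (k + 1))
      (fun j k hjk => H.gradIncrement_orthogonal (Nat.succ_lt_succ hjk)), Finset.mul_sum]
    exact Finset.sum_le_sum fun k _ => H.integral_gradIncrement_sq_le (k + 1)
  have hRb : ∫ ω, R ω ^ 2 ∂P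
      ≤ K ^ 2 * ((biasConst d n γ c M₃ * h ^ 2) ^ 2 * growthMoment n M₁ M₂) := by
    have hi : Integrable (fun ω => (K : ℝ) * ∑ k ∈ Finset.range K,
        stepBias P ℱ γ h J V θ r I ψ (k + 1) ω ^ 2) P :=
      (integrable_finsetSum _ fun k _ =>
        (H.memLp_stepBias hh1 hJ (k + 1)).1.integrable_sq).const_mul _
    refine (integral_mono hRL.integrable_sq hi fun ω => ?_).trans ?_
    · have := sq_sum_le_card_mul_sum_sq (s := Finset.range K)
        (f := fun k => stepBias P ℱ γ h J V θ r I ψ (k + 1) ω)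
      rwa [Finset.card_range] at this
    · rw [integral_const_mul, integral_finsetSum _ fun k _ =>
        (H.memLp_stepBias hh1 hJ (k + 1)).1.integrable_sq]
      refine (mul_le_mul_of_nonneg_left (Finset.sum_le_sum fun k _ =>
        (H.memLp_stepBias hh1 hJ (k + 1)).2) (Nat.cast_nonneg K)).trans_eq ?_
      rw [Finset.sum_const, Finset.card_range, nsmul_eq_mul]
      ring
  have hAI : ∫ ω, A ω ^ 2 ∂P ≤ (2 * correctedConst d γ M₃) ^ 2 := by
    refine (integral_mono hAi (integrable_const _) hAb).trans_eq ?_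
    simp
  -- Cauchy–Schwarz for four summands; the six squares are their pairwise differences, with signs.
  -- Orthogonality is thus needed only within each of the two families of increments.
  have hpt : ∀ ω, (h * ∑ k ∈ Finset.range K, generator γ V ψ (θ (k + 1) ω, r (k + 1) ω)) ^ 2
      ≤ 4 * (A ω ^ 2 + N ω ^ 2 + h ^ 2 * D ω ^ 2 + R ω ^ 2) := fun ω => by
    rw [sum_generator_eq (P := P) (ℱ := ℱ) (I := I) (J := J)]
    change (A ω - N ω + h * D ω - R ω) ^ 2 ≤ _
    nlinarith [sq_nonneg (A ω + N ω), sq_nonneg (A ω - h * D ω), sq_nonneg (A ω + R ω),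
      sq_nonneg (N ω + h * D ω), sq_nonneg (N ω - R ω), sq_nonneg (h * D ω + R ω)]
  have hiAN : Integrable (fun ω => A ω ^ 2 + N ω ^ 2) P := hAi.add hNL.integrable_sq
  have hiD : Integrable (fun ω => h ^ 2 * D ω ^ 2) P := hDL.integrable_sq.const_mul _
  have hiAND : Integrable (fun ω => A ω ^ 2 + N ω ^ 2 + h ^ 2 * D ω ^ 2) P := hiAN.add hiD
  have hi : Integrable (fun ω => 4 * (A ω ^ 2 + N ω ^ 2 + h ^ 2 * D ω ^ 2 + R ω ^ 2)) P :=
    (hiAND.add hRL.integrable_sq).const_mul 4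
  refine (integral_mono ((H.memLp_sum_generator K).const_mul h).integrable_sq hi hpt).trans ?_
  rw [integral_const_mul, integral_add hiAND hRL.integrable_sq, integral_add hiAN hiD,
    integral_add hAi hNL.integrable_sq, integral_const_mul]
  gcongr

end MeanSquare

end ChainSetup

end EWSG
end

/-! ### Assembly of the constants and the main theorem -/

noncomputable section

namespace EWSG

lemma timeAverage_sub_eq {d n : ℕ} {Ω : Type*} {γ φbar : ℝ} {V : Fin n → E d → ℝ}
    {φ ψ : Phase d → ℝ} (hψ : ∀ X, generator γ V ψ X = φ X - φbar) (θ r : ℕ → Ω → E d) {K : ℕ}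
    (hK : 0 < K) (ω : Ω) : timeAverage φ θ r K ω - φbar
      = (1 / (K : ℝ)) * ∑ k ∈ Finset.range K, generator γ V ψ (θ (k + 1) ω, r (k + 1) ω) := by
  have hK' : (K : ℝ) ≠ 0 := by positivity
  simp only [hψ, Finset.sum_sub_distrib, Finset.sum_const, Finset.card_range, nsmul_eq_mul,
    timeAverage]
  rw [← Finset.Ico_add_one_right_eq_Icc, Finset.sum_Ico_eq_sum_range, mul_sub,
    ← mul_assoc, one_div_mul_cancel hK', one_mul]
  simp [add_comm 1]

/-- The constants in front of `1 / T`, `h / T` and `h ^ 2` when the bound of the dynamics, valid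
for `h ≤ 1`, is combined with an a priori bound. -/
lemma div_sq_le_of_bounds {K h T Q C₀ A N D₀ D B R : ℝ} (hK : 0 < K) (hh : 0 < h) (hT : T = K * h)
    (hC₀ : 0 ≤ C₀) (hA : 0 ≤ A) (hN : 0 ≤ N) (hD₀ : 0 ≤ D₀) (hD : 0 ≤ D) (hB : 0 ≤ B)
    (hR : 0 ≤ R) (hapriori : Q ≤ K ^ 2 * C₀)
    (hdyn : h ≤ 1 → h ^ 2 * Q ≤ 4 * (A + K * (N * h) + h ^ 2 * (D₀ * (D + B))
      + K ^ 2 * (R * h ^ 4))) :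
    Q / K ^ 2 ≤ (4 * (A + N + D₀ * B) + C₀ + 1) * (1 / T) + (4 * D₀ + 1) * (h / T) * (D / K)
      + (4 * R + C₀ + 1) * h ^ 2 := by
  have hT0 : 0 < T := hT ▸ mul_pos hK hh
  have h0 : Q / K ^ 2 ≤ C₀ := by
    rw [div_le_iff₀ (by positivity)]
    linarith
  have hCA : C₀ ≤ 4 * (A + N + D₀ * B) + C₀ + 1 := by
    have := mul_nonneg hD₀ hB
    linarith
  have hCR : C₀ ≤ 4 * R + C₀ + 1 := by linarith
  -- Outside `h ≤ 1 ≤ T` the a priori bound suffices: `C₀ ≤ C₀ h ^ 2` if `h > 1`, and `C₀ ≤ C₀ / T`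
  -- if `T < 1`.
  rcases lt_or_ge 1 h with h1 | h1
  · have : C₀ * 1 ≤ (4 * R + C₀ + 1) * h ^ 2 :=
      mul_le_mul hCR (one_le_pow₀ h1.le) zero_le_one (by positivity)
    have h2 : 0 ≤ (4 * (A + N + D₀ * B) + C₀ + 1) * (1 / T)
      + (4 * D₀ + 1) * (h / T) * (D / K) := by positivity
    linarith
  rcases lt_or_ge T 1 with hT1 | hT1
  · have : C₀ * 1 ≤ (4 * (A + N + D₀ * B) + C₀ + 1) * (1 / T) :=
      mul_le_mul hCA ((one_le_div hT0).2 hT1.le) zero_le_one (by positivity)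
    have h2 : 0 ≤ (4 * D₀ + 1) * (h / T) * (D / K) + (4 * R + C₀ + 1) * h ^ 2 := by positivity
    linarith
  have hsq : 1 / T ^ 2 ≤ 1 / T := by
    rw [one_div_le_one_div (by positivity) hT0]
    nlinarith
  -- This absorbs the term with `B`, one extra covariance, into the `1 / T` term.
  have hh2 : h ^ 2 * (1 / T ^ 2) ≤ 1 / T :=
    (mul_le_of_le_one_left (by positivity) (pow_le_one₀ hh.le h1)).trans hsq
  have e : Q / K ^ 2 = h ^ 2 * Q * (1 / T ^ 2) := by
    rw [hT]; field_simp
  have e1 : K * (N * h) * (1 / T ^ 2) = N * (1 / T) := by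
    rw [hT]; field_simp
  have e2 : h ^ 2 * (1 / T ^ 2) * D = h / T * (D / K) := by
    rw [hT]; field_simp
  have e3 : K ^ 2 * (R * h ^ 4) * (1 / T ^ 2) = R * h ^ 2 := by
    rw [hT]; field_simp
  calc Q / K ^ 2 ≤ 4 * (A + K * (N * h) + h ^ 2 * (D₀ * (D + B)) + K ^ 2 * (R * h ^ 4))
        * (1 / T ^ 2) := by
        rw [e]
        exact mul_le_mul_of_nonneg_right (hdyn h1) (by positivity)
    _ = 4 * (A * (1 / T ^ 2) + K * (N * h) * (1 / T ^ 2)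
        + D₀ * (h ^ 2 * (1 / T ^ 2) * D) + D₀ * B * (h ^ 2 * (1 / T ^ 2))
        + K ^ 2 * (R * h ^ 4) * (1 / T ^ 2)) := by ring
    _ ≤ 4 * (A * (1 / T) + N * (1 / T) + D₀ * (h / T * (D / K)) + D₀ * B * (1 / T)
        + R * h ^ 2) := by
        rw [e1, e2, e3]
        gcongr
    _ ≤ _ := by
        have h3 : 0 ≤ (C₀ + 1) * (1 / T) + h / T * (D / K) + (C₀ + 1) * h ^ 2 := by positivity
        linarith

end EWSG
end

theorem theorem3 (d n : ℕ) (hn : 0 < n) (γ c M₁ M₂ M₃ : ℝ) (hγ : 0 < γ) (hc : 0 ≤ c) :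
    ∃ C₁ C₂ C₃ : ℝ, 0 < C₁ ∧ 0 < C₂ ∧ 0 < C₃ ∧
      ∀ (V : Fin n → EWSG.E d → ℝ) (φ ψ : EWSG.Phase d → ℝ) (φbar h : ℝ)
        (S : EWSG.IndexScheme d)
        {Ω : Type*} {mΩ : MeasurableSpace Ω} (P : Measure Ω) [IsProbabilityMeasure P]
        (ℱ : Filtration ℕ mΩ) (θ r : ℕ → Ω → EWSG.E d) (I : ℕ → Ω → Fin n)
        (ξ : ℕ → Ω → EWSG.E d),
        -- the target distribution and the posterior average
        (∀ i, Differentiable ℝ (V i)) →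
        Integrable (fun θ => Real.exp (-EWSG.totalPotential V θ)) →
        Integrable φ (EWSG.gibbs V) →
        φbar = ∫ X, φ X ∂(EWSG.gibbs V) →
        -- the chain
        0 < h →
        S.Admissible c h →
        EWSG.IsSGLangevinChain P ℱ γ h V S θ r I ξ →
        -- moment bounds along the chain
        (∀ l ∈ Finset.Icc 1 12, ∀ i k,
          Integrable (fun ω => ‖gradient (V i) (θ k ω)‖ ^ l) P ∧
            ∫ ω, ‖gradient (V i) (θ k ω)‖ ^ l ∂P < M₁) →
        (∀ l ∈ Finset.Icc 1 12, ∀ k,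
          Integrable (fun ω => ‖r k ω‖ ^ l) P ∧ ∫ ω, ‖r k ω‖ ^ l ∂P < M₂) →
        -- the solution of the Poisson equation
        ContDiff ℝ 3 ψ →
        (∀ X, EWSG.generator γ V ψ X = φ X - φbar) →
        (∀ l ∈ Finset.range 4, ∀ X, ‖iteratedFDeriv ℝ l ψ X‖ < M₃) →
        ∀ K : ℕ, 0 < K → ∀ T : ℝ, T = K * h →
          Integrable (fun ω => (EWSG.timeAverage φ θ r K ω - φbar) ^ 2) P ∧
          (∀ k, Integrable (fun ω =>
            (EWSG.condCov P (ℱ k) (EWSG.stochGrad V θ I k) ω).trace) P) ∧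
          ∫ ω, (EWSG.timeAverage φ θ r K ω - φbar) ^ 2 ∂P
            ≤ C₁ * (1 / T)
              + C₂ * (h / T) * ((∑ k ∈ Finset.range K,
                  ∫ ω, (EWSG.condCov P (ℱ k) (EWSG.stochGrad V θ I k) ω).trace ∂P) / K)
              + C₃ * h ^ 2 := by
  -- The constants are fixed before any chain is given, when the signs of the `M`'s are unknown;
  -- absolute values make every constant nonnegative.
  set Q₀ := EWSG.growthMoment n |M₁| |M₂| with hQ₀
  set C₀ := (|M₃| * (2 + γ) + γ * (d * |M₃|)) ^ 2 * Q₀ with hC₀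
  set A := (2 * EWSG.correctedConst d γ |M₃|) ^ 2 with hA
  set N := EWSG.noiseConst d γ |M₃| with hN
  set B := (2 * (n : ℝ)) ^ 2 * Q₀ with hB
  set R := EWSG.biasConst d n γ c |M₃| ^ 2 * Q₀ with hR
  have Q₀_nonneg : 0 ≤ Q₀ := by rw [hQ₀, EWSG.growthMoment]; positivity
  have C₀_nonneg : 0 ≤ C₀ := by positivity
  have A_nonneg : 0 ≤ A := sq_nonneg _
  have N_nonneg : 0 ≤ N := by
    have : 0 ≤ ∫ z, ‖z‖ ^ 2 ∂(stdGaussian (EWSG.E d)) := integral_nonneg fun _ => by positivity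
    rw [hN, EWSG.noiseConst]
    positivity
  have B_nonneg : 0 ≤ B := by positivity
  have R_nonneg : 0 ≤ R := by positivity
  -- The `4` comes from squaring four summands, `C₀` covers the ranges `h > 1` and `T < 1`, and the
  -- `1` ensures strict positivity.
  refine ⟨4 * (A + N + |M₃| ^ 2 * B) + C₀ + 1, 4 * |M₃| ^ 2 + 1, 4 * R + C₀ + 1, by positivity,
    by positivity, by positivity, ?_⟩
  intro V φ ψ φbar h S Ω mΩ P _ ℱ θ r I ξ hV _ _ _ hh hS hchain hgrad hmom hψ hpoisson hbound
    K hK T hT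
  have H : EWSG.ChainSetup P ℱ γ c h |M₁| |M₂| |M₃| V S θ r I ξ ψ :=
    { n_pos := hn
      γ_pos := hγ
      h_pos := hh
      differentiable := hV
      admissible := hS
      chain := hchain
      grad_integrable := fun i k => (hgrad 6 (by simp) i k).1
      grad_le := fun i k => (hgrad 6 (by simp) i k).2.le.trans (le_abs_self M₁)
      mom_integrable := fun k => (hmom 6 (by simp) k).1
      mom_le := fun k => (hmom 6 (by simp) k).2.le.trans (le_abs_self M₂)
      bounded := ⟨hψ, fun l hl X => (hbound l hl X).le.trans (le_abs_self M₃)⟩ }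
  have hK' : (0 : ℝ) < K := Nat.cast_pos.2 hK
  simp only [EWSG.timeAverage_sub_eq hpoisson θ r hK]
  refine ⟨((H.memLp_sum_generator K).const_mul _).integrable_sq,
    EWSG.ChainSetup.integrable_trace_condCov, ?_⟩
  simp only [mul_pow, integral_const_mul, one_div, inv_pow]
  rw [inv_mul_eq_div, ← one_div]
  refine EWSG.div_sq_le_of_bounds hK' hh hT C₀_nonneg A_nonneg N_nonneg (sq_nonneg _)
    (Finset.sum_nonneg fun k _ => H.integral_trace_condCov_nonneg k) B_nonneg R_nonneg
    (H.integral_sq_sum_generator_le_apriori K) fun h1 => ?_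
  have hdyn := H.integral_sq_sum_generator_le h1 K
  simp only [mul_pow, integral_const_mul] at hdyn
  -- The telescoping produces the covariances of the iterations `1, …, K`, whereas the claim has `0,
  -- …, K - 1`. Term `0` is nonnegative and term `K` is at most `B` by the moment bounds.
  have hshift : ∑ k ∈ Finset.range K,
        ∫ ω, (EWSG.condCov P (ℱ (k + 1)) (EWSG.stochGrad V θ I (k + 1)) ω).trace ∂P
      ≤ ∑ k ∈ Finset.range K,
        ∫ ω, (EWSG.condCov P (ℱ k) (EWSG.stochGrad V θ I k) ω).trace ∂P + B := by
    have e := (Finset.sum_range_succ' (fun k =>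
      ∫ ω, (EWSG.condCov P (ℱ k) (EWSG.stochGrad V θ I k) ω).trace ∂P) K).symm.trans
      (Finset.sum_range_succ _ K)
    have h0 := H.integral_trace_condCov_nonneg 0
    have h2 := H.integral_trace_condCov_le K
    linarith
  refine hdyn.trans ?_
  have e : ((K : ℝ) ^ 2 * (EWSG.biasConst d n γ c |M₃| ^ 2 * (h ^ 2) ^ 2 * Q₀))
      = K ^ 2 * (R * h ^ 4) := by rw [hR]; ring
  rw [hA, mul_pow, ← e]
  gcongr
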